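/- **Setting.** Let $c\in\mathbb R$. For $\varepsilon\ge 0$ and a function $f$ on $[0,\infty)$ (the restriction of $h=h(u,r)$ to a cone $u=\text{const}$) put $$\overline f_\varepsilon(r)=\frac1{r+\varepsilon}\int_0^r f\,ds,\qquad \nu+\lambda=-4\pi\int_r^\infty\frac{(f-\overline f_\varepsilon)^2}{s+\varepsilon}\,ds,\qquad g=\big(1-4\pi c^2(r+\varepsilon)^2\overline f_\varepsilon^{\,2}\big)e^{\nu+\lambda},\qquad \overline g(r)=\frac1{r+\varepsilon}\int_0^r g\,ds,$$ and let $m=\frac{r+\varepsilon}{2}\big(1-\overline g\,e^{-(\nu+\lambda)}\big)$ be the Hawking mass. Let $\mathcal O=\{(u,r): u\ge 0,\ r>0\}$. Let $h_0\in C^1([0,\infty))$ be initial data such that (all quantities for $\varepsilon=0$) the integral $\int_0^\infty (h_0-\overline{h_0})^2\,\frac{ds}{s}$ is finite, $\overline g>0$ on $(0,\infty)$, and the Bondi mass $\lim_{r\to\infty}m(r)$ exists and is finite. For $\varepsilon\in(0,1)$, a global classical solution $h_\varepsilon$ of the $\varepsilon$-regularized problem is a function $h_\varepsilon\in C^1([0,\infty)^2)$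 with $h_\varepsilon(0,\cdot)=h_0$, whose coefficient $\nu_\varepsilon+\lambda_\varepsilon$ is given by convergent integrals and is continuous on $[0,\infty)^2$, and which satisfies $$\partial_uh_\varepsilon-\tfrac12\overline g_\varepsilon\,\partial_rh_\varepsilon=\frac{(g_\varepsilon-\overline g_\varepsilon)(h_\varepsilon-\overline h_\varepsilon)}{2(r+\varepsilon)}-\frac{c^2}{2}(r+\varepsilon)\,e^{\nu_\varepsilon+\lambda_\varepsilon}\,\overline h_\varepsilon .$$ Put $\xi_\varepsilon(u,r)=\int_0^r\overline g_\varepsilon\frac{h_\varepsilon-\overline h_\varepsilon}{s+\varepsilon}\,ds-c^2\int_0^r(s+\varepsilon)\,\overline h_\varepsilon\, e^{\nu_\varepsilon+\lambda_\varepsilon}\,ds$. A *limiting generalized solution* is a function $h$ on $\mathcal O$ for which there are $\varepsilon_n\in(0,1)$, $\varepsilon_n\to0$, and global classical solutions $h_{\varepsilon_n}$ of the $\varepsilon_n$-regularized problems with data $h_0$ such that $h_{\varepsilon_n}$, $\overline h_{\varepsilon_n}$, $\partial_rh_{\varepsilon_n}$ converge, uniformly on compact subsets of $\mathcal O$, to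 $h$, $\overline h$, $\partial_r h$, respectively. For such an $h$, with $\nu+\lambda$ and $\overline g$ computed from $h$ with $\varepsilon=0$, set $$\xi(u,r)=\lim_{\delta\to0^+}\Big(\int_\delta^r\overline g\,\frac{h-\overline h}{s}\,ds-c^2\int_\delta^rs\,\overline h\,e^{\nu+\lambda}\,ds\Big).$$ **Proposition 7.2.** Let $h$ be a limiting generalized solution. 1. For almost every $u\ge0$ the limit defining $\xi(u,r)$ exists for every $r>0$, and $\xi$ is the weak limit of the $\xi_{\varepsilon_n}$: for every continuous $\varphi$ with compact support contained in $\mathcal O$, the function $\xi\varphi$ is integrable on $\mathcal O$ and $\iint_{\mathcal O}\xi_{\varepsilon_n}\varphi\,du\,dr\to\iint_{\mathcal O}\xi\varphi\,du\,dr$. 2. For almost every $u\ge0$ the function $r\mapsto \xi/\sqrt{e^{\nu+\lambda}}\,(u,r)$ is continuous on $(0,\infty)$ and tends to $0$ as $r\to0$. 3. For every $u_0>0$: for each $r>0$ one has $\xi/\sqrt{e^{\nu+\lambda}}\,(\cdot,r)\in L^2(0,u_0)$; the supremum $$\sup_{r>0}\Big|\frac{\xi}{\max\{1,r\}\sqrt{e^{\nu+\lambda}}}\Big|$$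 is finite for almost every $u\in(0,u_0)$ and belongs to $L^2(0,u_0)$ as a function of $u$; and $$\lim_{r\to0}\int_0^{u_0}\frac{\xi^2}{e^{\nu+\lambda}}(u,r)\,du=0 .$$ -/

import Mathlib

open Set Filter Topology MeasureTheory

/-! The spherically symmetric Einstein--Klein-Gordon system in Bondi coordinates `(u, r)`.
A function `h (u, r)` is written `h : ℝ → ℝ → ℝ`; only its values on `u ≥ 0`, `r ≥ 0` matter.
The metric coefficients on the light cone `u` depend only on the profile `f = h u`.
All of them carry the regularization parameter `ε` of the mean value; `ε = 0` gives the
original, unregularized quantities. -/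

namespace EKG

noncomputable section

/-- The (regularized) mean value `(r + ε)⁻¹ ∫₀ʳ f ds`. -/
def mean (ε : ℝ) (f : ℝ → ℝ) (r : ℝ) : ℝ := (1 / (r + ε)) * ∫ s in (0 : ℝ)..r, f s

/-- The exponent `ν + λ = -4π ∫_r^∞ (f - f̄)² / (s + ε) ds`. -/
def nuLam (ε : ℝ) (f : ℝ → ℝ) (r : ℝ) : ℝ :=
  -(4 * Real.pi) * ∫ s in Ioi r, (f s - mean ε f s) ^ 2 / (s + ε)

/-- The metric coefficient `e^{ν + λ}`. -/
def expNuLam (ε : ℝ) (f : ℝ → ℝ) (r : ℝ) : ℝ := Real.exp (nuLam ε f r)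

/-- `g = (1 - 4 c² π (r + ε)² f̄²) e^{ν + λ}`. -/
def gCoef (c ε : ℝ) (f : ℝ → ℝ) (r : ℝ) : ℝ :=
  (1 - 4 * c ^ 2 * Real.pi * (r + ε) ^ 2 * mean ε f r ^ 2) * expNuLam ε f r

/-- `ḡ = e^{ν - λ}`, the mean value of `g`. -/
def gBar (c ε : ℝ) (f : ℝ → ℝ) (r : ℝ) : ℝ := mean ε (gCoef c ε f) r

/-- The Hawking mass `m = (r + ε)/2 · (1 - ḡ / e^{ν + λ})`. -/
def hawkingMass (c ε : ℝ) (f : ℝ → ℝ) (r : ℝ) : ℝ :=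
  (r + ε) / 2 * (1 - gBar c ε f r / expNuLam ε f r)

/-- The regularized function `ξ_ε`. -/
def xiReg (c ε : ℝ) (f : ℝ → ℝ) (r : ℝ) : ℝ :=
  (∫ s in (0 : ℝ)..r, gBar c ε f s * ((f s - mean ε f s) / (s + ε)))
    - c ^ 2 * ∫ s in (0 : ℝ)..r, (s + ε) * mean ε f s * expNuLam ε f s

/-- The expression, truncated at distance `δ` from the center, whose limit as `δ → 0` is `ξ`
(unregularized coefficients). -/
def xiTrunc (c : ℝ) (f : ℝ → ℝ) (r δ : ℝ) : ℝ :=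
  (∫ s in δ..r, gBar c 0 f s * ((f s - mean 0 f s) / s))
    - c ^ 2 * ∫ s in δ..r, s * mean 0 f s * expNuLam 0 f s

/-- `ξ = lim_{δ → 0} (∫_δ^r ḡ (f - f̄)/s ds - c² ∫_δ^r s f̄ e^{ν + λ} ds)`. -/
def xi (c : ℝ) (f : ℝ → ℝ) (r : ℝ) : ℝ := limUnder (𝓝[>] (0 : ℝ)) (xiTrunc c f r)

/-- The spacetime domain `u ≥ 0`, `r > 0`. -/
def domain : Set (ℝ × ℝ) := Ici 0 ×ˢ Ioi 0

/-- Initial data on the cone `u = 0`: continuously differentiable up to the center, with a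
well-defined metric (convergence of the integral defining `ν + λ`, positivity of
`ḡ = e^{ν - λ}`), and with finite Bondi mass. -/
structure InitialData (c : ℝ) (h₀ : ℝ → ℝ) : Prop where
  contDiff : ContDiffOn ℝ 1 h₀ (Ici 0)
  integrable : IntegrableOn (fun s => (h₀ s - mean 0 h₀ s) ^ 2 / s) (Ioi 0)
  gBar_pos : ∀ r, 0 < r → 0 < gBar c 0 h₀ r
  finite_bondi_mass : ∃ M : ℝ, Tendsto (hawkingMass c 0 h₀) atTop (𝓝 M)

/-- Global classical solutions of the `ε`-regularized reduced Einstein equation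
`∂_u h - ½ ḡ ∂_r h = (g - ḡ)(h - h̄) / (2 (r + ε)) - (c²/2) (r + ε) e^{ν + λ} h̄`
with data `h₀`: `h` is continuously differentiable on `[0, ∞) × [0, ∞)` and its coefficients are
well defined and continuous there. -/
structure IsRegularizedSolution (c ε : ℝ) (h₀ : ℝ → ℝ) (h : ℝ → ℝ → ℝ) : Prop where
  contDiff : ContDiffOn ℝ 1 (fun p : ℝ × ℝ => h p.1 p.2) (Ici 0 ×ˢ Ici 0)
  integrable : ∀ u, 0 ≤ u →
    IntegrableOn (fun s => (h u s - mean ε (h u) s) ^ 2 / (s + ε)) (Ioi 0)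
  continuous_coef :
    ContinuousOn (fun p : ℝ × ℝ => nuLam ε (h p.1) p.2) (Ici 0 ×ˢ Ici 0)
  initial : ∀ r, 0 ≤ r → h 0 r = h₀ r
  evolution : ∀ u r, 0 ≤ u → 0 ≤ r →
    derivWithin (fun v => h v r) (Ici 0) u
        - 1 / 2 * gBar c ε (h u) r * derivWithin (fun s => h u s) (Ici 0) r
      = 1 / (2 * (r + ε)) * (gCoef c ε (h u) r - gBar c ε (h u) r)
            * (h u r - mean ε (h u) r)
          - c ^ 2 / 2 * (r + ε) * expNuLam ε (h u) r * mean ε (h u) r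

/-- Uniform convergence on the compact subsets of the spacetime domain `u ≥ 0`, `r > 0`. -/
def TendstoOnCompacts (F : ℕ → ℝ → ℝ → ℝ) (f : ℝ → ℝ → ℝ) : Prop :=
  ∀ K : Set (ℝ × ℝ), IsCompact K → K ⊆ domain →
    TendstoUniformlyOn (fun n (p : ℝ × ℝ) => F n p.1 p.2) (fun p : ℝ × ℝ => f p.1 p.2) atTop K

/-- `h` is a limiting generalized solution with data `h₀`: the limit of global classical
solutions `hε n` of the `ε n`-regularized problems along some sequence `ε n → 0`; here `h`, its
mean value and its radial derivative are the limits, uniform on compact subsets of the domain, of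
those of `hε n`. -/
structure IsLimitingSolution (c : ℝ) (h₀ : ℝ → ℝ) (ε : ℕ → ℝ) (hε : ℕ → ℝ → ℝ → ℝ)
    (h : ℝ → ℝ → ℝ) : Prop where
  eps_mem : ∀ n, ε n ∈ Ioo (0 : ℝ) 1
  eps_tendsto : Tendsto ε atTop (𝓝 0)
  solution : ∀ n, IsRegularizedSolution c (ε n) h₀ (hε n)
  tendsto : TendstoOnCompacts hε h
  tendsto_mean : TendstoOnCompacts (fun n u r => mean (ε n) (hε n u) r)
    (fun u r => mean 0 (h u) r)
  tendsto_deriv : TendstoOnCompacts (fun n u r => deriv (hε n u) r) (fun u r => deriv (h u) r)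

end

end EKG

/-! Write ρ = r + ε, E = e^{ν+λ}, K = h - h̄, and w = ρ ḡ / E = ρ - 2m. The argument rests on the
mass balance along r = const, namely ∂_u w = (2π / E)(ξ_ε² - (ḡ K)²) (`hasDerivAt_wCoef_left`). It
makes ξ_ε²/E integrable in u at every fixed r > 0: since 0 ≤ m, the integral over (0, u₀) is at most
that of the flux (ḡ K)²/E plus m(0, r)/π.

These bounds have to be uniform in ε. For small ε, the data give w > 0 and m ≤ C on the initial cone
(`exists_uniform_bound`). Discarding ξ_ε² in the balance propagates w > 0 in u, and m does not
increase along dr/du = -1/2, so m ≤ C everywhere. The mass bound controls the tail of the integral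
defining ν + λ, and w > 0 controls g near the center. Hence all metric coefficients converge
pointwise away from the center.

The differences ξ_ε(u, r) - ξ_ε(u, 1) are integrals away from the center, so they converge as well.
Only the value ξ_ε(u, 1) is uncontrolled pointwise. It is bounded in L²(0, u₀), hence has a weak
limit η(u) along every ultrafilter. The candidate for the limit is y(u, r) = η(u) + ∫₁ʳ ξ', and y²/E
inherits the energy bound with m replaced by min(C, r/2) (`integral_energy_le`). The flux divided by
r is integrable in r on each cone because E K²/r = E'/(4π) and 0 < E ≤ 1. The mass term min(C,
r/2)/r is bounded. So the integral of y²/E against a weight behaving like dr/r at the center is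
finite for almost every u.

On such a cone the finite logarithmic integral gives radii tending to 0 along which y²/E is small,
and a one-sided differential inequality for y²/E turns this into a limit 0 at the center
(`tendsto_energy`). Since y tends to 0, η(u) must equal the improper integral of ξ' from 0 to 1;
that is, the limit defining ξ exists and y = ξ (`xi_eq`). So η does not depend on the ultrafilter,
and weak convergence holds for the sequence itself. The same differential inequality bounds y²/E,
weighted by 1/max(1, r)², by a function Φ(u) in L¹(0, u₀). This Φ gives the statement on the
supremum, and it dominates in the limit r → 0. -/

namespace EKG
noncomputable section

/-! ### Metric coefficients on a single light cone -/

/-- A profile whose metric coefficients are well defined away from the center. -/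
structure IsProfile (c ε : ℝ) (f : ℝ → ℝ) : Prop where
  eps_nonneg : 0 ≤ ε
  cont : ContinuousOn f (Ioi 0)
  cont_mean : ContinuousOn (mean ε f) (Ioi 0)
  integrable : ∀ r, 0 < r → IntegrableOn (fun s => (f s - mean ε f s) ^ 2 / (s + ε)) (Ioi r)
  gCoef_int : ∀ r, 0 < r → IntervalIntegrable (gCoef c ε f) volume 0 r

/-- The quantity `(r + ε) ḡ / e^{ν + λ} = (r + ε) - 2 m`. -/
def wCoef (c ε : ℝ) (f : ℝ → ℝ) (r : ℝ) : ℝ := (r + ε) * gBar c ε f r / expNuLam ε f r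

lemma expNuLam_pos (ε : ℝ) (f : ℝ → ℝ) (r : ℝ) : 0 < expNuLam ε f r := Real.exp_pos _

lemma nuLam_nonpos {ε : ℝ} (hε : 0 ≤ ε) (f : ℝ → ℝ) {r : ℝ} (hr : 0 ≤ r) : nuLam ε f r ≤ 0 := by
  unfold nuLam
  have : 0 ≤ ∫ s in Ioi r, (f s - mean ε f s) ^ 2 / (s + ε) := by
    refine setIntegral_nonneg measurableSet_Ioi fun s hs => ?_
    have : 0 < s := hr.trans_lt hs
    positivity
  have := Real.pi_pos
  nlinarith

lemma expNuLam_le_one {ε : ℝ} (hε : 0 ≤ ε) (f : ℝ → ℝ) {r : ℝ} (hr : 0 ≤ r) :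
    expNuLam ε f r ≤ 1 := Real.exp_le_one_iff.2 (nuLam_nonpos hε f hr)

lemma hawkingMass_eq {c ε : ℝ} {f : ℝ → ℝ} {r : ℝ} :
    hawkingMass c ε f r = (r + ε - wCoef c ε f r) / 2 := by
  unfold hawkingMass wCoef; ring

lemma mul_mean {ε : ℝ} {f : ℝ → ℝ} {r : ℝ} (h : r + ε ≠ 0) :
    (r + ε) * mean ε f r = ∫ s in (0 : ℝ)..r, f s := by
  unfold mean; field_simp

lemma gCoef_le {c ε : ℝ} {f : ℝ → ℝ} {r : ℝ} : gCoef c ε f r ≤ expNuLam ε f r := by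
  have h1 : 0 ≤ 4 * c ^ 2 * Real.pi * (r + ε) ^ 2 * mean ε f r ^ 2 := by
    have := Real.pi_pos; positivity
  have := expNuLam_pos ε f r
  unfold gCoef
  nlinarith

/-- Primitives of functions continuous away from the center and integrable near it. -/
lemma hasDerivAt_primitive_of_continuousOn_Ioi {f : ℝ → ℝ} {a r : ℝ} (hr : 0 < r)
    (hf : ContinuousOn f (Ioi 0)) (hi : IntervalIntegrable f volume a r) :
    HasDerivAt (fun x => ∫ s in a..x, f s) (f r) r :=
  intervalIntegral.integral_hasDerivAt_right hi
    (hf.stronglyMeasurableAtFilter isOpen_Ioi r hr) (hf.continuousAt (Ioi_mem_nhds hr))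

lemma intervalIntegrable_of_continuousOn_Ioi {f : ℝ → ℝ} {a b : ℝ} (ha : 0 < a) (hb : 0 < b)
    (hf : ContinuousOn f (Ioi 0)) : IntervalIntegrable f volume a b :=
  (hf.mono fun _ hx => lt_of_lt_of_le (lt_min ha hb) hx.1).intervalIntegrable

namespace IsProfile

variable {c ε : ℝ} {f : ℝ → ℝ} (hp : IsProfile c ε f)
include hp

lemma rho_pos {r : ℝ} (hr : 0 < r) : 0 < r + ε := by have := hp.eps_nonneg; linarith

lemma cont_dev : ContinuousOn (fun s => f s - mean ε f s) (Ioi 0) := hp.cont.sub hp.cont_mean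

lemma cont_density : ContinuousOn (fun s => (f s - mean ε f s) ^ 2 / (s + ε)) (Ioi 0) :=
  (hp.cont_dev.pow 2).div (by fun_prop) fun _ hs => (hp.rho_pos hs).ne'

/-- Differences of the tail integrals are integrals over compact intervals, so local properties of ν
+ λ follow from local ones of the density. -/
lemma nuLam_sub {a b : ℝ} (ha : 0 < a) (hb : 0 < b) :
    nuLam ε f b - nuLam ε f a
      = 4 * Real.pi * ∫ s in a..b, (f s - mean ε f s) ^ 2 / (s + ε) := by
  have := intervalIntegral.integral_Ioi_sub_Ioi' (hp.integrable a ha) (hp.integrable b hb)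
  unfold nuLam
  rw [← this]; ring

lemma hasDerivAt_nuLam {r : ℝ} (hr : 0 < r) :
    HasDerivAt (nuLam ε f) (4 * Real.pi * ((f r - mean ε f r) ^ 2 / (r + ε))) r := by
  have h1 := (hasDerivAt_primitive_of_continuousOn_Ioi hr hp.cont_density
    (intervalIntegrable_of_continuousOn_Ioi (a := r) hr hr hp.cont_density)).const_mul
      (4 * Real.pi) |>.const_add (nuLam ε f r)
  refine h1.congr_of_eventuallyEq ?_
  filter_upwards [Ioi_mem_nhds hr] with x hx
  rw [← hp.nuLam_sub hr hx]; ring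

lemma hasDerivAt_expNuLam {r : ℝ} (hr : 0 < r) :
    HasDerivAt (expNuLam ε f)
      (4 * Real.pi * ((f r - mean ε f r) ^ 2 / (r + ε)) * expNuLam ε f r) r := by
  have := (hp.hasDerivAt_nuLam hr).exp
  rw [mul_comm]; exact this

lemma cont_expNuLam : ContinuousOn (expNuLam ε f) (Ioi 0) := fun _ hr =>
  (hp.hasDerivAt_expNuLam hr).continuousAt.continuousWithinAt

lemma expNuLam_mono {a b : ℝ} (ha : 0 < a) (hab : a ≤ b) : expNuLam ε f a ≤ expNuLam ε f b := by
  refine Real.exp_le_exp.2 (sub_nonneg.1 ?_)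
  rw [hp.nuLam_sub ha (ha.trans_le hab)]
  have : 0 ≤ ∫ s in a..b, (f s - mean ε f s) ^ 2 / (s + ε) :=
    intervalIntegral.integral_nonneg hab fun s hs =>
      div_nonneg (sq_nonneg _) (hp.rho_pos (ha.trans_le hs.1)).le
  have := Real.pi_pos
  positivity

lemma cont_gCoef : ContinuousOn (gCoef c ε f) (Ioi 0) := by
  have h1 := hp.cont_expNuLam
  have h2 := hp.cont_mean
  unfold gCoef
  fun_prop

lemma mul_gBar {r : ℝ} (hr : 0 < r) :
    (r + ε) * gBar c ε f r = ∫ s in (0 : ℝ)..r, gCoef c ε f s :=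
  mul_mean (hp.rho_pos hr).ne'

lemma hasDerivAt_mul_gBar {r : ℝ} (hr : 0 < r) :
    HasDerivAt (fun r => (r + ε) * gBar c ε f r) (gCoef c ε f r) r := by
  refine (hasDerivAt_primitive_of_continuousOn_Ioi hr hp.cont_gCoef
    (hp.gCoef_int r hr)).congr_of_eventuallyEq ?_
  filter_upwards [Ioi_mem_nhds hr] with x hx using hp.mul_gBar hx

lemma hasDerivAt_gBar {r : ℝ} (hr : 0 < r) :
    HasDerivAt (gBar c ε f) ((gCoef c ε f r - gBar c ε f r) / (r + ε)) r := by
  have h0 := (hp.rho_pos hr).ne'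
  have h1 := (hp.hasDerivAt_mul_gBar hr).div ((hasDerivAt_id r).add_const ε) h0
  have h2 : HasDerivAt (gBar c ε f) ((gCoef c ε f r * (id r + ε)
      - (r + ε) * gBar c ε f r * 1) / (id r + ε) ^ 2) r := by
    refine h1.congr_of_eventuallyEq ?_
    filter_upwards [Ioi_mem_nhds hr] with x hx
    have := (hp.rho_pos hx).ne'
    simp [this]
  convert h2 using 1
  simp only [id]
  field_simp

lemma cont_gBar : ContinuousOn (gBar c ε f) (Ioi 0) := fun _ hr =>
  (hp.hasDerivAt_gBar hr).continuousAt.continuousWithinAt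

/-- Since (ρ ḡ)' = g and g / E = 1 - 4πc²(ρ f̄)², the exponential cancels and w solves a linear
equation whose coefficients are local in r. -/
lemma hasDerivAt_wCoef {r : ℝ} (hr : 0 < r) :
    HasDerivAt (wCoef c ε f) ((1 - 4 * Real.pi * c ^ 2 * ((r + ε) * mean ε f r) ^ 2)
      - 4 * Real.pi * ((f r - mean ε f r) ^ 2 / (r + ε)) * wCoef c ε f r) r := by
  have hE := (expNuLam_pos ε f r).ne'
  refine ((hp.hasDerivAt_mul_gBar hr).div (hp.hasDerivAt_expNuLam hr) hE).congr_deriv ?_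
  unfold wCoef gCoef
  field_simp

lemma cont_wCoef : ContinuousOn (wCoef c ε f) (Ioi 0) := fun _ hr =>
  (hp.hasDerivAt_wCoef hr).continuousAt.continuousWithinAt

/-- Here g ≤ E and E is nondecreasing in r, so ∫₀ʳ g ≤ r E(r). The bound is r and not r + ε; in
particular the mass is nonnegative whatever the sign of ḡ. -/
lemma wCoef_le {r : ℝ} (hr : 0 < r) : wCoef c ε f r ≤ r := by
  unfold wCoef
  rw [hp.mul_gBar hr, div_le_iff₀ (expNuLam_pos _ _ _)]
  have : ∫ s in (0 : ℝ)..r, gCoef c ε f s ≤ ∫ _ in (0 : ℝ)..r, expNuLam ε f r := by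
    refine intervalIntegral.integral_mono_on_of_le_Ioo hr.le (hp.gCoef_int r hr) (by simp) ?_
    intro s hs
    exact gCoef_le.trans (hp.expNuLam_mono hs.1 hs.2.le)
  simpa using this

/-- Differentiating m = (ρ - w)/2 cancels the constant 1. The density that remains is nonnegative
wherever w ≥ 0, so the mass is then nondecreasing in r. -/
lemma hasDerivAt_hawkingMass {r : ℝ} (hr : 0 < r) :
    HasDerivAt (hawkingMass c ε f) (2 * Real.pi * (c ^ 2 * ((r + ε) * mean ε f r) ^ 2
      + wCoef c ε f r / (r + ε) * (f r - mean ε f r) ^ 2)) r := by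
  have h1 := ((((hasDerivAt_id r).add_const ε).sub (hp.hasDerivAt_wCoef hr)).div_const 2)
  have h2 : hawkingMass c ε f = fun r => ((id r + ε) - wCoef c ε f r) / 2 := by
    ext; exact hawkingMass_eq
  rw [h2]
  refine h1.congr_deriv ?_
  ring

lemma hawkingMass_nonneg {r : ℝ} (hr : 0 < r) : 0 ≤ hawkingMass c ε f r := by
  have := hp.wCoef_le hr
  have := hp.eps_nonneg
  rw [hawkingMass_eq]; linarith

lemma cont_massDensity : ContinuousOn (fun s => c ^ 2 * ((s + ε) * mean ε f s) ^ 2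
      + wCoef c ε f s / (s + ε) * (f s - mean ε f s) ^ 2) (Ioi 0) := by
  have h1 := hp.cont_dev
  have h2 := hp.cont_mean
  have h3 : ContinuousOn (fun s => wCoef c ε f s / (s + ε)) (Ioi 0) :=
    hp.cont_wCoef.div (by fun_prop) fun _ hs => (hp.rho_pos hs).ne'
  fun_prop

lemma hawkingMass_sub {a b : ℝ} (ha : 0 < a) (hb : 0 < b) :
    hawkingMass c ε f b - hawkingMass c ε f a
      = 2 * Real.pi * ∫ s in a..b, (c ^ 2 * ((s + ε) * mean ε f s) ^ 2
      + wCoef c ε f s / (s + ε) * (f s - mean ε f s) ^ 2) := by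
  rw [← intervalIntegral.integral_const_mul]
  refine (intervalIntegral.integral_eq_sub_of_hasDerivAt (fun x hx => ?_) ?_).symm
  · exact hp.hasDerivAt_hawkingMass (lt_of_lt_of_le (lt_min ha hb) hx.1)
  · exact (intervalIntegrable_of_continuousOn_Ioi ha hb hp.cont_massDensity).const_mul _

lemma gBar_eq {r : ℝ} (hr : 0 < r) :
    gBar c ε f r = wCoef c ε f r / (r + ε) * expNuLam ε f r := by
  have := (hp.rho_pos hr).ne'
  have := (expNuLam_pos ε f r).ne'
  unfold wCoef; field_simp

end IsProfile

/-- Only integrability of g at the center needs an argument: 0 < E ≤ 1 there, and the polynomial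
factor is integrable by assumption. The factor c² stays inside that assumption because the mass
controls only c² times the integral, so c = 0 needs no separate treatment. -/
lemma IsProfile.of_mean_sq {c ε : ℝ} {f : ℝ → ℝ} (hε : 0 ≤ ε) (h1 : ContinuousOn f (Ioi 0))
    (h2 : ContinuousOn (mean ε f) (Ioi 0))
    (h3 : ∀ r, 0 < r → IntegrableOn (fun s => (f s - mean ε f s) ^ 2 / (s + ε)) (Ioi r))
    (h4 : ∀ r, 0 < r → IntervalIntegrable (fun s => c ^ 2 * ((s + ε) * mean ε f s) ^ 2) volume 0 r) :
    IsProfile c ε f := by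
  have hE : ContinuousOn (expNuLam ε f) (Ioi 0) := by
    intro r hr
    have hr' : 0 < r := hr
    refine ContinuousAt.continuousWithinAt ?_
    have hc : ContinuousOn (fun s => (f s - mean ε f s) ^ 2 / (s + ε)) (Ioi 0) :=
      ((h1.sub h2).pow 2).div (by fun_prop) fun s hs => by
        have : 0 < s := hs
        positivity
    have h5 := (hasDerivAt_primitive_of_continuousOn_Ioi hr hc
      (intervalIntegrable_of_continuousOn_Ioi (a := r) hr hr hc)).continuousAt
    have h6 : ContinuousAt (nuLam ε f) r := by
      refine ((h5.const_mul (4 * Real.pi)).const_add (nuLam ε f r)).congr ?_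
      filter_upwards [Ioi_mem_nhds hr] with x hx
      unfold nuLam
      rw [← intervalIntegral.integral_Ioi_sub_Ioi' (h3 r hr) (h3 x hx)]
      ring
    exact h6.rexp
  refine ⟨hε, h1, h2, h3, fun r hr => ?_⟩
  have h5 : IntervalIntegrable (fun s => 1 - 4 * Real.pi * (c ^ 2 * ((s + ε) * mean ε f s) ^ 2))
      volume 0 r := intervalIntegrable_const.sub ((h4 r hr).const_mul _)
  rw [intervalIntegrable_iff_integrableOn_Ioc_of_le hr.le] at h5 ⊢
  have h6 := h5.mul_bdd (c := 1) (g := expNuLam ε f)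
    ((hE.mono Ioc_subset_Ioi_self).aestronglyMeasurable measurableSet_Ioc) (by
      refine (ae_restrict_iff' measurableSet_Ioc).2 (Eventually.of_forall fun s hs => ?_)
      rw [Real.norm_eq_abs, abs_of_pos (expNuLam_pos _ _ _)]
      exact expNuLam_le_one hε f hs.1.le)
  refine h6.congr (Eventually.of_forall fun s => ?_)
  simp only [gCoef]; ring

/-! ### Calculus on the closed quadrant -/

/-- The closed quadrant `u ≥ 0`, `r ≥ 0`. -/
def quadrant : Set (ℝ × ℝ) := Ici 0 ×ˢ Ici 0

lemma mem_quadrant {u r : ℝ} : (u, r) ∈ quadrant ↔ 0 ≤ u ∧ 0 ≤ r := Iff.rfl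

/-- Clamping both coordinates at 0 extends a function continuous on the quadrant to the whole plane,
where the theorems on parametric integrals of continuous functions apply. -/
lemma continuous_clamp {F : ℝ → ℝ → ℝ} (hF : ContinuousOn (fun p : ℝ × ℝ => F p.1 p.2) quadrant) :
    Continuous (fun p : ℝ × ℝ => F (max p.1 0) (max p.2 0)) :=
  hF.comp_continuous (f := fun p : ℝ × ℝ => (max p.1 0, max p.2 0)) (by fun_prop)
    fun p => mem_quadrant.2 ⟨le_max_right _ _, le_max_right _ _⟩

lemma continuousOn_primitive_quadrant {F : ℝ → ℝ → ℝ}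
    (hF : ContinuousOn (fun p : ℝ × ℝ => F p.1 p.2) quadrant) :
    ContinuousOn (fun p : ℝ × ℝ => ∫ s in (0 : ℝ)..p.2, F p.1 s) quadrant := by
  have h1 : Continuous (Function.uncurry fun (p : ℝ × ℝ) (s : ℝ) => F (max p.1 0) (max s 0)) :=
    (continuous_clamp hF).comp (f := fun q : (ℝ × ℝ) × ℝ => (q.1.1, q.2)) (by fun_prop)
  have h2 := intervalIntegral.continuous_parametric_intervalIntegral_of_continuous
    (μ := volume) (a₀ := 0) h1 (s := fun p => p.2) continuous_snd
  refine h2.continuousOn.congr fun p hp => ?_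
  refine intervalIntegral.integral_congr fun s hs => ?_
  rw [uIcc_of_le hp.2] at hs
  rw [max_eq_left hp.1, max_eq_left hs.1]

lemma continuousOn_left {F : ℝ → ℝ → ℝ}
    (hF : ContinuousOn (fun p : ℝ × ℝ => F p.1 p.2) quadrant) {r : ℝ} (hr : 0 ≤ r) :
    ContinuousOn (fun u => F u r) (Ici 0) :=
  hF.comp (f := fun u => (u, r)) (by fun_prop) fun _ hu => ⟨hu, hr⟩

lemma continuousOn_right {F : ℝ → ℝ → ℝ}
    (hF : ContinuousOn (fun p : ℝ × ℝ => F p.1 p.2) quadrant) {u : ℝ} (hu : 0 ≤ u) :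
    ContinuousOn (fun r => F u r) (Ici 0) :=
  hF.comp (f := fun r => (u, r)) (by fun_prop) fun _ hr => ⟨hu, hr⟩

lemma intervalIntegrable_of_continuousOn_Ici {f : ℝ → ℝ} {a b : ℝ} (ha : 0 ≤ a) (hb : 0 ≤ b)
    (hf : ContinuousOn f (Ici 0)) : IntervalIntegrable f volume a b :=
  (hf.mono fun _ hx => le_trans (le_min ha hb) hx.1).intervalIntegrable

lemma hasDerivAt_primitive_left {F F' : ℝ → ℝ → ℝ}
    (hF : ContinuousOn (fun p : ℝ × ℝ => F p.1 p.2) quadrant)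
    (hF' : ContinuousOn (fun p : ℝ × ℝ => F' p.1 p.2) quadrant)
    (hd : ∀ u s, 0 < u → 0 ≤ s → HasDerivAt (fun v => F v s) (F' u s) u)
    {u r : ℝ} (hu : 0 < u) (hr : 0 ≤ r) :
    HasDerivAt (fun v => ∫ s in (0 : ℝ)..r, F v s) (∫ s in (0 : ℝ)..r, F' u s) u := by
  have hK : IsCompact (Icc (u / 2) (2 * u) ×ˢ Icc 0 r) := isCompact_Icc.prod isCompact_Icc
  have hKQ : Icc (u / 2) (2 * u) ×ˢ Icc 0 r ⊆ quadrant := fun p hp =>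
    ⟨(half_pos hu).le.trans hp.1.1, hp.2.1⟩
  obtain ⟨B, hB⟩ := hK.exists_bound_of_continuousOn (hF'.mono hKQ)
  refine (intervalIntegral.hasDerivAt_integral_of_dominated_loc_of_deriv_le
    (bound := fun _ => B) (s := Ioo (u / 2) (2 * u)) (Ioo_mem_nhds (by linarith) (by linarith))
    ?_ ?_ ?_ ?_ (by simp) ?_).2
  · filter_upwards [Ioi_mem_nhds hu] with x hx
    rw [uIoc_of_le hr]
    exact ((continuousOn_right hF (le_of_lt hx)).mono fun s hs => hs.1.le).aestronglyMeasurable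
      measurableSet_Ioc
  · exact intervalIntegrable_of_continuousOn_Ici le_rfl hr (continuousOn_right hF hu.le)
  · rw [uIoc_of_le hr]
    exact ((continuousOn_right hF' hu.le).mono fun s hs => hs.1.le).aestronglyMeasurable
      measurableSet_Ioc
  · refine Eventually.of_forall fun s hs x hx => ?_
    rw [uIoc_of_le hr] at hs
    exact hB (x, s) ⟨⟨hx.1.le, hx.2.le⟩, hs.1.le, hs.2⟩
  · refine Eventually.of_forall fun s hs x hx => ?_
    rw [uIoc_of_le hr] at hs
    exact hd x s (by linarith [hx.1]) hs.1.le

lemma hasDerivAt_primitive_right {F : ℝ → ℝ → ℝ}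
    (hF : ContinuousOn (fun p : ℝ × ℝ => F p.1 p.2) quadrant) {u r : ℝ} (hu : 0 ≤ u) (hr : 0 < r) :
    HasDerivAt (fun x => ∫ s in (0 : ℝ)..x, F u s) (F u r) r :=
  hasDerivAt_primitive_of_continuousOn_Ioi hr ((continuousOn_right hF hu).mono Ioi_subset_Ici_self)
    (intervalIntegrable_of_continuousOn_Ici le_rfl hr.le (continuousOn_right hF hu))

/-! ### Regularity of the coefficients of a regularized solution -/

/-- The derivatives of a solution, one-sided on the boundary of the quadrant. -/
def derivU (h : ℝ → ℝ → ℝ) (u r : ℝ) : ℝ := derivWithin (fun v => h v r) (Ici 0) u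

/-- The radial derivative, one-sided at the center. -/
def derivR (h : ℝ → ℝ → ℝ) (u r : ℝ) : ℝ := derivWithin (fun s => h u s) (Ici 0) r

namespace IsRegularizedSolution

variable {c ε : ℝ} {h₀ : ℝ → ℝ} {h : ℝ → ℝ → ℝ} (hs : IsRegularizedSolution c ε h₀ h)
include hs

lemma cont : ContinuousOn (fun p : ℝ × ℝ => h p.1 p.2) quadrant := hs.contDiff.continuousOn

lemma hasDerivAt_left {u r : ℝ} (hu : 0 < u) (hr : 0 ≤ r) :
    HasDerivAt (fun v => h v r) (derivU h u r) u := by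
  have h1 : ContDiffOn ℝ 1 (fun v => h v r) (Ici 0) :=
    hs.contDiff.comp (f := fun v => (v, r)) (by fun_prop) fun _ hv => ⟨hv, hr⟩
  exact ((h1.differentiableOn one_ne_zero) u hu.le).hasDerivWithinAt.hasDerivAt (Ici_mem_nhds hu)

lemma hasDerivAt_right {u r : ℝ} (hu : 0 ≤ u) (hr : 0 < r) :
    HasDerivAt (fun s => h u s) (derivR h u r) r := by
  have h1 : ContDiffOn ℝ 1 (fun s => h u s) (Ici 0) :=
    hs.contDiff.comp (f := fun s => (u, s)) (by fun_prop) fun _ hv => ⟨hu, hv⟩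
  exact ((h1.differentiableOn one_ne_zero) r hr.le).hasDerivWithinAt.hasDerivAt (Ici_mem_nhds hr)

/-- The one-sided derivative in u is the Fréchet derivative within the quadrant applied to (1, 0);
the latter is continuous up to the boundary because the quadrant has unique differentials. -/
lemma cont_derivU : ContinuousOn (fun p : ℝ × ℝ => derivU h p.1 p.2) quadrant := by
  have hu : UniqueDiffOn ℝ quadrant := (uniqueDiffOn_Ici 0).prod (uniqueDiffOn_Ici 0)
  have h1 : ContinuousOn (fun p => fderivWithin ℝ (fun p : ℝ × ℝ => h p.1 p.2) quadrant p (1, 0))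
      quadrant :=
    ((hs.contDiff.continuousOn_fderivWithin hu le_rfl).clm_apply continuousOn_const)
  refine h1.congr fun p hp => ?_
  have h2 : HasFDerivWithinAt (fun p : ℝ × ℝ => h p.1 p.2)
      (fderivWithin ℝ (fun p : ℝ × ℝ => h p.1 p.2) quadrant p) quadrant p :=
    ((hs.contDiff.differentiableOn one_ne_zero) p hp).hasFDerivWithinAt
  have h3 : HasDerivWithinAt (fun v : ℝ => (v, p.2)) ((1 : ℝ), (0 : ℝ)) (Ici 0) p.1 :=
    (hasDerivWithinAt_id _ _).prodMk (hasDerivWithinAt_const _ _ _)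
  have h4 := HasFDerivWithinAt.comp_hasDerivWithinAt (t := quadrant) p.1 (f := fun v : ℝ => (v, p.2))
    h2 h3 (fun v hv => ⟨hv, hp.2⟩)
  exact h4.derivWithin ((uniqueDiffOn_Ici 0) _ hp.1)

lemma cont_prim : ContinuousOn (fun p : ℝ × ℝ => ∫ s in (0 : ℝ)..p.2, h p.1 s) quadrant :=
  continuousOn_primitive_quadrant hs.cont

lemma cont_expNuLam : ContinuousOn (fun p : ℝ × ℝ => expNuLam ε (h p.1) p.2) quadrant :=
  hs.continuous_coef.rexp

variable (hε : 0 < ε)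
include hε

omit hs in
lemma cont_inv_rho : ContinuousOn (fun p : ℝ × ℝ => 1 / (p.2 + ε)) quadrant :=
  continuousOn_const.div (by fun_prop) fun p hp => by
    have : 0 ≤ p.2 := hp.2
    positivity

lemma cont_mean : ContinuousOn (fun p : ℝ × ℝ => mean ε (h p.1) p.2) quadrant :=
  (cont_inv_rho hε).mul hs.cont_prim

lemma cont_dev : ContinuousOn (fun p : ℝ × ℝ => h p.1 p.2 - mean ε (h p.1) p.2) quadrant :=
  hs.cont.sub (hs.cont_mean hε)

lemma cont_gCoef : ContinuousOn (fun p : ℝ × ℝ => gCoef c ε (h p.1) p.2) quadrant := by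
  have h1 := hs.cont_mean hε
  have h2 := hs.cont_expNuLam
  unfold gCoef
  fun_prop

lemma cont_gBar : ContinuousOn (fun p : ℝ × ℝ => gBar c ε (h p.1) p.2) quadrant :=
  (cont_inv_rho hε).mul (continuousOn_primitive_quadrant (F := fun u s => gCoef c ε (h u) s)
    (hs.cont_gCoef hε))

lemma cont_wCoef : ContinuousOn (fun p : ℝ × ℝ => wCoef c ε (h p.1) p.2) quadrant := by
  have h1 := hs.cont_gBar hε
  have h2 := hs.cont_expNuLam
  exact ContinuousOn.div (by fun_prop) h2 fun p _ => (expNuLam_pos _ _ _).ne'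

lemma cont_xi_integrand : ContinuousOn (fun p : ℝ × ℝ => gBar c ε (h p.1) p.2
    * ((h p.1 p.2 - mean ε (h p.1) p.2) / (p.2 + ε))) quadrant :=
  (hs.cont_gBar hε).mul ((hs.cont_dev hε).div (by fun_prop) fun p hp => by
    have : 0 ≤ p.2 := hp.2
    positivity)

lemma cont_xi_integrand' : ContinuousOn (fun p : ℝ × ℝ => (p.2 + ε) * mean ε (h p.1) p.2
    * expNuLam ε (h p.1) p.2) quadrant := by
  have h1 := hs.cont_mean hε
  have h2 := hs.cont_expNuLam
  fun_prop

lemma cont_xiReg : ContinuousOn (fun p : ℝ × ℝ => xiReg c ε (h p.1) p.2) quadrant :=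
  (continuousOn_primitive_quadrant (F := fun u s => gBar c ε (h u) s
    * ((h u s - mean ε (h u) s) / (s + ε))) (hs.cont_xi_integrand hε)).sub
  (continuousOn_const.mul (continuousOn_primitive_quadrant (F := fun u s => (s + ε)
    * mean ε (h u) s * expNuLam ε (h u) s) (hs.cont_xi_integrand' hε)))

lemma isProfile {u : ℝ} (hu : 0 ≤ u) : IsProfile c ε (h u) := by
  have h2 := continuousOn_right (F := fun u r => mean ε (h u) r) (hs.cont_mean hε) hu
  refine IsProfile.of_mean_sq hε.le ((continuousOn_right hs.cont hu).mono Ioi_subset_Ici_self)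
    (h2.mono Ioi_subset_Ici_self)
    (fun r hr => (hs.integrable u hu).mono_set (Ioi_subset_Ioi hr.le)) fun r hr => ?_
  exact intervalIntegrable_of_continuousOn_Ici le_rfl hr.le (by fun_prop)

end IsRegularizedSolution

/-! ### Evolution equations in `u` -/

/-- Identities between nonlocal quantities are checked below by comparing radial derivatives and the
values at the center. For ε > 0 the quantities compared are continuous up to the center and vanish
there. -/
lemma eqOn_of_hasDerivAt_eq {f g f' : ℝ → ℝ} (hf : ContinuousOn f (Ici 0))
    (hg : ContinuousOn g (Ici 0)) (h0 : f 0 = g 0) (hf' : ∀ r, 0 < r → HasDerivAt f (f' r) r)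
    (hg' : ∀ r, 0 < r → HasDerivAt g (f' r) r) {r : ℝ} (hr : 0 ≤ r) : f r = g r := by
  have h1 := intervalIntegral.integral_eq_sub_of_hasDerivAt_of_le (f := fun x => f x - g x)
    (f' := fun _ => 0) hr ((hf.sub hg).mono fun x hx => hx.1)
    (fun x hx => ((hf' x hx.1).sub (hg' x hx.1)).congr_deriv (sub_self _)) (by simp)
  simp only [intervalIntegral.integral_zero] at h1
  linarith

lemma hasDerivAt_mean {ε : ℝ} {f : ℝ → ℝ} (hε : 0 ≤ ε) (hf : ContinuousOn f (Ioi 0)) {r : ℝ}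
    (hr : 0 < r) (hi : IntervalIntegrable f volume 0 r) :
    HasDerivAt (mean ε f) ((f r - mean ε f r) / (r + ε)) r := by
  have h0 : r + ε ≠ 0 := by positivity
  have h1 := (hasDerivAt_primitive_of_continuousOn_Ioi hr hf hi).div
    ((hasDerivAt_id r).add_const ε) h0
  have h2 : mean ε f = (fun x => ∫ s in (0 : ℝ)..x, f s) / fun x => id x + ε := by
    ext x; simp [mean, div_eq_inv_mul]
  have h3 := mul_mean (f := f) h0
  rw [h2]
  refine h1.congr_deriv ?_
  rw [← h3, ← h2]
  simp only [id]
  field_simp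

namespace IsRegularizedSolution

variable {c ε : ℝ} {h₀ : ℝ → ℝ} {h : ℝ → ℝ → ℝ} (hs : IsRegularizedSolution c ε h₀ h)
  (hε : 0 < ε)
include hs hε

lemma hasDerivAt_xiReg {u r : ℝ} (hu : 0 ≤ u) (hr : 0 < r) :
    HasDerivAt (xiReg c ε (h u)) (gBar c ε (h u) r * ((h u r - mean ε (h u) r) / (r + ε))
      - c ^ 2 * ((r + ε) * mean ε (h u) r * expNuLam ε (h u) r)) r :=
  (hasDerivAt_primitive_right (F := fun u s => gBar c ε (h u) s
    * ((h u s - mean ε (h u) s) / (s + ε))) (hs.cont_xi_integrand hε) hu hr).sub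
  ((hasDerivAt_primitive_right (F := fun u s => (s + ε)
    * mean ε (h u) s * expNuLam ε (h u) s) (hs.cont_xi_integrand' hε) hu hr).const_mul _)

lemma hasDerivAt_dev {u r : ℝ} (hu : 0 ≤ u) (hr : 0 < r) :
    HasDerivAt (fun s => h u s - mean ε (h u) s)
      (derivR h u r - (h u r - mean ε (h u) r) / (r + ε)) r :=
  (hs.hasDerivAt_right hu hr).sub (hasDerivAt_mean hε.le (hs.isProfile hε hu).cont hr
    (intervalIntegrable_of_continuousOn_Ici le_rfl hr.le (continuousOn_right hs.cont hu)))

/-- This is the evolution equation in divergence form, 2 ∂_u h = ∂_r(ḡ K + ξ_ε): the product rule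
produces exactly the terms ḡ ∂_r h and (g - ḡ)K/ρ of the equation, and what is left over is ∂_r ξ_ε.
-/
lemma hasDerivAt_gBar_mul_dev {u r : ℝ} (hu : 0 ≤ u) (hr : 0 < r) :
    HasDerivAt (fun s => gBar c ε (h u) s * (h u s - mean ε (h u) s))
      (2 * derivU h u r - (gBar c ε (h u) r * ((h u r - mean ε (h u) r) / (r + ε))
      - c ^ 2 * ((r + ε) * mean ε (h u) r * expNuLam ε (h u) r))) r := by
  refine (((hs.isProfile hε hu).hasDerivAt_gBar hr).mul (hs.hasDerivAt_dev hε hu hr)).congr_deriv ?_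
  have h1 := hs.evolution u r hu hr.le
  have h2 : derivU h u r = 1 / 2 * gBar c ε (h u) r * derivR h u r
      + (1 / (2 * (r + ε)) * (gCoef c ε (h u) r - gBar c ε (h u) r) * (h u r - mean ε (h u) r)
          - c ^ 2 / 2 * (r + ε) * expNuLam ε (h u) r * mean ε (h u) r) := by
    unfold derivU derivR; linarith
  have h3 : r + ε ≠ 0 := by positivity
  rw [h2]
  field_simp
  ring

lemma cont_gBar_mul_dev : ContinuousOn (fun p : ℝ × ℝ => gBar c ε (h p.1) p.2
    * (h p.1 p.2 - mean ε (h p.1) p.2)) quadrant := (hs.cont_gBar hε).mul (hs.cont_dev hε)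

omit hs hε in
lemma gBar_zero {f : ℝ → ℝ} : gBar c ε f 0 = 0 := by simp [gBar, mean]

omit hs hε in
lemma xiReg_zero {f : ℝ → ℝ} : xiReg c ε f 0 = 0 := by simp [xiReg]

lemma primitive_derivU {u r : ℝ} (hu : 0 ≤ u) (hr : 0 ≤ r) :
    ∫ s in (0 : ℝ)..r, derivU h u s
      = (gBar c ε (h u) r * (h u r - mean ε (h u) r) + xiReg c ε (h u) r) / 2 := by
  refine eqOn_of_hasDerivAt_eq (f := fun r => ∫ s in (0 : ℝ)..r, derivU h u s)
    (g := fun r => (gBar c ε (h u) r * (h u r - mean ε (h u) r) + xiReg c ε (h u) r) / 2)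
    (f' := derivU h u)
    (continuousOn_right (F := fun u r => ∫ s in (0 : ℝ)..r, derivU h u s)
      (continuousOn_primitive_quadrant hs.cont_derivU) hu)
    (((continuousOn_right (F := fun u r => gBar c ε (h u) r * (h u r - mean ε (h u) r))
      (hs.cont_gBar_mul_dev hε) hu).add
      (continuousOn_right (F := fun u r => xiReg c ε (h u) r) (hs.cont_xiReg hε) hu)).div_const 2)
    (by simp [gBar_zero, xiReg_zero])
    (fun r hr => hasDerivAt_primitive_right hs.cont_derivU hu hr)
    (fun r hr => ?_) hr
  refine (((hs.hasDerivAt_gBar_mul_dev hε hu hr).add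
    (hs.hasDerivAt_xiReg hε hu hr)).div_const 2).congr_deriv ?_
  ring

lemma hasDerivAt_primitive {u r : ℝ} (hu : 0 < u) (hr : 0 ≤ r) :
    HasDerivAt (fun u => ∫ s in (0 : ℝ)..r, h u s)
      ((gBar c ε (h u) r * (h u r - mean ε (h u) r) + xiReg c ε (h u) r) / 2) u := by
  rw [← hs.primitive_derivU hε hu.le hr]
  exact hasDerivAt_primitive_left hs.cont hs.cont_derivU
    (fun u s hu hs' => hs.hasDerivAt_left hu hs') hu hr

omit hε in
-- Factoring out the value at the center leaves an integral over [0, r], which can be differentiated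
-- in u. The factor E(u, 0), a tail integral known only to be continuous in u, will cancel in w.
lemma expNuLam_eq {u r : ℝ} (hu : 0 ≤ u) (hr : 0 ≤ r) :
    expNuLam ε (h u) r = expNuLam ε (h u) 0 * Real.exp (4 * Real.pi *
      ∫ s in (0 : ℝ)..r, (h u s - mean ε (h u) s) ^ 2 / (s + ε)) := by
  have hi := hs.integrable u hu
  have := intervalIntegral.integral_Ioi_sub_Ioi' hi (hi.mono_set (Ioi_subset_Ioi hr))
  unfold expNuLam nuLam
  rw [← Real.exp_add, ← this]
  congr 1
  ring

/-- With V = ∫₀ʳ h, q = 4π ∫₀ʳ K²/ρ and P = ∫₀ʳ (1 - 4πc²V²) e^q one has w = P e^{-q}, free of E(u,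
0). Hence ∂_u w = (∂_u P - P ∂_u q) e^{-q}. The bracket factors as a multiple of ∂_u V · (ξ_ε - ḡ
K), and 2 ∂_u V = ξ_ε + ḡ K turns the product into a difference of squares. -/
lemma hasDerivAt_wCoef_left {u r : ℝ} (hu : 0 < u) (hr : 0 ≤ r) :
    HasDerivAt (fun u => wCoef c ε (h u) r) (2 * Real.pi / expNuLam ε (h u) r *
      (xiReg c ε (h u) r ^ 2 - (gBar c ε (h u) r * (h u r - mean ε (h u) r)) ^ 2)) u := by
  set V : ℝ → ℝ → ℝ := fun u r => ∫ s in (0 : ℝ)..r, h u s with hV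
  set V' : ℝ → ℝ → ℝ := fun u r => (gBar c ε (h u) r * (h u r - mean ε (h u) r)
    + xiReg c ε (h u) r) / 2 with hV'
  have cV : ContinuousOn (fun p : ℝ × ℝ => V p.1 p.2) quadrant := hs.cont_prim
  have cV' : ContinuousOn (fun p : ℝ × ℝ => V' p.1 p.2) quadrant :=
    ((hs.cont_gBar_mul_dev hε).add (hs.cont_xiReg hε)).div_const 2
  have dV : ∀ u r, 0 < u → 0 ≤ r → HasDerivAt (fun u => V u r) (V' u r) u :=
    fun u r hu hr => hs.hasDerivAt_primitive hε hu hr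
  set K : ℝ → ℝ → ℝ := fun u r => h u r - mean ε (h u) r with hK
  set K' : ℝ → ℝ → ℝ := fun u r => derivU h u r - 1 / (r + ε) * V' u r with hK'
  have cK : ContinuousOn (fun p : ℝ × ℝ => K p.1 p.2) quadrant := hs.cont_dev hε
  have cK' : ContinuousOn (fun p : ℝ × ℝ => K' p.1 p.2) quadrant :=
    hs.cont_derivU.sub ((cont_inv_rho hε).mul cV')
  have dK : ∀ u r, 0 < u → 0 ≤ r → HasDerivAt (fun u => K u r) (K' u r) u :=
    fun u r hu hr => (hs.hasDerivAt_left hu hr).sub ((dV u r hu hr).const_mul _)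
  set b : ℝ → ℝ → ℝ := fun u r => K u r ^ 2 * (1 / (r + ε)) with hb
  set b' : ℝ → ℝ → ℝ := fun u r => 2 * K u r * K' u r * (1 / (r + ε)) with hb'
  have cb : ContinuousOn (fun p : ℝ × ℝ => b p.1 p.2) quadrant :=
    (cK.pow 2).mul (cont_inv_rho hε)
  have cb' : ContinuousOn (fun p : ℝ × ℝ => b' p.1 p.2) quadrant :=
    ((continuousOn_const.mul cK).mul cK').mul (cont_inv_rho hε)
  have db : ∀ u r, 0 < u → 0 ≤ r → HasDerivAt (fun u => b u r) (b' u r) u := by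
    intro u r hu hr
    refine (((dK u r hu hr).pow 2).mul_const _).congr_deriv ?_
    simp [hb']
  set q : ℝ → ℝ → ℝ := fun u r => 4 * Real.pi * ∫ s in (0 : ℝ)..r, b u s with hq
  set q' : ℝ → ℝ → ℝ := fun u r => 4 * Real.pi * ∫ s in (0 : ℝ)..r, b' u s with hq'
  have cq : ContinuousOn (fun p : ℝ × ℝ => q p.1 p.2) quadrant :=
    continuousOn_const.mul (continuousOn_primitive_quadrant cb)
  have cq' : ContinuousOn (fun p : ℝ × ℝ => q' p.1 p.2) quadrant :=
    continuousOn_const.mul (continuousOn_primitive_quadrant cb')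
  have dq : ∀ u r, 0 < u → 0 ≤ r → HasDerivAt (fun u => q u r) (q' u r) u :=
    fun u r hu hr => (hasDerivAt_primitive_left cb cb' db hu hr).const_mul _
  set a : ℝ → ℝ → ℝ := fun u r => 1 - 4 * Real.pi * c ^ 2 * V u r ^ 2 with ha
  set a' : ℝ → ℝ → ℝ := fun u r => -(8 * Real.pi * c ^ 2 * V u r * V' u r) with ha'
  set y : ℝ → ℝ → ℝ := fun u r => a u r * Real.exp (q u r) with hy
  set y' : ℝ → ℝ → ℝ := fun u r => (a' u r + a u r * q' u r) * Real.exp (q u r) with hy'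
  have ca : ContinuousOn (fun p : ℝ × ℝ => a p.1 p.2) quadrant := by fun_prop
  have ca' : ContinuousOn (fun p : ℝ × ℝ => a' p.1 p.2) quadrant := by fun_prop
  have cy : ContinuousOn (fun p : ℝ × ℝ => y p.1 p.2) quadrant := by fun_prop
  have cy' : ContinuousOn (fun p : ℝ × ℝ => y' p.1 p.2) quadrant := by fun_prop
  have dy : ∀ u r, 0 < u → 0 ≤ r → HasDerivAt (fun u => y u r) (y' u r) u := by
    intro u r hu hr
    have h1 : HasDerivAt (fun u => a u r) (a' u r) u := by
      refine ((((dV u r hu hr).pow 2).const_mul (4 * Real.pi * c ^ 2)).const_sub 1).congr_deriv ?_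
      simp [ha']; ring
    refine (h1.mul (dq u r hu hr).exp).congr_deriv ?_
    simp [hy']; ring
  set P : ℝ → ℝ → ℝ := fun u r => ∫ s in (0 : ℝ)..r, y u s with hP
  set P' : ℝ → ℝ → ℝ := fun u r => ∫ s in (0 : ℝ)..r, y' u s with hP'
  have cP : ContinuousOn (fun p : ℝ × ℝ => P p.1 p.2) quadrant := continuousOn_primitive_quadrant cy
  have cP' : ContinuousOn (fun p : ℝ × ℝ => P' p.1 p.2) quadrant :=
    continuousOn_primitive_quadrant cy'
  have dP : HasDerivAt (fun u => P u r) (P' u r) u := hasDerivAt_primitive_left cy cy' dy hu hr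
  have hE : ∀ u r, 0 ≤ u → 0 ≤ r →
      expNuLam ε (h u) r = expNuLam ε (h u) 0 * Real.exp (q u r) := by
    intro u r hu hr
    rw [hs.expNuLam_eq hu hr]
    simp only [hq, hb, hK, mul_one_div]
  have hVm : ∀ u r, 0 ≤ r → (r + ε) * mean ε (h u) r = V u r :=
    fun u r hr => mul_mean (by positivity)
  have hG : ∀ u r, 0 ≤ u → 0 ≤ r → (r + ε) * gBar c ε (h u) r = expNuLam ε (h u) 0 * P u r := by
    intro u r hu hr
    unfold gBar
    rw [mul_mean (by positivity), hP, ← intervalIntegral.integral_const_mul]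
    refine intervalIntegral.integral_congr fun s hs' => ?_
    rw [uIcc_of_le hr] at hs'
    simp only [gCoef, hE u s hu hs'.1, hy, ha, ← hVm u s hs'.1]
    ring
  have hw : ∀ u, 0 ≤ u → wCoef c ε (h u) r = P u r * Real.exp (-(q u r)) := by
    intro u hu
    unfold wCoef
    rw [hG u r hu hr, hE u r hu hr, Real.exp_neg]
    have := (expNuLam_pos ε (h u) 0).ne'
    have := (Real.exp_pos (q u r)).ne'
    field_simp
  -- Both sides vanish at r = 0 and have the same radial derivative. On the left the term a q' e^q
  -- of y' cancels against q' y; on the right 2 ∂_u h = ∂_r(ḡ K + ξ_ε) is used.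
  have key : P' u r - q' u r * P u r = 4 * Real.pi / expNuLam ε (h u) 0 *
      (V' u r * (xiReg c ε (h u) r - gBar c ε (h u) r * K u r)) := by
    refine eqOn_of_hasDerivAt_eq (f := fun r => P' u r - q' u r * P u r)
      (g := fun r => 4 * Real.pi / expNuLam ε (h u) 0 *
        (V' u r * (xiReg c ε (h u) r - gBar c ε (h u) r * K u r)))
      (f' := fun r => y' u r - (4 * Real.pi * b' u r * P u r + q' u r * y u r))
      ((continuousOn_right cP' hu.le).sub
        ((continuousOn_right cq' hu.le).mul (continuousOn_right cP hu.le)))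
      (continuousOn_const.mul ((continuousOn_right cV' hu.le).mul
        ((continuousOn_right (F := fun u r => xiReg c ε (h u) r) (hs.cont_xiReg hε) hu.le).sub
        (continuousOn_right (F := fun u r => gBar c ε (h u) r * K u r)
          (hs.cont_gBar_mul_dev hε) hu.le))))
      ?_ ?_ ?_ hr
    · simp [hP', hP, hV', gBar_zero, xiReg_zero]
    · intro r hr
      exact (hasDerivAt_primitive_right cy' hu.le hr).sub
        (((hasDerivAt_primitive_right cb' hu.le hr).const_mul _).mul
          (hasDerivAt_primitive_right cy hu.le hr))
    · intro r hr
      have d1 := hs.hasDerivAt_xiReg hε hu.le hr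
      have d2 := hs.hasDerivAt_gBar_mul_dev hε hu.le hr
      have d3 := (d2.add d1).div_const 2
      refine ((d3.mul (d1.sub d2)).const_mul (4 * Real.pi / expNuLam ε (h u) 0)).congr_deriv ?_
      have e1 := hG u r hu.le hr.le
      have e2 := hE u r hu.le hr.le
      have e3 := hVm u r hr.le
      have hρ : r + ε ≠ 0 := by positivity
      have e0 := (expNuLam_pos ε (h u) 0).ne'
      have e4 : gBar c ε (h u) r = expNuLam ε (h u) 0 * P u r / (r + ε) := by
        rw [← e1]; field_simp
      have e5 : xiReg c ε (h u) r = 2 * V' u r - gBar c ε (h u) r * K u r := by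
        simp only [hV', hK]; ring
      simp only [Pi.add_apply, Pi.sub_apply]
      rw [show h u r - mean ε (h u) r = K u r from rfl, e5, e3, e2, e4]
      simp only [hy', hy, ha', hb', hK']
      field_simp
      ring
  have dw : HasDerivAt (fun u => P u r * Real.exp (-(q u r)))
      ((P' u r - q' u r * P u r) * Real.exp (-(q u r))) u := by
    refine (dP.mul (dq u r hu hr).neg.exp).congr_deriv ?_
    simp only [Pi.neg_apply]
    ring
  refine (dw.congr_of_eventuallyEq ?_).congr_deriv ?_
  · filter_upwards [Ioi_mem_nhds hu] with x hx using hw x (le_of_lt hx)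
  · rw [key, hE u r hu.le hr, Real.exp_neg]
    have := (expNuLam_pos ε (h u) 0).ne'
    have := (Real.exp_pos (q u r)).ne'
    rw [show h u r - mean ε (h u) r = K u r from rfl]
    simp only [hV']
    rw [show h u r - mean ε (h u) r = K u r from rfl]
    field_simp
    ring

end IsRegularizedSolution

/-! ### Bounds on one cone in terms of the mass -/

namespace IsProfile

variable {c ε C : ℝ} {f : ℝ → ℝ} (hp : IsProfile c ε f)
include hp

lemma gBar_le {r : ℝ} (hr : 0 < r) : gBar c ε f r ≤ expNuLam ε f r := by
  rw [hp.gBar_eq hr]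
  have h1 := hp.wCoef_le hr
  have h2 := hp.eps_nonneg
  have h3 : wCoef c ε f r / (r + ε) ≤ 1 := (div_le_one (hp.rho_pos hr)).2 (by linarith)
  have := expNuLam_pos ε f r
  nlinarith

lemma gBar_nonneg {r : ℝ} (hr : 0 < r) (hw : 0 ≤ wCoef c ε f r) : 0 ≤ gBar c ε f r := by
  rw [hp.gBar_eq hr]
  exact mul_nonneg (div_nonneg hw (hp.rho_pos hr).le) (expNuLam_pos _ _ _).le

lemma integral_massDensity_le {a b : ℝ} (ha : 0 < a) (hab : a ≤ b) :
    ∫ s in a..b, (c ^ 2 * ((s + ε) * mean ε f s) ^ 2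
      + wCoef c ε f s / (s + ε) * (f s - mean ε f s) ^ 2)
      ≤ hawkingMass c ε f b / (2 * Real.pi) := by
  rw [le_div_iff₀ (by have := Real.pi_pos; positivity), mul_comm,
    ← hp.hawkingMass_sub ha (ha.trans_le hab)]
  linarith [hp.hawkingMass_nonneg ha]

lemma integral_mean_sq_le {a b : ℝ} (ha : 0 < a) (hab : a ≤ b)
    (hw : ∀ r, 0 < r → 0 ≤ wCoef c ε f r) :
    ∫ s in a..b, c ^ 2 * ((s + ε) * mean ε f s) ^ 2 ≤ hawkingMass c ε f b / (2 * Real.pi) := by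
  refine le_trans ?_ (hp.integral_massDensity_le ha hab)
  have h2 := hp.cont_mean
  refine intervalIntegral.integral_mono_on hab
    (intervalIntegrable_of_continuousOn_Ioi ha (ha.trans_le hab) (by fun_prop))
    (intervalIntegrable_of_continuousOn_Ioi ha (ha.trans_le hab) hp.cont_massDensity) ?_
  intro s hs
  have hs0 := ha.trans_le hs.1
  have := div_nonneg (hw s hs0) (hp.rho_pos hs0).le
  have : 0 ≤ wCoef c ε f s / (s + ε) * (f s - mean ε f s) ^ 2 := by positivity
  linarith

/-- For s ≥ a ≥ 4C the bound m ≤ C gives w ≥ s + ε - 2C ≥ ρ/2, so the mass density controls half of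
the squared deviation. A further factor 1/ρ ≤ 1/a yields decay in a, independent of b and ε. -/
lemma integral_density_le {a b : ℝ} (ha : 0 < a) (hab : a ≤ b) (hC : 4 * C ≤ a)
    (hm : ∀ r, 0 < r → hawkingMass c ε f r ≤ C) :
    ∫ s in a..b, (f s - mean ε f s) ^ 2 / (s + ε) ≤ C / (Real.pi * a) := by
  have hb := ha.trans_le hab
  have hπ := Real.pi_pos
  have h1 : ∫ s in a..b, (f s - mean ε f s) ^ 2 / (s + ε) ≤ ∫ s in a..b, 2 / a *
      (c ^ 2 * ((s + ε) * mean ε f s) ^ 2 + wCoef c ε f s / (s + ε) * (f s - mean ε f s) ^ 2) := by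
    refine intervalIntegral.integral_mono_on hab
      (intervalIntegrable_of_continuousOn_Ioi ha hb hp.cont_density)
      ((intervalIntegrable_of_continuousOn_Ioi ha hb hp.cont_massDensity).const_mul _) ?_
    intro s hs
    have hs0 := ha.trans_le hs.1
    have hρ := hp.rho_pos hs0
    have hm' := hm s hs0
    rw [hawkingMass_eq] at hm'
    have h2 : 1 / 2 ≤ wCoef c ε f s / (s + ε) := by
      rw [le_div_iff₀ hρ]
      have := hp.eps_nonneg
      linarith [hs.1]
    have h3 : 1 / (s + ε) ≤ 1 / a :=
      one_div_le_one_div_of_le ha (by linarith [hs.1, hp.eps_nonneg])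
    have h4 : 0 ≤ c ^ 2 * ((s + ε) * mean ε f s) ^ 2 := by positivity
    have h5 : 1 / 2 * (f s - mean ε f s) ^ 2
        ≤ c ^ 2 * ((s + ε) * mean ε f s) ^ 2
          + wCoef c ε f s / (s + ε) * (f s - mean ε f s) ^ 2 := by
      nlinarith [sq_nonneg (f s - mean ε f s)]
    calc (f s - mean ε f s) ^ 2 / (s + ε) = (f s - mean ε f s) ^ 2 * (1 / (s + ε)) := by ring
      _ ≤ (f s - mean ε f s) ^ 2 * (1 / a) := by gcongr
      _ = 2 / a * (1 / 2 * (f s - mean ε f s) ^ 2) := by ring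
      _ ≤ _ := by gcongr
  refine h1.trans ?_
  rw [intervalIntegral.integral_const_mul]
  have h6 := (hp.integral_massDensity_le ha hab).trans
    (div_le_div_of_nonneg_right (hm b hb) (by positivity))
  calc _ ≤ 2 / a * (C / (2 * Real.pi)) := by gcongr
    _ = C / (Real.pi * a) := by field_simp

lemma abs_nuLam_le {R : ℝ} (hR : 0 < R) (hC : 4 * C ≤ R)
    (hm : ∀ r, 0 < r → hawkingMass c ε f r ≤ C) : |nuLam ε f R| ≤ 4 * C / R := by
  rw [abs_of_nonpos (nuLam_nonpos hp.eps_nonneg f hR.le)]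
  have hπ := Real.pi_pos
  have h1 := intervalIntegral_tendsto_integral_Ioi R (hp.integrable R hR) tendsto_id
  have h2 : ∫ s in Ioi R, (f s - mean ε f s) ^ 2 / (s + ε) ≤ C / (Real.pi * R) := by
    refine le_of_tendsto h1 ?_
    filter_upwards [eventually_ge_atTop R] with b hb
    exact hp.integral_density_le hR hb hC hm
  unfold nuLam
  calc _ = 4 * Real.pi * ∫ s in Ioi R, (f s - mean ε f s) ^ 2 / (s + ε) := by ring
    _ ≤ 4 * Real.pi * (C / (Real.pi * R)) := by gcongr
    _ = 4 * C / R := by field_simp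

/-- The integrand is E'/(4π), and E increases from a positive value to one at most 1. The weight E
is what makes the bound hold down to the center with no assumption on ν + λ there. -/
lemma integral_exp_density_le {a b : ℝ} (ha : 0 < a) (hab : a ≤ b) :
    ∫ s in a..b, expNuLam ε f s * ((f s - mean ε f s) ^ 2 / (s + ε)) ≤ 1 / (4 * Real.pi) := by
  have hπ := Real.pi_pos
  have hb := ha.trans_le hab
  have hc := hp.cont_density
  have hE := hp.cont_expNuLam
  have h1 := intervalIntegral.integral_eq_sub_of_hasDerivAt (f := expNuLam ε f) (a := a) (b := b)
    (fun x hx => hp.hasDerivAt_expNuLam (lt_of_lt_of_le (lt_min ha hb) hx.1))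
    (intervalIntegrable_of_continuousOn_Ioi ha hb (by fun_prop))
  have h2 : ∀ s, 4 * Real.pi * ((f s - mean ε f s) ^ 2 / (s + ε)) * expNuLam ε f s
      = 4 * Real.pi * (expNuLam ε f s * ((f s - mean ε f s) ^ 2 / (s + ε))) := fun s => by ring
  simp only [h2] at h1
  rw [intervalIntegral.integral_const_mul] at h1
  rw [le_div_iff₀ (by positivity), mul_comm, h1]
  have := expNuLam_le_one hp.eps_nonneg f hb.le
  have := expNuLam_pos ε f a
  linarith

end IsProfile

/-- The chain rule along a curve, for functions known only through continuous partial derivatives;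
it serves to follow the mass along slanted lines. -/
lemma hasDerivAt_comp_of_partial {F F₁ F₂ : ℝ → ℝ → ℝ}
    (h1 : ContinuousOn (fun p : ℝ × ℝ => F₁ p.1 p.2) (Ioi 0 ×ˢ Ioi 0))
    (h2 : ContinuousOn (fun p : ℝ × ℝ => F₂ p.1 p.2) (Ioi 0 ×ˢ Ioi 0))
    (d1 : ∀ u r, 0 < u → 0 < r → HasDerivAt (fun v => F v r) (F₁ u r) u)
    (d2 : ∀ u r, 0 < u → 0 < r → HasDerivAt (fun s => F u s) (F₂ u r) r)
    {x y : ℝ → ℝ} {x' y' t : ℝ} (hx0 : 0 < x t) (hy0 : 0 < y t)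
    (hx : HasDerivAt x x' t) (hy : HasDerivAt y y' t) :
    HasDerivAt (fun t => F (x t) (y t)) (F₁ (x t) (y t) * x' + F₂ (x t) (y t) * y') t := by
  have hn : Ioi (0 : ℝ) ×ˢ Ioi (0 : ℝ) ∈ 𝓝 (x t, y t) :=
    prod_mem_nhds (Ioi_mem_nhds hx0) (Ioi_mem_nhds hy0)
  have h := hasStrictFDerivAt_uncurry_coprod (𝕜 := ℝ) (u := (x t, y t)) (f := F)
    (f₁ := fun u r => ContinuousLinearMap.toSpanSingleton ℝ (F₁ u r))
    (f₂ := fun u r => ContinuousLinearMap.toSpanSingleton ℝ (F₂ u r))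
    (by filter_upwards [hn] with p hp using (d1 p.1 p.2 hp.1 hp.2).hasFDerivAt)
    (by filter_upwards [hn] with p hp using (d2 p.1 p.2 hp.1 hp.2).hasFDerivAt)
    (by
      have := (h1.continuousAt hn)
      exact (ContinuousLinearMap.toSpanSingletonCLE (𝕜 := ℝ) (E := ℝ)).continuous.continuousAt.comp this)
    (by
      have := (h2.continuousAt hn)
      exact (ContinuousLinearMap.toSpanSingletonCLE (𝕜 := ℝ) (E := ℝ)).continuous.continuousAt.comp this)
  have h3 := h.hasFDerivAt.comp_hasDerivAt t (hx.prodMk hy)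
  refine h3.congr_deriv ?_
  simp [Function.HasUncurry.uncurry, mul_comm]

/-! ### Propagation of positivity and of the mass bound -/

namespace IsRegularizedSolution

variable {c ε : ℝ} {h₀ : ℝ → ℝ} {h : ℝ → ℝ → ℝ} (hs : IsRegularizedSolution c ε h₀ h)
  (hε : 0 < ε)
include hs hε

lemma cont_xiReg_left {r : ℝ} (hr : 0 ≤ r) :
    ContinuousOn (fun u => xiReg c ε (h u) r) (Ici 0) :=
  continuousOn_left (F := fun u r => xiReg c ε (h u) r) (hs.cont_xiReg hε) hr

omit hε in
lemma cont_expNuLam_left {r : ℝ} (hr : 0 ≤ r) :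
    ContinuousOn (fun u => expNuLam ε (h u) r) (Ici 0) :=
  continuousOn_left (F := fun u r => expNuLam ε (h u) r) hs.cont_expNuLam hr

lemma cont_gBar_mul_dev_left {r : ℝ} (hr : 0 ≤ r) :
    ContinuousOn (fun u => gBar c ε (h u) r * (h u r - mean ε (h u) r)) (Ici 0) :=
  continuousOn_left (F := fun u r => gBar c ε (h u) r * (h u r - mean ε (h u) r))
    (hs.cont_gBar_mul_dev hε) hr

lemma cont_dev_left {r : ℝ} (hr : 0 ≤ r) :
    ContinuousOn (fun u => h u r - mean ε (h u) r) (Ici 0) :=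
  continuousOn_left (F := fun u r => h u r - mean ε (h u) r) (hs.cont_dev hε) hr

lemma cont_wCoef_left {r : ℝ} (hr : 0 ≤ r) :
    ContinuousOn (fun u => wCoef c ε (h u) r) (Ici 0) :=
  continuousOn_left (F := fun u r => wCoef c ε (h u) r) (hs.cont_wCoef hε) hr

/-- The term ξ_ε² is discarded and ḡ = (w/ρ)E inserted. The remaining loss is quadratic in w, hence
of the form β w with a coefficient β continuous in u. -/
lemma deriv_wCoef_ge {u r : ℝ} (hu : 0 ≤ u) (hr : 0 < r) :
    -(2 * Real.pi * expNuLam ε (h u) r * (wCoef c ε (h u) r / (r + ε)) ^ 2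
      * (h u r - mean ε (h u) r) ^ 2) ≤ 2 * Real.pi / expNuLam ε (h u) r *
      (xiReg c ε (h u) r ^ 2 - (gBar c ε (h u) r * (h u r - mean ε (h u) r)) ^ 2) := by
  rw [(hs.isProfile hε hu).gBar_eq hr]
  have hE := expNuLam_pos ε (h u) r
  have hπ := Real.pi_pos
  have : 0 ≤ 2 * Real.pi / expNuLam ε (h u) r * xiReg c ε (h u) r ^ 2 := by positivity
  rw [mul_sub]
  have h2 : 2 * Real.pi / expNuLam ε (h u) r * (wCoef c ε (h u) r / (r + ε)
      * expNuLam ε (h u) r * (h u r - mean ε (h u) r)) ^ 2 = 2 * Real.pi * expNuLam ε (h u) r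
      * (wCoef c ε (h u) r / (r + ε)) ^ 2 * (h u r - mean ε (h u) r) ^ 2 := by
    field_simp
  rw [h2]
  linarith

/-- Positivity of `ḡ` propagates along the lines `r = const`. -/
lemma wCoef_pos {u r : ℝ} (hr : 0 < r) (hw : 0 < wCoef c ε (h 0) r) (hu : 0 ≤ u) :
    0 < wCoef c ε (h u) r := by
  have hρ : 0 < r + ε := by positivity
  -- One factor w of the quadratic loss is kept inside β, so w e^{∫β} is nondecreasing in u. The
  -- sign of β plays no role, so no positivity is presupposed.
  set β : ℝ → ℝ := fun u => 2 * Real.pi * expNuLam ε (h u) r * wCoef c ε (h u) r / (r + ε) ^ 2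
      * (h u r - mean ε (h u) r) ^ 2 with hβ
  have cβ : ContinuousOn β (Ici 0) := by
    have h1 := hs.cont_expNuLam_left hr.le
    have h2 := hs.cont_wCoef_left hε hr.le
    have h3 := hs.cont_dev_left hε hr.le
    fun_prop
  set y : ℝ → ℝ := fun u => wCoef c ε (h u) r * Real.exp (∫ t in (0 : ℝ)..u, β t) with hy
  have cB : ContinuousOn (fun u => ∫ t in (0 : ℝ)..u, β t) (Ici 0) :=
    continuousOn_right (F := fun _ u => ∫ t in (0 : ℝ)..u, β t)
      (continuousOn_primitive_quadrant (F := fun _ u => β u)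
        (cβ.comp continuousOn_snd fun p hp => hp.2)) (u := 0) le_rfl
  have hd : ∀ u, 0 < u → HasDerivAt y ((2 * Real.pi / expNuLam ε (h u) r *
      (xiReg c ε (h u) r ^ 2 - (gBar c ε (h u) r * (h u r - mean ε (h u) r)) ^ 2)
        + β u * wCoef c ε (h u) r) * Real.exp (∫ t in (0 : ℝ)..u, β t)) u := by
    intro u hu
    refine ((hs.hasDerivAt_wCoef_left hε hu hr.le).mul
      (hasDerivAt_primitive_of_continuousOn_Ioi hu (cβ.mono Ioi_subset_Ici_self)
        (intervalIntegrable_of_continuousOn_Ici le_rfl hu.le cβ)).exp).congr_deriv ?_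
    ring
  have hmono : MonotoneOn y (Ici 0) := by
    refine monotoneOn_of_hasDerivWithinAt_nonneg (convex_Ici 0)
      ((hs.cont_wCoef_left hε hr.le).mul cB.rexp)
      (fun x hx => (hd x (by simpa using hx)).hasDerivWithinAt) fun x hx => ?_
    have hx' : 0 < x := by simpa using hx
    refine mul_nonneg ?_ (Real.exp_pos _).le
    have := hs.deriv_wCoef_ge hε hx'.le hr
    have e : 2 * Real.pi * expNuLam ε (h x) r * (wCoef c ε (h x) r / (r + ε)) ^ 2
      * (h x r - mean ε (h x) r) ^ 2 = β x * wCoef c ε (h x) r := by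
      simp only [hβ]; field_simp
    linarith
  have h1 := hmono (mem_Ici.2 le_rfl) hu hu
  simp only [hy, intervalIntegral.integral_same, Real.exp_zero, mul_one] at h1
  exact pos_of_mul_pos_left (hw.trans_le h1) (Real.exp_pos _).le

/-- The Hawking mass does not increase along lines of inward slope one half. -/
lemma hawkingMass_le {C : ℝ} (hw : ∀ r, 0 < r → 0 < wCoef c ε (h 0) r)
    (hm : ∀ r, 0 < r → hawkingMass c ε (h 0) r ≤ C) {u r : ℝ} (hu : 0 ≤ u) (hr : 0 < r) :
    hawkingMass c ε (h u) r ≤ C := by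
  have hπ := Real.pi_pos
  set y : ℝ → ℝ := fun t => r + (u - t) / 2 with hy
  have hy' : ∀ t, HasDerivAt y (-1 / 2) t := fun t =>
    (((hasDerivAt_id t).const_sub u).div_const 2).const_add r
  have hy0 : ∀ t ∈ Icc 0 u, 0 < y t := fun t ht => by
    simp only [hy]; linarith [ht.2]
  have cw : ContinuousOn (fun t => wCoef c ε (h t) (y t)) (Icc 0 u) :=
    (hs.cont_wCoef hε).comp (f := fun t => (t, y t)) (by fun_prop)
      fun t ht => ⟨ht.1, (hy0 t ht).le⟩
  have hρ : ∀ p ∈ Ioi (0 : ℝ) ×ˢ Ioi (0 : ℝ), p.2 + ε ≠ 0 := fun p hp => by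
    have : 0 < p.2 := hp.2
    positivity
  have hsub : Ioi (0 : ℝ) ×ˢ Ioi (0 : ℝ) ⊆ quadrant := prod_mono Ioi_subset_Ici_self
    Ioi_subset_Ici_self
  have dw : ∀ t ∈ Ioo 0 u, HasDerivAt (fun t => wCoef c ε (h t) (y t)) _ t := fun t ht =>
    hasDerivAt_comp_of_partial (F := fun u r => wCoef c ε (h u) r)
      (F₁ := fun u r => 2 * Real.pi / expNuLam ε (h u) r *
        (xiReg c ε (h u) r ^ 2 - (gBar c ε (h u) r * (h u r - mean ε (h u) r)) ^ 2))
      (F₂ := fun u r => (1 - 4 * Real.pi * c ^ 2 * ((r + ε) * mean ε (h u) r) ^ 2)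
        - 4 * Real.pi * ((h u r - mean ε (h u) r) ^ 2 / (r + ε)) * wCoef c ε (h u) r)
      (x := fun t => t)
      (by
        have h1 := (hs.cont_expNuLam).mono hsub
        have h2 := (hs.cont_xiReg hε).mono hsub
        have h3 := (hs.cont_gBar_mul_dev hε).mono hsub
        exact (continuousOn_const.div h1 fun p _ => (expNuLam_pos _ _ _).ne').mul
          ((h2.pow 2).sub (h3.pow 2)))
      (by
        have h1 := (hs.cont_mean hε).mono hsub
        have h2 := (hs.cont_wCoef hε).mono hsub
        have h3 := (hs.cont_dev hε).mono hsub
        have h4 : ContinuousOn (fun p : ℝ × ℝ =>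
            (h p.1 p.2 - mean ε (h p.1) p.2) ^ 2 / (p.2 + ε)) (Ioi 0 ×ˢ Ioi 0) :=
          (h3.pow 2).div (by fun_prop) hρ
        fun_prop)
      (fun u r hu hr => hs.hasDerivAt_wCoef_left hε hu hr.le)
      (fun u r hu hr => (hs.isProfile hε hu.le).hasDerivAt_wCoef hr)
      ht.1 (hy0 t ⟨ht.1.le, ht.2.le⟩) (hasDerivAt_id t) (hy' t)
  -- Along the line w - y = ε - 2m. Its derivative is at least 2πWk²(1 - E W) plus a nonnegative
  -- term in h̄, where W = w/ρ, and E W = ḡ ≤ 1. The slope 1/2 is the largest characteristic speed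
  -- ḡ/2 allowed by this bound.
  have hanti : MonotoneOn (fun t => wCoef c ε (h t) (y t) - y t) (Icc 0 u) := by
    refine monotoneOn_of_hasDerivWithinAt_nonneg (convex_Icc 0 u) (cw.sub (by fun_prop))
      (fun t ht => ((dw t (by simpa using ht)).sub (hy' t)).hasDerivWithinAt) fun t ht => ?_
    have ht' : t ∈ Ioo 0 u := by simpa using ht
    have hyt := hy0 t ⟨ht'.1.le, ht'.2.le⟩
    have hp := hs.isProfile hε ht'.1.le
    have hwt := hs.wCoef_pos hε hyt (hw _ hyt) ht'.1.le
    have h1 := hs.deriv_wCoef_ge hε ht'.1.le hyt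
    have h2 := hp.gBar_le hyt
    have h3 := expNuLam_le_one hε.le (h t) hyt.le
    rw [hp.gBar_eq hyt] at h2
    have hρt := hp.rho_pos hyt
    set W := wCoef c ε (h t) (y t) / (y t + ε) with hW
    have hW0 : 0 ≤ W := by positivity
    set k := h t (y t) - mean ε (h t) (y t) with hk
    have e1 : k ^ 2 / (y t + ε) * wCoef c ε (h t) (y t) = W * k ^ 2 := by rw [hW]; ring
    have e2 : expNuLam ε (h t) (y t) * W ^ 2 * k ^ 2 ≤ W * k ^ 2 := by
      have : W * expNuLam ε (h t) (y t) ≤ 1 := h2.trans h3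
      have h5 : 0 ≤ W * k ^ 2 := by positivity
      nlinarith
    have e3 : 0 ≤ c ^ 2 * ((y t + ε) * mean ε (h t) (y t)) ^ 2 := by positivity
    rw [mul_assoc (4 * Real.pi) (k ^ 2 / (y t + ε)), e1]
    nlinarith
  have h1 := hanti (left_mem_Icc.2 hu) (right_mem_Icc.2 hu) hu
  have h2 := hm _ (hy0 0 (left_mem_Icc.2 hu))
  rw [hawkingMass_eq] at h2 ⊢
  have h3 : y u = r := by simp [hy]
  beta_reduce at h1
  rw [h3] at h1
  linarith

/-- The integrated mass balance on the line `r = const`. -/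
lemma integral_xiReg_sq_le {u₀ r : ℝ} (hu₀ : 0 ≤ u₀) (hr : 0 < r) :
    ∫ u in (0 : ℝ)..u₀, xiReg c ε (h u) r ^ 2 / expNuLam ε (h u) r
      ≤ (∫ u in (0 : ℝ)..u₀, (gBar c ε (h u) r * (h u r - mean ε (h u) r)) ^ 2
          / expNuLam ε (h u) r) + hawkingMass c ε (h 0) r / Real.pi := by
  have hπ := Real.pi_pos
  have c1 : ContinuousOn (fun u => xiReg c ε (h u) r ^ 2 / expNuLam ε (h u) r) (Ici 0) :=
    ((hs.cont_xiReg_left hε hr.le).pow 2).div (hs.cont_expNuLam_left hr.le)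
      fun _ _ => (expNuLam_pos _ _ _).ne'
  have c2 : ContinuousOn (fun u => (gBar c ε (h u) r * (h u r - mean ε (h u) r)) ^ 2
      / expNuLam ε (h u) r) (Ici 0) :=
    ((hs.cont_gBar_mul_dev_left hε hr.le).pow 2).div (hs.cont_expNuLam_left hr.le)
      fun _ _ => (expNuLam_pos _ _ _).ne'
  have i1 := intervalIntegrable_of_continuousOn_Ici le_rfl hu₀ c1
  have i2 := intervalIntegrable_of_continuousOn_Ici le_rfl hu₀ c2
  have h1 := intervalIntegral.integral_eq_sub_of_hasDerivAt_of_le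
    (f := fun u => wCoef c ε (h u) r)
    (f' := fun u => 2 * Real.pi * (xiReg c ε (h u) r ^ 2 / expNuLam ε (h u) r
      - (gBar c ε (h u) r * (h u r - mean ε (h u) r)) ^ 2 / expNuLam ε (h u) r)) hu₀
    ((hs.cont_wCoef_left hε hr.le).mono fun x hx => hx.1)
    (fun u hu => (hs.hasDerivAt_wCoef_left hε hu.1 hr.le).congr_deriv (by ring))
    ((i1.sub i2).const_mul _)
  rw [intervalIntegral.integral_const_mul, intervalIntegral.integral_sub i1 i2] at h1
  have h2 := (hs.isProfile hε hu₀).hawkingMass_nonneg hr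
  -- The change of w is twice the loss of mass; the final mass is nonnegative and is dropped.
  have h3 : wCoef c ε (h u₀) r - wCoef c ε (h 0) r
      = 2 * (hawkingMass c ε (h 0) r - hawkingMass c ε (h u₀) r) := by
    rw [hawkingMass_eq, hawkingMass_eq]; ring
  rw [h3] at h1
  have h4 : ∫ u in (0 : ℝ)..u₀, xiReg c ε (h u) r ^ 2 / expNuLam ε (h u) r
      = (∫ u in (0 : ℝ)..u₀, (gBar c ε (h u) r * (h u r - mean ε (h u) r)) ^ 2
          / expNuLam ε (h u) r)
        + (hawkingMass c ε (h 0) r - hawkingMass c ε (h u₀) r) / Real.pi := by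
    rw [← sub_eq_iff_eq_add', eq_div_iff hπ.ne']
    linarith
  rw [h4]
  gcongr
  linarith

end IsRegularizedSolution

/-! ### Initial data: bounds uniform in the regularization parameter -/

lemma integral_one_div_sq_le {a b : ℝ} (ha : 0 < a) (hab : a ≤ b) :
    ∫ s in a..b, 1 / s ^ 2 ≤ 1 / a := by
  have hb := ha.trans_le hab
  have h0 : ∀ s ∈ uIcc a b, 0 < s := fun s hs => lt_of_lt_of_le (lt_min ha hb) hs.1
  have h1 := intervalIntegral.integral_eq_sub_of_hasDerivAt (f := fun s : ℝ => -s⁻¹)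
    (f' := fun s => 1 / s ^ 2) (a := a) (b := b)
    (fun s hs => (hasDerivAt_inv (h0 s hs).ne').neg.congr_deriv (by simp))
    (ContinuousOn.intervalIntegrable (continuousOn_const.div (by fun_prop)
      fun s hs => pow_ne_zero 2 (h0 s hs).ne'))
  rw [h1]
  have := inv_pos.2 hb
  simp only [one_div]
  linarith

namespace InitialData

variable {c : ℝ} {h₀ : ℝ → ℝ} (hd : InitialData c h₀)
include hd

lemma cont : ContinuousOn h₀ (Ici 0) := hd.contDiff.continuousOn

lemma cont_primitive : ContinuousOn (fun r => ∫ s in (0 : ℝ)..r, h₀ s) (Ici 0) :=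
  continuousOn_right (F := fun _ r => ∫ s in (0 : ℝ)..r, h₀ s)
    (continuousOn_primitive_quadrant (F := fun _ s => h₀ s)
      (hd.cont.comp continuousOn_snd fun _ hp => hp.2)) (u := 0) le_rfl

lemma hasDerivAt_mean_zero {r : ℝ} (hr : 0 < r) :
    HasDerivAt (mean 0 h₀) ((h₀ r - mean 0 h₀ r) / r) r := by
  have := hasDerivAt_mean le_rfl (hd.cont.mono Ioi_subset_Ici_self) hr
    (intervalIntegrable_of_continuousOn_Ici le_rfl hr.le hd.cont)
  rwa [add_zero] at this

lemma isProfile : IsProfile c 0 h₀ := by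
  refine IsProfile.of_mean_sq le_rfl (hd.cont.mono Ioi_subset_Ici_self)
    (fun r hr => (hd.hasDerivAt_mean_zero hr).continuousAt.continuousWithinAt)
    (fun r hr => by simpa using hd.integrable.mono_set (Ioi_subset_Ioi hr.le)) fun r hr => ?_
  have h1 : IntervalIntegrable (fun s => c ^ 2 * (∫ x in (0 : ℝ)..s, h₀ x) ^ 2) volume 0 r :=
    intervalIntegrable_of_continuousOn_Ici le_rfl hr.le
      (continuousOn_const.mul (hd.cont_primitive.pow 2))
  refine h1.congr fun s hs => ?_
  rw [uIoc_of_le hr.le] at hs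
  rw [mul_mean (by simpa using hs.1.ne')]

lemma wCoef_pos {r : ℝ} (hr : 0 < r) : 0 < wCoef c 0 h₀ r := by
  have := hd.gBar_pos r hr
  have := expNuLam_pos 0 h₀ r
  unfold wCoef
  positivity

/-- Since w > 0 the mass is nondecreasing in r, so the Bondi mass is its supremum. -/
lemma exists_mass_bound : ∃ M, 0 ≤ M ∧ ∀ r, 0 < r → hawkingMass c 0 h₀ r ≤ M := by
  obtain ⟨M, hM⟩ := hd.finite_bondi_mass
  have hp := hd.isProfile
  have h1 : ∀ r, 0 < r → hawkingMass c 0 h₀ r ≤ M := by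
    intro r hr
    refine ge_of_tendsto hM ?_
    filter_upwards [eventually_ge_atTop r] with b hb
    rw [← sub_nonneg, hp.hawkingMass_sub hr (hr.trans_le hb)]
    have hπ := Real.pi_pos
    refine mul_nonneg (by positivity) (intervalIntegral.integral_nonneg hb fun s hs => ?_)
    have hs0 := hr.trans_le hs.1
    have := hd.wCoef_pos hs0
    positivity
  exact ⟨M, (hp.hawkingMass_nonneg one_pos).trans (h1 1 one_pos), h1⟩

/-- From r = 4M on one has w ≥ r/2, so the mass density dominates half of the squared deviation
itself, without the weight 1/s that appears in ν + λ. -/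
lemma exists_dev_sq_bound : ∃ R X, 1 ≤ R ∧ 0 ≤ X ∧
    ∀ b, R ≤ b → ∫ s in R..b, (h₀ s - mean 0 h₀ s) ^ 2 ≤ X := by
  obtain ⟨M, hM0, hM⟩ := hd.exists_mass_bound
  have hp := hd.isProfile
  have hπ := Real.pi_pos
  refine ⟨max (4 * M) 1, M / Real.pi, le_max_right _ _, by positivity, fun b hb => ?_⟩
  set R := max (4 * M) 1
  have hR : 0 < R := lt_of_lt_of_le one_pos (le_max_right _ _)
  have hbp := hR.trans_le hb
  have h1 : ∫ s in R..b, (h₀ s - mean 0 h₀ s) ^ 2 ≤ ∫ s in R..b, 2 *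
      (c ^ 2 * ((s + 0) * mean 0 h₀ s) ^ 2
        + wCoef c 0 h₀ s / (s + 0) * (h₀ s - mean 0 h₀ s) ^ 2) := by
    refine intervalIntegral.integral_mono_on hb
      (intervalIntegrable_of_continuousOn_Ioi hR hbp (hp.cont_dev.pow 2))
      ((intervalIntegrable_of_continuousOn_Ioi hR hbp hp.cont_massDensity).const_mul _) ?_
    intro s hs
    have hs0 := hR.trans_le hs.1
    have hm' := hM s hs0
    rw [hawkingMass_eq] at hm'
    have h2 : 1 / 2 ≤ wCoef c 0 h₀ s / (s + 0) := by
      rw [le_div_iff₀ (by linarith)]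
      have : 4 * M ≤ R := le_max_left _ _
      linarith [hs.1]
    have h4 : 0 ≤ c ^ 2 * ((s + 0) * mean 0 h₀ s) ^ 2 := by positivity
    nlinarith [sq_nonneg (h₀ s - mean 0 h₀ s)]
  refine h1.trans ?_
  rw [intervalIntegral.integral_const_mul]
  have h2 := (hp.integral_massDensity_le hR hb).trans
    (div_le_div_of_nonneg_right (hM b hbp) (by positivity))
  calc _ ≤ 2 * (M / (2 * Real.pi)) := by gcongr
    _ = M / Real.pi := by field_simp

/-- On [0, R] the mean is bounded by the supremum of |h₀|. Beyond R its derivative is (h₀ - h̄₀)/s,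
and |h₀ - h̄₀|/s ≤ ((h₀ - h̄₀)² + 1/s²)/2 has integrals over [R, r] bounded uniformly in r. -/
lemma exists_mean_bound : ∃ B, 0 ≤ B ∧ ∀ r, 0 < r → |mean 0 h₀ r| ≤ B := by
  obtain ⟨R, X, hR1, hX0, hX⟩ := hd.exists_dev_sq_bound
  have hp := hd.isProfile
  have hR : 0 < R := one_pos.trans_le hR1
  obtain ⟨B, hB⟩ := (isCompact_Icc (a := (0 : ℝ)) (b := R)).exists_bound_of_continuousOn
    (hd.cont.mono fun x hx => hx.1)
  have hB0 : 0 ≤ B := (norm_nonneg _).trans (hB 0 ⟨le_rfl, hR.le⟩)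
  have h1 : ∀ r, 0 < r → r ≤ R → |mean 0 h₀ r| ≤ B := by
    intro r hr hrR
    have := intervalIntegral.norm_integral_le_of_norm_le_const (a := 0) (b := r) (f := h₀) (C := B)
      fun x hx => by
        rw [uIoc_of_le hr.le] at hx
        exact hB x ⟨hx.1.le, hx.2.trans hrR⟩
    rw [sub_zero, abs_of_pos hr, Real.norm_eq_abs] at this
    unfold mean
    rw [add_zero, abs_mul, abs_of_pos (one_div_pos.2 hr), one_div, inv_mul_le_iff₀ hr]
    linarith
  refine ⟨B + (X + 1) / 2, by positivity, fun r hr => ?_⟩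
  rcases le_total r R with hrR | hrR
  · exact (h1 r hr hrR).trans (by linarith)
  · have c1 : ContinuousOn (fun s => (h₀ s - mean 0 h₀ s) / s) (Ioi 0) :=
      hp.cont_dev.div continuousOn_id fun s hs => ne_of_gt hs
    have c2 : ContinuousOn (fun s : ℝ => 1 / s ^ 2) (Ioi 0) :=
      continuousOn_const.div (by fun_prop) fun s hs => pow_ne_zero 2 (ne_of_gt hs)
    have c3 := hp.cont_dev
    have h2 := intervalIntegral.integral_eq_sub_of_hasDerivAt (f := mean 0 h₀) (a := R) (b := r)
      (fun s hs => hd.hasDerivAt_mean_zero (lt_of_lt_of_le (lt_min hR hr) hs.1))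
      (intervalIntegrable_of_continuousOn_Ioi hR hr c1)
    have h3 : |∫ s in R..r, (h₀ s - mean 0 h₀ s) / s|
        ≤ ∫ s in R..r, ((h₀ s - mean 0 h₀ s) ^ 2 + 1 / s ^ 2) * (1 / 2) := by
      refine (intervalIntegral.abs_integral_le_integral_abs hrR).trans ?_
      refine intervalIntegral.integral_mono_on hrR
        (intervalIntegrable_of_continuousOn_Ioi hR hr c1.abs)
        (intervalIntegrable_of_continuousOn_Ioi hR hr (by fun_prop)) fun s hs => ?_
      have := sq_nonneg (|h₀ s - mean 0 h₀ s| - 1 / s)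
      have hs0 := hR.trans_le hs.1
      rw [sub_sq, sq_abs] at this
      rw [abs_div, abs_of_pos hs0]
      have e : |h₀ s - mean 0 h₀ s| / s = |h₀ s - mean 0 h₀ s| * (1 / s) := by ring
      have e2 : (1 / s) ^ 2 = 1 / s ^ 2 := by ring
      rw [e, ← e2]
      linarith
    rw [intervalIntegral.integral_mul_const, intervalIntegral.integral_add
      (intervalIntegrable_of_continuousOn_Ioi hR hr (by fun_prop))
      (intervalIntegrable_of_continuousOn_Ioi hR hr c2)] at h3
    have h4 := hX r hrR
    have h5 := integral_one_div_sq_le hR hrR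
    have h6 : 1 / R ≤ 1 := by rw [div_le_one hR]; exact hR1
    have h7 := h1 R hR le_rfl
    have h8 : mean 0 h₀ r = mean 0 h₀ R + ∫ s in R..r, (h₀ s - mean 0 h₀ s) / s := by
      rw [h2]; ring
    rw [h8]
    refine (abs_add_le _ _).trans ?_
    linarith

/-- The integrand majorizes the mass density of the regularized data for every ε at once: the
deviation changes by h̄₀ ε/(s + ε), which is at most B/s once B bounds the mean. -/
lemma exists_integral_bound (B : ℝ) {a : ℝ} (ha : 0 < a) : ∃ X, ∀ r, a ≤ r →
    ∫ s in a..r, (c ^ 2 * (s * mean 0 h₀ s) ^ 2 + 2 * (h₀ s - mean 0 h₀ s) ^ 2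
      + 2 * B ^ 2 * (1 / s ^ 2)) ≤ X := by
  obtain ⟨R, X, hR1, hX0, hX⟩ := hd.exists_dev_sq_bound
  obtain ⟨M, hM0, hM⟩ := hd.exists_mass_bound
  have hp := hd.isProfile
  have hR : 0 < R := one_pos.trans_le hR1
  have hπ := Real.pi_pos
  have c2 : ContinuousOn (fun s : ℝ => 1 / s ^ 2) (Ioi 0) :=
    continuousOn_const.div (by fun_prop) fun s hs => pow_ne_zero 2 (ne_of_gt hs)
  have c3 := hp.cont_dev
  have c4 := hp.cont_mean
  have i1 : ∀ x y, 0 < x → 0 < y → IntervalIntegrable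
      (fun s => (h₀ s - mean 0 h₀ s) ^ 2) volume x y :=
    fun x y hx hy => intervalIntegrable_of_continuousOn_Ioi hx hy (by fun_prop)
  refine ⟨M / (2 * Real.pi) + 2 * ((∫ s in a..max a R, (h₀ s - mean 0 h₀ s) ^ 2) + X)
    + 2 * B ^ 2 * (1 / a), fun r har => ?_⟩
  have hr := ha.trans_le har
  have haR : 0 < max a R := ha.trans_le (le_max_left _ _)
  rw [intervalIntegral.integral_add (intervalIntegrable_of_continuousOn_Ioi ha hr (by fun_prop))
      (intervalIntegrable_of_continuousOn_Ioi ha hr (by fun_prop)),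
    intervalIntegral.integral_add (intervalIntegrable_of_continuousOn_Ioi ha hr (by fun_prop))
      (intervalIntegrable_of_continuousOn_Ioi ha hr (by fun_prop)),
    intervalIntegral.integral_const_mul (2 * B ^ 2), intervalIntegral.integral_const_mul 2]
  have h1 := (hp.integral_mean_sq_le ha har fun r hr => (hd.wCoef_pos hr).le).trans
    (div_le_div_of_nonneg_right (hM r hr) (by positivity : 0 ≤ 2 * Real.pi))
  simp only [add_zero] at h1
  have h2 : ∫ s in a..r, (h₀ s - mean 0 h₀ s) ^ 2
      ≤ (∫ s in a..max a R, (h₀ s - mean 0 h₀ s) ^ 2) + X := by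
    rcases le_total r (max a R) with hrR | hrR
    · rw [← intervalIntegral.integral_add_adjacent_intervals (i1 a r ha hr) (i1 r _ hr haR)]
      have := intervalIntegral.integral_nonneg (μ := volume) hrR
        fun s _ => sq_nonneg (h₀ s - mean 0 h₀ s)
      linarith
    · rw [← intervalIntegral.integral_add_adjacent_intervals (i1 a _ ha haR) (i1 _ r haR hr)]
      have h3 := hX r ((le_max_right _ _).trans hrR)
      rw [← intervalIntegral.integral_add_adjacent_intervals (i1 R _ hR haR) (i1 _ r haR hr)] at h3
      have := intervalIntegral.integral_nonneg (μ := volume) (le_max_right a R)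
        fun s _ => sq_nonneg (h₀ s - mean 0 h₀ s)
      linarith
  have h5 := integral_one_div_sq_le ha har
  gcongr

omit hd in
-- Consequently (s + ε) f̄_ε does not depend on ε; regularization enters the data only through the
-- deviation and the weight 1/ρ.
lemma mean_eq {ε : ℝ} {f : ℝ → ℝ} (hf : EqOn f h₀ (Ici 0)) {s : ℝ} (hs : 0 < s) (hsε : 0 < s + ε) :
    mean ε f s = s / (s + ε) * mean 0 h₀ s := by
  have : ∫ x in (0 : ℝ)..s, f x = ∫ x in (0 : ℝ)..s, h₀ x := by
    refine intervalIntegral.integral_congr fun x hx => hf ?_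
    rw [uIcc_of_le hs.le] at hx
    exact hx.1
  unfold mean
  rw [this, add_zero]
  field_simp

/-- The regularized mass of the data is bounded and `ḡ` is positive, uniformly for small `ε`. -/
theorem exists_uniform_bound : ∃ ε₀ C : ℝ, 0 < ε₀ ∧ ∀ ε f, 0 < ε → ε < ε₀ → IsProfile c ε f →
    EqOn f h₀ (Ici 0) → (∀ r, 0 < r → 0 < wCoef c ε f r) ∧
      ∀ r, 0 < r → hawkingMass c ε f r ≤ C := by
  have hπ := Real.pi_pos
  have hp := hd.isProfile
  obtain ⟨B, hB0, hB⟩ := hd.exists_mean_bound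
  -- near the center `g` is positive
  obtain ⟨a, ha, ha1⟩ : ∃ a, 0 < a ∧ ∀ s, 0 < s → s ≤ a →
      4 * Real.pi * c ^ 2 * (s * mean 0 h₀ s) ^ 2 < 1 := by
    have h1 : ContinuousWithinAt (fun r => 4 * Real.pi * c ^ 2 * (∫ s in (0 : ℝ)..r, h₀ s) ^ 2)
        (Ici 0) 0 := (continuousOn_const.mul (hd.cont_primitive.pow 2)) 0 (mem_Ici.2 le_rfl)
    have h2 := h1.eventually_lt_const (u := 1) (by simp)
    obtain ⟨a, ha, h3⟩ := (mem_nhdsGE_iff_exists_Icc_subset).1 h2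
    refine ⟨a, ha, fun s hs hsa => ?_⟩
    have h4 := h3 ⟨hs.le, hsa⟩
    have h5 := mul_mean (ε := 0) (f := h₀) (r := s) (by simpa using hs.ne')
    rw [add_zero] at h5
    rw [h5]
    exact h4
  obtain ⟨X, hX⟩ := hd.exists_integral_bound B ha
  set C : ℝ := (a + 1) / 2 + 2 * Real.pi * X with hC
  -- For r > R ≥ 2C positivity of w = r + ε - 2m follows from the mass bound alone. Near the center
  -- it follows from g > 0. Only [a, R] requires comparison with ε = 0.
  set R : ℝ := max (2 * C) a with hR
  have haR : a ≤ R := le_max_right _ _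
  have hR0 : 0 < R := ha.trans_le haR
  obtain ⟨r₂, hr₂, hmin⟩ := (isCompact_Icc (a := a) (b := R)).exists_isMinOn
    (nonempty_Icc.2 haR) (hp.cont_wCoef.mono fun x hx => ha.trans_le hx.1)
  -- The unregularized w is at least 2η on [a, R]. The comparison starts at δ ≤ a, where the
  -- regularized w is positive, and δ ≤ η limits the initial discrepancy to η; the other η absorbs
  -- the error accumulated on [δ, r].
  set η := wCoef c 0 h₀ r₂ / 2 with hη
  have hη0 : 0 < η := half_pos (hd.wCoef_pos (ha.trans_le hr₂.1))
  set δ := min a η with hδ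
  have hδ0 : 0 < δ := lt_min ha hη0
  obtain ⟨B₁, hB₁⟩ := (isCompact_Icc (a := (0 : ℝ)) (b := R)).exists_bound_of_continuousOn
    (hd.cont.mono fun x hx => hx.1)
  have hB₁0 : 0 ≤ B₁ := (norm_nonneg _).trans (hB₁ 0 ⟨le_rfl, hR0.le⟩)
  -- On [δ, R] the deviation changes by x with |x| ≤ Bε/δ and |x| ≤ B, while |k| ≤ B₁ + B; hence (k
  -- + x)² - k² = x(2k + x) ≤ ε L.
  set L := B / δ * (2 * (B₁ + B) + B) with hL
  have hL0 : 0 ≤ L := by positivity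
  refine ⟨min 1 (η / (4 * Real.pi * L * R + 1)), C, lt_min one_pos (by positivity),
    fun ε f hε hε0 hpε hf => ?_⟩
  have hε1 : ε < 1 := hε0.trans_le (min_le_left _ _)
  have hε2 : ε * (4 * Real.pi * L * R + 1) < η :=
    (lt_div_iff₀ (by positivity)).1 (hε0.trans_le (min_le_right _ _))
  have hmean : ∀ s, 0 < s → (s + ε) * mean ε f s = s * mean 0 h₀ s := fun s hs => by
    have : s + ε ≠ 0 := by positivity
    rw [mean_eq hf hs (by positivity)]; field_simp
  have hdev : ∀ s, 0 < s → f s - mean ε f s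
      = (h₀ s - mean 0 h₀ s) + mean 0 h₀ s * (ε / (s + ε)) := fun s hs => by
    have : s + ε ≠ 0 := by positivity
    rw [mean_eq hf hs (by positivity), hf hs.le]; field_simp; ring
  have hnear : ∀ r, 0 < r → r ≤ a → 0 < wCoef c ε f r := by
    intro r hr hra
    unfold wCoef
    refine div_pos ?_ (expNuLam_pos _ _ _)
    rw [hpε.mul_gBar hr]
    refine intervalIntegral.intervalIntegral_pos_of_pos_on (hpε.gCoef_int r hr) (fun s hs => ?_) hr
    have h1 := ha1 s hs.1 (hs.2.le.trans hra)
    rw [← hmean s hs.1] at h1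
    refine mul_pos ?_ (expNuLam_pos _ _ _)
    have e : 4 * c ^ 2 * Real.pi * (s + ε) ^ 2 * mean ε f s ^ 2
        = 4 * Real.pi * c ^ 2 * ((s + ε) * mean ε f s) ^ 2 := by ring
    rw [e]
    linarith
  -- Only the upper bound w/ρ ≤ 1 is needed to estimate the mass density from above, so the mass
  -- bound can be obtained before positivity of w is known away from the center.
  have hmass : ∀ r, 0 < r → hawkingMass c ε f r ≤ C := by
    have h0 : ∀ r, 0 < r → r ≤ a → hawkingMass c ε f r ≤ (a + 1) / 2 := fun r hr hra => by
      rw [hawkingMass_eq]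
      have := hnear r hr hra
      linarith
    have hX0 : 0 ≤ X := by simpa using hX a le_rfl
    intro r hr
    rcases le_total r a with hra | hra
    · refine (h0 r hr hra).trans ?_
      rw [hC]
      have : 0 ≤ 2 * Real.pi * X := by positivity
      linarith
    · have h1 := hpε.hawkingMass_sub ha hr
      have c2 : ContinuousOn (fun s : ℝ => 1 / s ^ 2) (Ioi 0) :=
        continuousOn_const.div (by fun_prop) fun s hs => pow_ne_zero 2 (ne_of_gt hs)
      have c3 := hp.cont_dev
      have c4 := hp.cont_mean
      have h2 : ∫ s in a..r, (c ^ 2 * ((s + ε) * mean ε f s) ^ 2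
          + wCoef c ε f s / (s + ε) * (f s - mean ε f s) ^ 2) ≤ X := by
        refine le_trans ?_ (hX r hra)
        refine intervalIntegral.integral_mono_on hra
          (intervalIntegrable_of_continuousOn_Ioi ha hr hpε.cont_massDensity)
          (intervalIntegrable_of_continuousOn_Ioi ha hr (by fun_prop)) fun s hs => ?_
        have hs0 := ha.trans_le hs.1
        have hρ := hpε.rho_pos hs0
        rw [hmean s hs0]
        have h3 : wCoef c ε f s / (s + ε) ≤ 1 :=
          (div_le_one hρ).2 (by linarith [hpε.wCoef_le hs0])
        have h4 : wCoef c ε f s / (s + ε) * (f s - mean ε f s) ^ 2 ≤ (f s - mean ε f s) ^ 2 :=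
          mul_le_of_le_one_left (sq_nonneg _) h3
        have h5 : (mean 0 h₀ s * (ε / (s + ε))) ^ 2 ≤ B ^ 2 * (1 / s ^ 2) := by
          have h6 : ε / (s + ε) ≤ 1 / s := by
            rw [div_le_div_iff₀ hρ hs0]; nlinarith
          have h7 : 0 ≤ ε / (s + ε) := by positivity
          have h8 : |mean 0 h₀ s * (ε / (s + ε))| ≤ B * (1 / s) := by
            rw [abs_mul, abs_of_nonneg h7]
            exact mul_le_mul (hB s hs0) h6 h7 hB0
          have := pow_le_pow_left₀ (abs_nonneg _) h8 2
          rw [sq_abs] at this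
          refine this.trans_eq ?_
          ring
        have h9 : (f s - mean ε f s) ^ 2 ≤ 2 * (h₀ s - mean 0 h₀ s) ^ 2
            + 2 * (mean 0 h₀ s * (ε / (s + ε))) ^ 2 := by
          rw [hdev s hs0]
          nlinarith [sq_nonneg (h₀ s - mean 0 h₀ s - mean 0 h₀ s * (ε / (s + ε)))]
        linarith
      have h3 := h0 a ha le_rfl
      have : 2 * Real.pi * ∫ s in a..r, (c ^ 2 * ((s + ε) * mean ε f s) ^ 2
          + wCoef c ε f s / (s + ε) * (f s - mean ε f s) ^ 2) ≤ 2 * Real.pi * X := by gcongr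
      linarith
  refine ⟨fun r hr => ?_, hmass⟩
  rcases le_total r a with hra | hra
  · exact hnear r hr hra
  rcases le_or_gt r R with hrR | hrR
  swap
  · have h1 := hmass r hr
    rw [hawkingMass_eq] at h1
    have : 2 * C ≤ R := le_max_left _ _
    linarith
  -- comparison with the unregularized data on `[δ, r]`
  set y : ℝ → ℝ := fun s => expNuLam ε f s * (wCoef c ε f s - wCoef c 0 h₀ s) with hy
  have hδr : δ ≤ r := (min_le_left _ _).trans hra
  -- The factor E_ε is the integrating factor of the linear equation for the regularized w: it
  -- removes that w, and only the known unregularized w multiplies the difference of the two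
  -- densities.
  have hdy : ∀ s, 0 < s → HasDerivAt y (-(4 * Real.pi * expNuLam ε f s * wCoef c 0 h₀ s
      * ((f s - mean ε f s) ^ 2 / (s + ε) - (h₀ s - mean 0 h₀ s) ^ 2 / s))) s := by
    intro s hs
    refine ((hpε.hasDerivAt_expNuLam hs).mul
      ((hpε.hasDerivAt_wCoef hs).sub (hp.hasDerivAt_wCoef hs))).congr_deriv ?_
    rw [hmean s hs]
    simp only [add_zero, Pi.sub_apply]
    ring
  have hE := expNuLam_pos ε f r
  have h1 : -(4 * Real.pi * expNuLam ε f r * (ε * L)) * (r - δ) ≤ y r - y δ := by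
    refine (convex_Icc δ r).mul_sub_le_image_sub_of_le_deriv
      (fun s hs => (hdy s (hδ0.trans_le hs.1)).continuousAt.continuousWithinAt)
      (fun s hs => ?_) (fun s hs => ?_) δ (left_mem_Icc.2 hδr) r (right_mem_Icc.2 hδr) hδr
    · rw [interior_Icc] at hs
      exact (hdy s (hδ0.trans hs.1)).differentiableAt.differentiableWithinAt
    rw [interior_Icc] at hs
    have hs0 := hδ0.trans hs.1
    have hρ := hpε.rho_pos hs0
    rw [(hdy s hs0).deriv]
    have hw := hd.wCoef_pos hs0
    have hw1 := hp.wCoef_le hs0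
    have hEs := hpε.expNuLam_mono hs0 hs.2.le
    have hEs0 := expNuLam_pos ε f s
    set x := mean 0 h₀ s * (ε / (s + ε)) with hx
    set k := h₀ s - mean 0 h₀ s with hk
    have hxb : |x| ≤ B * (ε / δ) := by
      have h7 : 0 ≤ ε / (s + ε) := by positivity
      rw [hx, abs_mul, abs_of_nonneg h7]
      refine mul_le_mul (hB s hs0) ?_ h7 hB0
      exact div_le_div_of_nonneg_left hε.le hδ0 (by linarith [hs.1])
    have hxB : |x| ≤ B := by
      have h7 : 0 ≤ ε / (s + ε) := by positivity
      rw [hx, abs_mul, abs_of_nonneg h7]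
      refine (mul_le_of_le_one_right (abs_nonneg _) ?_).trans (hB s hs0)
      rw [div_le_one hρ]; linarith
    have hkb : |k| ≤ B₁ + B := by
      have h5 := hB₁ s ⟨hs0.le, hs.2.le.trans hrR⟩
      rw [Real.norm_eq_abs] at h5
      exact (abs_sub _ _).trans (add_le_add h5 (hB s hs0))
    have h6 : (k + x) ^ 2 - k ^ 2 ≤ ε * L := by
      have e : (k + x) ^ 2 - k ^ 2 = x * (2 * k + x) := by ring
      rw [e]
      refine (le_abs_self _).trans ?_
      rw [abs_mul]
      have h7 : |2 * k + x| ≤ 2 * (B₁ + B) + B := by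
        refine (abs_add_le _ _).trans ?_
        rw [abs_mul, abs_two]
        linarith
      calc _ ≤ B * (ε / δ) * (2 * (B₁ + B) + B) :=
            mul_le_mul hxb h7 (abs_nonneg _) (by positivity)
        _ = ε * L := by rw [hL]; ring
    have h8 : wCoef c 0 h₀ s * ((f s - mean ε f s) ^ 2 / (s + ε) - k ^ 2 / s) ≤ ε * L := by
      rw [hdev s hs0]
      have h9 : (k + x) ^ 2 / (s + ε) ≤ (k + x) ^ 2 / s :=
        div_le_div_of_nonneg_left (sq_nonneg _) hs0 (by linarith)
      calc _ ≤ wCoef c 0 h₀ s * ((k + x) ^ 2 / s - k ^ 2 / s) := by gcongr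
        _ = wCoef c 0 h₀ s / s * ((k + x) ^ 2 - k ^ 2) := by ring
        _ ≤ wCoef c 0 h₀ s / s * (ε * L) := by gcongr
        _ ≤ 1 * (ε * L) := by
          gcongr
          exact (div_le_one hs0).2 hw1
        _ = ε * L := one_mul _
    have h10 : expNuLam ε f s * (wCoef c 0 h₀ s * ((f s - mean ε f s) ^ 2 / (s + ε) - k ^ 2 / s))
        ≤ expNuLam ε f r * (ε * L) :=
      (mul_le_mul_of_nonneg_left h8 hEs0.le).trans
        (mul_le_mul_of_nonneg_right hEs (by positivity))
    have := mul_le_mul_of_nonneg_left h10 (by positivity : 0 ≤ 4 * Real.pi)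
    linarith
  -- At δ the regularized w is positive and the unregularized one is at most δ; monotonicity of E
  -- replaces E(δ) by E(r), which can then be divided out.
  have h2 : -(expNuLam ε f r * δ) ≤ y δ := by
    have h3 := hnear δ hδ0 (min_le_left _ _)
    have h4 := hp.wCoef_le hδ0
    have h5 := hpε.expNuLam_mono hδ0 hδr
    have h6 := expNuLam_pos ε f δ
    have h7 : expNuLam ε f δ * δ ≤ expNuLam ε f r * δ := by gcongr
    have h8 : expNuLam ε f δ * (-δ) ≤ y δ := by
      simp only [hy]
      gcongr
      linarith
    linarith
  have h3 : 2 * η ≤ wCoef c 0 h₀ r := by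
    have : wCoef c 0 h₀ r₂ ≤ wCoef c 0 h₀ r := hmin ⟨hra, hrR⟩
    rw [hη]; linarith
  have h4 : expNuLam ε f r * (-(4 * Real.pi * (ε * L)) * (r - δ) - δ)
      ≤ expNuLam ε f r * (wCoef c ε f r - wCoef c 0 h₀ r) := by
    have : y r = expNuLam ε f r * (wCoef c ε f r - wCoef c 0 h₀ r) := rfl
    rw [← this]
    linarith
  have h5 := le_of_mul_le_mul_left h4 hE
  have h6 : 4 * Real.pi * (ε * L) * (r - δ) ≤ 4 * Real.pi * (ε * L) * R := by
    gcongr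
    linarith
  have h7 : δ ≤ η := min_le_right _ _
  -- In total w_ε(r) ≥ 2η - δ - 4πεLR ≥ η - 4πεLR > 0, by the choice of the threshold for ε.
  nlinarith

end InitialData

/-! ### Convergence of the metric coefficients -/

lemma tendsto_intervalIntegral_of_bound {F : ℕ → ℝ → ℝ} {f : ℝ → ℝ} {a b B : ℝ} (ha : 0 < a)
    (hb : 0 < b) (hc : ∀ n, ContinuousOn (F n) (Ioi 0))
    (hB : ∀ᶠ n in atTop, ∀ s ∈ uIcc a b, |F n s| ≤ B)
    (hl : ∀ s, 0 < s → Tendsto (fun n => F n s) atTop (𝓝 (f s))) :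
    Tendsto (fun n => ∫ s in a..b, F n s) atTop (𝓝 (∫ s in a..b, f s)) := by
  have hpos : ∀ s ∈ uIcc a b, 0 < s := fun s hs => lt_of_lt_of_le (lt_min ha hb) hs.1
  refine intervalIntegral.tendsto_integral_filter_of_dominated_convergence (fun _ => B)
    (Eventually.of_forall fun n => ?_) ?_ (by simp) ?_
  · exact ((hc n).mono fun s hs => hpos s (uIoc_subset_uIcc hs)).aestronglyMeasurable
      measurableSet_uIoc
  · filter_upwards [hB] with n hn
    exact Eventually.of_forall fun s hs => hn s (uIoc_subset_uIcc hs)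
  · exact Eventually.of_forall fun s hs => hl s (hpos s (uIoc_subset_uIcc hs))

/-- A sequence of regularized solutions with `ḡ > 0` and uniformly bounded mass, converging
pointwise and locally boundedly away from the center. -/
structure IsBoundedLimit (c C : ℝ) (h₀ : ℝ → ℝ) (ε : ℕ → ℝ) (hε : ℕ → ℝ → ℝ → ℝ)
    (h : ℝ → ℝ → ℝ) : Prop where
  eps_pos : ∀ n, 0 < ε n
  eps_tendsto : Tendsto ε atTop (𝓝 0)
  sol : ∀ n, IsRegularizedSolution c (ε n) h₀ (hε n)
  wCoef_pos : ∀ n u r, 0 ≤ u → 0 < r → 0 < wCoef c (ε n) (hε n u) r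
  mass_le : ∀ n u r, 0 ≤ u → 0 < r → hawkingMass c (ε n) (hε n u) r ≤ C
  tendsto : ∀ u r, 0 ≤ u → 0 < r → Tendsto (fun n => hε n u r) atTop (𝓝 (h u r))
  tendsto_mean : ∀ u r, 0 ≤ u → 0 < r →
    Tendsto (fun n => mean (ε n) (hε n u) r) atTop (𝓝 (mean 0 (h u) r))
  bound : ∀ u₀ a b, 0 < a → ∃ B, 0 ≤ B ∧ ∀ᶠ n in atTop, ∀ u r, 0 ≤ u → u ≤ u₀ → a ≤ r → r ≤ b →
    |hε n u r| ≤ B ∧ |mean (ε n) (hε n u) r| ≤ B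
  cont : ∀ u, 0 ≤ u → ContinuousOn (h u) (Ioi 0)
  cont_mean : ∀ u, 0 ≤ u → ContinuousOn (mean 0 (h u)) (Ioi 0)

namespace IsBoundedLimit

variable {c C : ℝ} {h₀ : ℝ → ℝ} {ε : ℕ → ℝ} {hε : ℕ → ℝ → ℝ → ℝ} {h : ℝ → ℝ → ℝ}
  (hl : IsBoundedLimit c C h₀ ε hε h)
include hl

lemma profile (n : ℕ) {u : ℝ} (hu : 0 ≤ u) : IsProfile c (ε n) (hε n u) :=
  (hl.sol n).isProfile (hl.eps_pos n) hu

lemma C_nonneg : 0 ≤ C := ((hl.profile 0 le_rfl).hawkingMass_nonneg one_pos).trans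
  (hl.mass_le 0 0 1 le_rfl one_pos)

lemma eventually_eps_le_one : ∀ᶠ n in atTop, ε n ≤ 1 := hl.eps_tendsto.eventually_le_const one_pos

lemma tendsto_rho (r : ℝ) : Tendsto (fun n => r + ε n) atTop (𝓝 (r + 0)) :=
  tendsto_const_nhds.add hl.eps_tendsto

lemma tendsto_dev {u r : ℝ} (hu : 0 ≤ u) (hr : 0 < r) :
    Tendsto (fun n => hε n u r - mean (ε n) (hε n u) r) atTop (𝓝 (h u r - mean 0 (h u) r)) :=
  (hl.tendsto u r hu hr).sub (hl.tendsto_mean u r hu hr)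

lemma tendsto_density {u r : ℝ} (hu : 0 ≤ u) (hr : 0 < r) :
    Tendsto (fun n => (hε n u r - mean (ε n) (hε n u) r) ^ 2 / (r + ε n)) atTop
      (𝓝 ((h u r - mean 0 (h u) r) ^ 2 / (r + 0))) :=
  ((hl.tendsto_dev hu hr).pow 2).div (hl.tendsto_rho r) (by simpa using hr.ne')

/-- Local bounds for the deviation and for `(r + ε) h̄`. -/
lemma bound' (u₀ a b : ℝ) (ha : 0 < a) : ∃ B, 0 ≤ B ∧ ∀ᶠ n in atTop, ∀ u r, 0 ≤ u → u ≤ u₀ →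
    a ≤ r → r ≤ b → |hε n u r - mean (ε n) (hε n u) r| ≤ B ∧
      |(r + ε n) * mean (ε n) (hε n u) r| ≤ B := by
  obtain ⟨B, hB0, hB⟩ := hl.bound u₀ a b ha
  refine ⟨2 * B + (|b| + 1) * B, by positivity, ?_⟩
  filter_upwards [hB, hl.eventually_eps_le_one] with n hn hn1 u r hu hu₀ har hrb
  obtain ⟨h1, h2⟩ := hn u r hu hu₀ har hrb
  have h3 : 0 ≤ (|b| + 1) * B := by positivity
  have hε0 := hl.eps_pos n
  constructor
  · exact (abs_sub _ _).trans (by linarith)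
  · rw [abs_mul, abs_of_pos (by linarith)]
    have : r + ε n ≤ |b| + 1 := by linarith [le_abs_self b]
    have := mul_le_mul this h2 (abs_nonneg _) (by positivity)
    linarith

lemma tendsto_integral_density {u a b : ℝ} (hu : 0 ≤ u) (ha : 0 < a) (hb : 0 < b) :
    Tendsto (fun n => ∫ s in a..b, (hε n u s - mean (ε n) (hε n u) s) ^ 2 / (s + ε n)) atTop
      (𝓝 (∫ s in a..b, (h u s - mean 0 (h u) s) ^ 2 / (s + 0))) := by
  have hab : 0 < min a b := lt_min ha hb
  obtain ⟨B, hB0, hB⟩ := hl.bound' u (min a b) (max a b) hab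
  refine tendsto_intervalIntegral_of_bound (B := B ^ 2 / min a b) ha hb
    (fun n => (hl.profile n hu).cont_density) ?_ fun s hs => hl.tendsto_density hu hs
  filter_upwards [hB] with n hn s hs
  have h1 := (hn u s hu le_rfl hs.1 hs.2).1
  have hs0 := hab.trans_le hs.1
  have hε0 := hl.eps_pos n
  rw [abs_div, abs_of_pos (by linarith : 0 < s + ε n), abs_pow]
  have : min a b ≤ s + ε n := hs.1.trans (by linarith)
  gcongr

lemma integral_density_le {u a b : ℝ} (hu : 0 ≤ u) (ha : 0 < a) (hab : a ≤ b) (hC : 4 * C ≤ a) :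
    ∫ s in a..b, (h u s - mean 0 (h u) s) ^ 2 / (s + 0) ≤ C / (Real.pi * a) :=
  le_of_tendsto (hl.tendsto_integral_density hu ha (ha.trans_le hab)) (Eventually.of_forall
    fun n => (hl.profile n hu).integral_density_le ha hab hC fun r hr => hl.mass_le n u r hu hr)

lemma integrableOn_density {u a : ℝ} (hu : 0 ≤ u) (ha : 0 < a) :
    IntegrableOn (fun s => (h u s - mean 0 (h u) s) ^ 2 / (s + 0)) (Ioi a) := by
  have hc : ContinuousOn (fun s => (h u s - mean 0 (h u) s) ^ 2 / (s + 0)) (Ioi 0) :=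
    (((hl.cont u hu).sub (hl.cont_mean u hu)).pow 2).div (by fun_prop) fun s hs => by
      simpa using (ne_of_gt hs)
  set R := max (4 * C) a with hR
  have hR0 : 0 < R := ha.trans_le (le_max_right _ _)
  refine integrableOn_Ioi_of_intervalIntegral_norm_bounded
    ((∫ s in a..R, (h u s - mean 0 (h u) s) ^ 2 / (s + 0)) + C / (Real.pi * R)) a (b := fun n => n)
    (l := atTop (α := ℝ)) (fun b => ?_) tendsto_id ?_
  · rcases le_total b a with h1 | h1
    · rw [Ioc_eq_empty_of_le h1]; exact integrableOn_empty
    · exact ((intervalIntegrable_of_continuousOn_Ioi ha (ha.trans_le h1) hc).1)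
  · filter_upwards [eventually_ge_atTop R] with b hb
    have e : ∫ s in a..b, ‖(h u s - mean 0 (h u) s) ^ 2 / (s + 0)‖
        = ∫ s in a..b, (h u s - mean 0 (h u) s) ^ 2 / (s + 0) := by
      refine intervalIntegral.integral_congr fun s hs => ?_
      rw [uIcc_of_le ((le_max_right _ _).trans hb)] at hs
      have := ha.trans_le hs.1
      exact Real.norm_of_nonneg (by positivity)
    rw [e, ← intervalIntegral.integral_add_adjacent_intervals
      (intervalIntegrable_of_continuousOn_Ioi ha hR0 hc)
      (intervalIntegrable_of_continuousOn_Ioi hR0 (hR0.trans_le hb) hc)]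
    have := hl.integral_density_le hu hR0 hb (le_max_left _ _)
    linarith

/-- Positivity of w bounds the mass by (r + ε)/2, which unlike C becomes small at the center. This
smallness later compensates the singular weight 1/r. -/
lemma hawkingMass_le_half (n : ℕ) {u r : ℝ} (hu : 0 ≤ u) (hr : 0 < r) :
    hawkingMass c (ε n) (hε n u) r ≤ (r + ε n) / 2 := by
  rw [hawkingMass_eq]
  linarith [hl.wCoef_pos n u r hu hr]

lemma tendsto_integral_mean_sq {u a b : ℝ} (hu : 0 ≤ u) (ha : 0 < a) (hb : 0 < b) :
    Tendsto (fun n => ∫ s in a..b, c ^ 2 * ((s + ε n) * mean (ε n) (hε n u) s) ^ 2) atTop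
      (𝓝 (∫ s in a..b, c ^ 2 * ((s + 0) * mean 0 (h u) s) ^ 2)) := by
  have hab : 0 < min a b := lt_min ha hb
  obtain ⟨B, hB0, hB⟩ := hl.bound' u (min a b) (max a b) hab
  refine tendsto_intervalIntegral_of_bound (B := c ^ 2 * B ^ 2) ha hb (fun n => ?_) ?_
    fun s hs => (((hl.tendsto_rho s).mul (hl.tendsto_mean u s hu hs)).pow 2).const_mul _
  · have := (hl.profile n hu).cont_mean
    fun_prop
  · filter_upwards [hB] with n hn s hs
    have h1 := (hn u s hu le_rfl hs.1 hs.2).2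
    rw [abs_mul, abs_pow, abs_pow, sq_abs c]
    gcongr

/-- Integrability at the center passes to the limit because the mass bounds c² ∫_δ^r (ρ h̄)² by (r +
ε)/(4π), uniformly in δ and n. Letting first n → ∞ and then δ → 0 gives the claim. -/
lemma isProfile {u : ℝ} (hu : 0 ≤ u) : IsProfile c 0 (h u) := by
  refine IsProfile.of_mean_sq le_rfl (hl.cont u hu) (hl.cont_mean u hu)
    (fun r hr => hl.integrableOn_density hu hr) fun r hr => ?_
  have hc : ContinuousOn (fun s => c ^ 2 * ((s + 0) * mean 0 (h u) s) ^ 2) (Ioi 0) := by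
    have := hl.cont_mean u hu
    fun_prop
  rw [intervalIntegrable_iff_integrableOn_Ioc_of_le hr.le]
  have ht : Tendsto (fun n : ℕ => r / (n + 1)) atTop (𝓝 0) :=
    (tendsto_const_div_atTop_nhds_zero_nat r).comp (tendsto_add_atTop_nat 1) |>.congr
      fun n => by simp
  have hpos : ∀ n : ℕ, 0 < r / (n + 1) := fun n => by positivity
  have hle : ∀ n : ℕ, r / (n + 1) ≤ r := fun n => div_le_self hr.le (by
    have : (0 : ℝ) ≤ n := n.cast_nonneg
    linarith)
  refine integrableOn_Ioc_of_intervalIntegral_norm_bounded_left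
    (I := r / 2 / (2 * Real.pi)) (a := fun n : ℕ => r / (n + 1)) (l := atTop) (fun n => ?_) ht ?_
  · exact (intervalIntegrable_of_continuousOn_Ioi (hpos n) hr hc).1
  · refine Eventually.of_forall fun n => ?_
    rw [← intervalIntegral.integral_of_le (hle n)]
    have e : ∫ s in (r / (n + 1))..r, ‖c ^ 2 * ((s + 0) * mean 0 (h u) s) ^ 2‖
        = ∫ s in (r / (n + 1))..r, c ^ 2 * ((s + 0) * mean 0 (h u) s) ^ 2 :=
      intervalIntegral.integral_congr fun s _ => Real.norm_of_nonneg (by positivity)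
    rw [e]
    have h1 : Tendsto (fun m => (r + ε m) / 2 / (2 * Real.pi)) atTop
        (𝓝 ((r + 0) / 2 / (2 * Real.pi))) := ((hl.tendsto_rho r).div_const 2).div_const _
    rw [add_zero] at h1
    refine le_of_tendsto_of_tendsto (hl.tendsto_integral_mean_sq hu (hpos n) hr) h1
      (Eventually.of_forall fun m => ?_)
    have := Real.pi_pos
    refine ((hl.profile m hu).integral_mean_sq_le (hpos n) (hle n)
      fun r hr => (hl.wCoef_pos m u r hu hr).le).trans ?_
    exact div_le_div_of_nonneg_right (hl.hawkingMass_le_half m hu hr) (by positivity)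

lemma abs_nuLam_le {u R : ℝ} (hu : 0 ≤ u) (hR : 0 < R) (hC : 4 * C ≤ R) :
    |nuLam 0 (h u) R| ≤ 4 * C / R := by
  rw [abs_of_nonpos (nuLam_nonpos le_rfl (h u) hR.le)]
  have hπ := Real.pi_pos
  have h1 := intervalIntegral_tendsto_integral_Ioi R (hl.integrableOn_density hu hR) tendsto_id
  have h2 : ∫ s in Ioi R, (h u s - mean 0 (h u) s) ^ 2 / (s + 0) ≤ C / (Real.pi * R) := by
    refine le_of_tendsto h1 ?_
    filter_upwards [eventually_ge_atTop R] with b hb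
    exact hl.integral_density_le hu hR hb hC
  unfold nuLam
  calc _ = 4 * Real.pi * ∫ s in Ioi R, (h u s - mean 0 (h u) s) ^ 2 / (s + 0) := by ring
    _ ≤ 4 * Real.pi * (C / (Real.pi * R)) := by gcongr
    _ = 4 * C / R := by field_simp

lemma tendsto_nuLam {u r : ℝ} (hu : 0 ≤ u) (hr : 0 < r) :
    Tendsto (fun n => nuLam (ε n) (hε n u) r) atTop (𝓝 (nuLam 0 (h u) r)) := by
  rw [Metric.tendsto_atTop']
  intro η hη
  have hC := hl.C_nonneg
  -- Beyond R ≥ 4C both tails are at most 4C/R ≤ η/4, uniformly in n; the compact piece [r, R]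
  -- contributes a third η/4.
  set R := max r (max (4 * C) (16 * C / η)) with hR
  have hR0 : 0 < R := hr.trans_le (le_max_left _ _)
  have hR1 : 4 * C ≤ R := (le_max_left _ _).trans (le_max_right _ _)
  have hR2 : 4 * C / R ≤ η / 4 := by
    have h1 : 16 * C / η ≤ R := (le_max_right _ _).trans (le_max_right _ _)
    rw [div_le_iff₀ hη] at h1
    rw [div_le_iff₀ hR0]
    linarith
  have h1 := (hl.tendsto_integral_density hu hr hR0).const_mul (4 * Real.pi)
  obtain ⟨N, hN⟩ := Metric.tendsto_atTop.1 h1 (η / 4) (by positivity)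
  refine ⟨N, fun n hn => ?_⟩
  have h2 := hN n hn.le
  have h3 := (hl.profile n hu).nuLam_sub hr hR0
  have h4 := (hl.isProfile hu).nuLam_sub hr hR0
  have h5 := (hl.profile n hu).abs_nuLam_le hR0 hR1 fun r hr => hl.mass_le n u r hu hr
  have h6 := hl.abs_nuLam_le hu hR0 hR1
  rw [Real.dist_eq] at h2 ⊢
  rw [← h3, ← h4] at h2
  rw [abs_lt] at h2 ⊢
  rw [abs_le] at h5 h6
  constructor <;> linarith [h2.1, h2.2, h5.1, h5.2, h6.1, h6.2]

lemma tendsto_expNuLam {u r : ℝ} (hu : 0 ≤ u) (hr : 0 < r) :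
    Tendsto (fun n => expNuLam (ε n) (hε n u) r) atTop (𝓝 (expNuLam 0 (h u) r)) :=
  (hl.tendsto_nuLam hu hr).rexp

lemma tendsto_gCoef {u r : ℝ} (hu : 0 ≤ u) (hr : 0 < r) :
    Tendsto (fun n => gCoef c (ε n) (hε n u) r) atTop (𝓝 (gCoef c 0 (h u) r)) :=
  ((((tendsto_const_nhds.mul ((hl.tendsto_rho r).pow 2)).mul
    ((hl.tendsto_mean u r hu hr).pow 2)).const_sub 1).mul (hl.tendsto_expNuLam hu hr))

/-- The integral equals ρ ḡ = w E with 0 < w ≤ r and E ≤ 1. Although g is not bounded below near the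
center, its integral over (0, r) is thus uniformly small. -/
lemma mul_gBar_mem (n : ℕ) {u r : ℝ} (hu : 0 ≤ u) (hr : 0 < r) :
    ∫ s in (0 : ℝ)..r, gCoef c (ε n) (hε n u) s ∈ Icc 0 r := by
  have hp := hl.profile n hu
  have h1 : (r + ε n) * gBar c (ε n) (hε n u) r
      = wCoef c (ε n) (hε n u) r * expNuLam (ε n) (hε n u) r := by
    have := (expNuLam_pos (ε n) (hε n u) r).ne'
    unfold wCoef; field_simp
  rw [← hp.mul_gBar hr, h1]
  have h2 := hl.wCoef_pos n u r hu hr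
  have h3 := expNuLam_pos (ε n) (hε n u) r
  have h4 := hp.wCoef_le hr
  have h5 := expNuLam_le_one (hl.eps_pos n).le (hε n u) hr.le
  exact ⟨by positivity, by nlinarith⟩

lemma tendsto_integral_gCoef {u a b : ℝ} (hu : 0 ≤ u) (ha : 0 < a) (hb : 0 < b) :
    Tendsto (fun n => ∫ s in a..b, gCoef c (ε n) (hε n u) s) atTop
      (𝓝 (∫ s in a..b, gCoef c 0 (h u) s)) := by
  have hab : 0 < min a b := lt_min ha hb
  obtain ⟨B, hB0, hB⟩ := hl.bound' u (min a b) (max a b) hab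
  refine tendsto_intervalIntegral_of_bound (B := 1 + 4 * c ^ 2 * Real.pi * B ^ 2) ha hb
    (fun n => (hl.profile n hu).cont_gCoef) ?_ fun s hs => hl.tendsto_gCoef hu hs
  filter_upwards [hB] with n hn s hs
  have h1 := (hn u s hu le_rfl hs.1 hs.2).2
  have hs0 := hab.trans_le hs.1
  have h2 := expNuLam_pos (ε n) (hε n u) s
  have h3 := expNuLam_le_one (hl.eps_pos n).le (hε n u) hs0.le
  have hπ := Real.pi_pos
  have e : gCoef c (ε n) (hε n u) s = (1 - 4 * c ^ 2 * Real.pi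
      * ((s + ε n) * mean (ε n) (hε n u) s) ^ 2) * expNuLam (ε n) (hε n u) s := by
    unfold gCoef; ring
  rw [e, abs_mul, abs_of_pos h2]
  have h4 : |1 - 4 * c ^ 2 * Real.pi * ((s + ε n) * mean (ε n) (hε n u) s) ^ 2|
      ≤ 1 + 4 * c ^ 2 * Real.pi * B ^ 2 := by
    refine (abs_sub _ _).trans ?_
    rw [abs_one, abs_of_nonneg (by positivity : 0 ≤ 4 * c ^ 2 * Real.pi
      * ((s + ε n) * mean (ε n) (hε n u) s) ^ 2), ← sq_abs ((s + ε n) * mean (ε n) (hε n u) s)]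
    gcongr
  calc _ ≤ (1 + 4 * c ^ 2 * Real.pi * B ^ 2) * 1 := by gcongr
    _ = _ := mul_one _

/-- The interval is split at a small δ. Over (0, δ) the integrals lie in [0, δ] for every n, and
that of the limit is small by integrability; over (δ, r) dominated convergence applies. -/
lemma tendsto_primitive_gCoef {u r : ℝ} (hu : 0 ≤ u) (hr : 0 < r) :
    Tendsto (fun n => ∫ s in (0 : ℝ)..r, gCoef c (ε n) (hε n u) s) atTop
      (𝓝 (∫ s in (0 : ℝ)..r, gCoef c 0 (h u) s)) := by
  have hp := hl.isProfile hu
  rw [Metric.tendsto_atTop']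
  intro η hη
  have h0 : ContinuousWithinAt (fun x => ∫ s in (0 : ℝ)..x, gCoef c 0 (h u) s) (Icc 0 r) 0 := by
    have := (intervalIntegral.continuousOn_primitive_interval'
      (hp.gCoef_int r hr) (left_mem_uIcc)) 0 left_mem_uIcc
    rwa [uIcc_of_le hr.le] at this
  have h1 : ∀ᶠ x in 𝓝[Icc 0 r] 0, |∫ s in (0 : ℝ)..x, gCoef c 0 (h u) s| < η / 3 := by
    have := (Metric.continuousWithinAt_iff'.1 h0) (η / 3) (by positivity)
    simpa [Real.dist_eq] using this
  have h2 : ∀ᶠ x in 𝓝[>] (0 : ℝ), |∫ s in (0 : ℝ)..x, gCoef c 0 (h u) s| < η / 3 := by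
    refine Filter.Eventually.filter_mono ?_ h1
    rw [← nhdsWithin_Ioo_eq_nhdsGT hr]
    exact nhdsWithin_mono _ Ioo_subset_Icc_self
  have h3 : ∀ᶠ x in 𝓝[>] (0 : ℝ), x < η / 3 :=
    nhdsWithin_le_nhds (Iio_mem_nhds (by positivity))
  obtain ⟨δ, hδ1, hδ2, hδ0⟩ := (h2.and (h3.and self_mem_nhdsWithin)).exists
  have hδ0' : 0 < δ := hδ0
  obtain ⟨N, hN⟩ := Metric.tendsto_atTop.1 (hl.tendsto_integral_gCoef hu hδ0' hr) (η / 3)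
    (by positivity)
  refine ⟨N, fun n hn => ?_⟩
  have h4 := hN n hn.le
  have hpn := hl.profile n hu
  have h5 := hl.mul_gBar_mem n hu hδ0'
  rw [← intervalIntegral.integral_add_adjacent_intervals (hpn.gCoef_int δ hδ0')
      (intervalIntegrable_of_continuousOn_Ioi hδ0' hr hpn.cont_gCoef),
    ← intervalIntegral.integral_add_adjacent_intervals (hp.gCoef_int δ hδ0')
      (intervalIntegrable_of_continuousOn_Ioi hδ0' hr hp.cont_gCoef)]
  rw [Real.dist_eq, abs_lt] at h4 ⊢
  rw [abs_lt] at hδ1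
  constructor <;> linarith [h4.1, h4.2, hδ1.1, hδ1.2, h5.1, h5.2]

lemma tendsto_gBar {u r : ℝ} (hu : 0 ≤ u) (hr : 0 < r) :
    Tendsto (fun n => gBar c (ε n) (hε n u) r) atTop (𝓝 (gBar c 0 (h u) r)) :=
  ((tendsto_const_nhds (x := (1 : ℝ))).div (hl.tendsto_rho r) (by simpa using hr.ne')).mul
    (hl.tendsto_primitive_gCoef hu hr)

lemma tendsto_wCoef {u r : ℝ} (hu : 0 ≤ u) (hr : 0 < r) :
    Tendsto (fun n => wCoef c (ε n) (hε n u) r) atTop (𝓝 (wCoef c 0 (h u) r)) :=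
  ((hl.tendsto_rho r).mul (hl.tendsto_gBar hu hr)).div (hl.tendsto_expNuLam hu hr)
    (expNuLam_pos _ _ _).ne'

lemma wCoef_nonneg {u r : ℝ} (hu : 0 ≤ u) (hr : 0 < r) : 0 ≤ wCoef c 0 (h u) r :=
  ge_of_tendsto' (hl.tendsto_wCoef hu hr) fun n => (hl.wCoef_pos n u r hu hr).le

lemma hawkingMass_le {u r : ℝ} (hu : 0 ≤ u) (hr : 0 < r) : hawkingMass c 0 (h u) r ≤ C := by
  have h1 : Tendsto (fun n => hawkingMass c (ε n) (hε n u) r) atTop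
      (𝓝 (hawkingMass c 0 (h u) r)) := by
    simp only [hawkingMass_eq]
    exact (((hl.tendsto_rho r).sub (hl.tendsto_wCoef hu hr)).div_const 2)
  exact le_of_tendsto' h1 fun n => hl.mass_le n u r hu hr

end IsBoundedLimit

/-! ### From locally uniform convergence to bounded limits -/

lemma mem_domain {p : ℝ × ℝ} : p ∈ domain ↔ 0 ≤ p.1 ∧ 0 < p.2 := Iff.rfl

lemma measurableSet_domain : MeasurableSet domain := measurableSet_Ici.prod measurableSet_Ioi

lemma domain_subset_quadrant : domain ⊆ quadrant := prod_mono subset_rfl Ioi_subset_Ici_self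

lemma rect_subset_domain {u₀ a b : ℝ} (ha : 0 < a) : Icc 0 u₀ ×ˢ Icc a b ⊆ domain :=
  fun _ hp => ⟨hp.1.1, ha.trans_le hp.2.1⟩

namespace TendstoOnCompacts

variable {F : ℕ → ℝ → ℝ → ℝ} {f : ℝ → ℝ → ℝ} (hF : TendstoOnCompacts F f)
include hF

lemma tendsto {u r : ℝ} (hu : 0 ≤ u) (hr : 0 < r) :
    Tendsto (fun n => F n u r) atTop (𝓝 (f u r)) :=
  (hF {(u, r)} isCompact_singleton (by simpa [mem_domain] using ⟨hu, hr⟩)).tendsto_at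
    (mem_singleton _)

variable (hc : ∀ n, ContinuousOn (fun p : ℝ × ℝ => F n p.1 p.2) domain)
include hc

lemma continuousOn_compact {K : Set (ℝ × ℝ)} (hK : IsCompact K) (hKd : K ⊆ domain) :
    ContinuousOn (fun p : ℝ × ℝ => f p.1 p.2) K :=
  (hF K hK hKd).continuousOn (Frequently.of_forall fun n => (hc n).mono hKd)

lemma continuousOn_right {u : ℝ} (hu : 0 ≤ u) : ContinuousOn (f u) (Ioi 0) := by
  intro r hr
  have hr0 : 0 < r := hr
  have h1 := hF.continuousOn_compact hc (isCompact_Icc.prod isCompact_Icc)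
    (rect_subset_domain (u₀ := u) (a := r / 2) (b := 2 * r) (half_pos hr0))
  have h2 : ContinuousOn (f u) (Icc (r / 2) (2 * r)) :=
    h1.comp (f := fun s => (u, s)) (by fun_prop) fun s hs => ⟨⟨hu, le_rfl⟩, hs⟩
  exact (h2.continuousAt (Icc_mem_nhds (by linarith) (by linarith))).continuousWithinAt

lemma exists_bound (u₀ a b : ℝ) (ha : 0 < a) : ∃ B, 0 ≤ B ∧ ∀ᶠ n in atTop, ∀ u r, 0 ≤ u →
    u ≤ u₀ → a ≤ r → r ≤ b → |F n u r| ≤ B := by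
  have hK : IsCompact (Icc 0 u₀ ×ˢ Icc a b) := isCompact_Icc.prod isCompact_Icc
  have hKd : Icc 0 u₀ ×ˢ Icc a b ⊆ domain := rect_subset_domain ha
  obtain ⟨B, hB⟩ := hK.exists_bound_of_continuousOn (hF.continuousOn_compact hc hK hKd)
  refine ⟨max B 0 + 1, by positivity, ?_⟩
  filter_upwards [Metric.tendstoUniformlyOn_iff.1 (hF _ hK hKd) 1 one_pos] with n hn u r hu hu₀ ha hb
  have h1 := hn (u, r) ⟨⟨hu, hu₀⟩, ha, hb⟩
  have h2 := hB (u, r) ⟨⟨hu, hu₀⟩, ha, hb⟩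
  rw [Real.dist_eq, abs_sub_comm] at h1
  rw [Real.norm_eq_abs] at h2
  have h3 := abs_sub_abs_le_abs_sub (F n u r) (f u r)
  have h4 := le_max_left B 0
  dsimp only at h1 h2
  linarith

end TendstoOnCompacts

/-- After dropping finitely many terms a limiting solution is a bounded limit. -/
theorem IsLimitingSolution.exists_isBoundedLimit {c : ℝ} {h₀ : ℝ → ℝ} {ε : ℕ → ℝ}
    {hε : ℕ → ℝ → ℝ → ℝ} {h : ℝ → ℝ → ℝ} (hlim : IsLimitingSolution c h₀ ε hε h)
    (hd : InitialData c h₀) :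
    ∃ N C, IsBoundedLimit c C h₀ (fun n => ε (n + N)) (fun n => hε (n + N)) h := by
  obtain ⟨ε₀, C, hε₀, hC⟩ := hd.exists_uniform_bound
  obtain ⟨N, hN⟩ := eventually_atTop.1 (hlim.eps_tendsto.eventually_lt_const hε₀)
  have hpos : ∀ n, 0 < ε n := fun n => (hlim.eps_mem n).1
  have h0 : ∀ n, (∀ r, 0 < r → 0 < wCoef c (ε (n + N)) (hε (n + N) 0) r) ∧
      ∀ r, 0 < r → hawkingMass c (ε (n + N)) (hε (n + N) 0) r ≤ C := fun n =>
    hC _ _ (hpos _) (hN _ (Nat.le_add_left _ _))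
      ((hlim.solution _).isProfile (hpos _) le_rfl) fun r hr => (hlim.solution _).initial r hr
  have hc1 : ∀ n, ContinuousOn (fun p : ℝ × ℝ => hε n p.1 p.2) domain := fun n =>
    (hlim.solution n).cont.mono domain_subset_quadrant
  have hc2 : ∀ n, ContinuousOn (fun p : ℝ × ℝ => mean (ε n) (hε n p.1) p.2) domain := fun n =>
    ((hlim.solution n).cont_mean (hpos n)).mono domain_subset_quadrant
  refine ⟨N, C, ⟨fun n => hpos _, hlim.eps_tendsto.comp (tendsto_add_atTop_nat N),
    fun n => hlim.solution _, fun n u r hu hr => ?_, fun n u r hu hr => ?_, fun u r hu hr => ?_,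
    fun u r hu hr => ?_, fun u₀ a b ha => ?_, fun u hu => ?_, fun u hu => ?_⟩⟩
  · exact (hlim.solution _).wCoef_pos (hpos _) hr ((h0 n).1 r hr) hu
  · exact (hlim.solution _).hawkingMass_le (hpos _) (h0 n).1 (h0 n).2 hu hr
  · exact (hlim.tendsto.tendsto hu hr).comp (tendsto_add_atTop_nat N)
  · exact (hlim.tendsto_mean.tendsto hu hr).comp (tendsto_add_atTop_nat N)
  · obtain ⟨B₁, h1, hB₁⟩ := hlim.tendsto.exists_bound hc1 u₀ a b ha
    obtain ⟨B₂, h2, hB₂⟩ := hlim.tendsto_mean.exists_bound hc2 u₀ a b ha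
    refine ⟨max B₁ B₂, h1.trans (le_max_left _ _), ?_⟩
    filter_upwards [(tendsto_add_atTop_nat N).eventually hB₁,
      (tendsto_add_atTop_nat N).eventually hB₂] with n hn1 hn2 u r hu hu₀ ha hb
    exact ⟨(hn1 u r hu hu₀ ha hb).trans (le_max_left _ _),
      (hn2 u r hu hu₀ ha hb).trans (le_max_right _ _)⟩
  · exact hlim.tendsto.continuousOn_right hc1 hu
  · exact hlim.tendsto_mean.continuousOn_right hc2 hu

/-! ### The differences of ξ between two radii -/

/-- The integrand in the definition of `ξ`. -/
def xiIntegrand (c : ℝ) (f : ℝ → ℝ) (s : ℝ) : ℝ :=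
  gBar c 0 f s * ((f s - mean 0 f s) / s) - c ^ 2 * (s * mean 0 f s * expNuLam 0 f s)

namespace IsProfile

variable {c : ℝ} {f : ℝ → ℝ} (hp : IsProfile c 0 f)
include hp

lemma cont_xiIntegrand : ContinuousOn (xiIntegrand c f) (Ioi 0) := by
  have h1 := hp.cont_gBar
  have h2 := hp.cont_mean
  have h3 := hp.cont_expNuLam
  have h4 : ContinuousOn (fun s => (f s - mean 0 f s) / s) (Ioi 0) :=
    hp.cont_dev.div continuousOn_id fun s hs => ne_of_gt hs
  unfold xiIntegrand
  fun_prop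

lemma xiTrunc_eq {r δ : ℝ} (hr : 0 < r) (hδ : 0 < δ) :
    xiTrunc c f r δ = ∫ s in δ..r, xiIntegrand c f s := by
  have h1 := hp.cont_gBar
  have h2 := hp.cont_mean
  have h3 := hp.cont_expNuLam
  have h4 : ContinuousOn (fun s => (f s - mean 0 f s) / s) (Ioi 0) :=
    hp.cont_dev.div continuousOn_id fun s hs => ne_of_gt hs
  unfold xiTrunc xiIntegrand
  rw [intervalIntegral.integral_sub (intervalIntegrable_of_continuousOn_Ioi hδ hr (by fun_prop))
    (intervalIntegrable_of_continuousOn_Ioi hδ hr (by fun_prop)),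
    intervalIntegral.integral_const_mul]

/-- The base point 1 separates the radius r from the cutoff δ: the limit δ → 0 no longer involves r.
-/
lemma xiTrunc_sub {r δ : ℝ} (hr : 0 < r) (hδ : 0 < δ) :
    xiTrunc c f r δ = xiTrunc c f r 1 - xiTrunc c f δ 1 := by
  have hi : ∀ a b, 0 < a → 0 < b → IntervalIntegrable (xiIntegrand c f) volume a b :=
    fun a b ha hb => intervalIntegrable_of_continuousOn_Ioi ha hb hp.cont_xiIntegrand
  rw [hp.xiTrunc_eq hr hδ, hp.xiTrunc_eq hr one_pos, hp.xiTrunc_eq hδ one_pos,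
    intervalIntegral.integral_interval_sub_left (hi _ _ one_pos hr) (hi _ _ one_pos hδ)]

lemma hasDerivAt_xiTrunc {r : ℝ} (hr : 0 < r) :
    HasDerivAt (fun r => xiTrunc c f r 1) (xiIntegrand c f r) r := by
  refine (hasDerivAt_primitive_of_continuousOn_Ioi hr hp.cont_xiIntegrand
    (intervalIntegrable_of_continuousOn_Ioi one_pos hr hp.cont_xiIntegrand)).congr_of_eventuallyEq ?_
  filter_upwards [Ioi_mem_nhds hr] with x hx using hp.xiTrunc_eq hx one_pos

end IsProfile

/-- Joint measurability in (u, r) of the limit coefficients comes from their being pointwise limits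
of continuous functions; the indicator discards the values outside the domain, about which nothing
is known. -/
lemma measurable_indicator_domain {F : ℕ → ℝ → ℝ → ℝ} {f : ℝ → ℝ → ℝ}
    (hF : ∀ n, ContinuousOn (fun p : ℝ × ℝ => F n p.1 p.2) domain)
    (hl : ∀ u r, 0 ≤ u → 0 < r → Tendsto (fun n => F n u r) atTop (𝓝 (f u r))) :
    Measurable (domain.indicator fun p : ℝ × ℝ => f p.1 p.2) := by
  classical
  refine measurable_of_tendsto_metrizable
    (f := fun n => domain.indicator fun p : ℝ × ℝ => F n p.1 p.2) (fun n => ?_) ?_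
  · have := (hF n).measurable_piecewise (g := fun _ => (0 : ℝ)) continuousOn_const
      measurableSet_domain
    rwa [← piecewise_eq_indicator]
  · refine tendsto_pi_nhds.2 fun p => ?_
    by_cases hp : p ∈ domain
    · simpa only [indicator_of_mem hp] using hl p.1 p.2 hp.1 hp.2
    · simp only [indicator_of_notMem hp]; exact tendsto_const_nhds

namespace IsBoundedLimit

variable {c C : ℝ} {h₀ : ℝ → ℝ} {ε : ℕ → ℝ} {hε : ℕ → ℝ → ℝ → ℝ} {h : ℝ → ℝ → ℝ}
  (hl : IsBoundedLimit c C h₀ ε hε h)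
include hl

lemma xiReg_sub (n : ℕ) {u r : ℝ} (hu : 0 ≤ u) (hr : 0 < r) :
    xiReg c (ε n) (hε n u) r - xiReg c (ε n) (hε n u) 1 = ∫ s in (1 : ℝ)..r,
      (gBar c (ε n) (hε n u) s * ((hε n u s - mean (ε n) (hε n u) s) / (s + ε n))
        - c ^ 2 * ((s + ε n) * mean (ε n) (hε n u) s * expNuLam (ε n) (hε n u) s)) := by
  have hε0 := hl.eps_pos n
  have hpos : ∀ s ∈ uIcc 1 r, 0 < s := fun s hs => lt_of_lt_of_le (lt_min one_pos hr) hs.1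
  refine (intervalIntegral.integral_eq_sub_of_hasDerivAt
    (fun s hs => (hl.sol n).hasDerivAt_xiReg hε0 hu (hpos s hs)) ?_).symm
  refine ContinuousOn.intervalIntegrable ?_
  refine ContinuousOn.mono ?_ (fun s hs => (hpos s hs).le : uIcc 1 r ⊆ Ici 0)
  exact continuousOn_right (F := fun u s => gBar c (ε n) (hε n u) s
    * ((hε n u s - mean (ε n) (hε n u) s) / (s + ε n))
        - c ^ 2 * ((s + ε n) * mean (ε n) (hε n u) s * expNuLam (ε n) (hε n u) s))
    (((hl.sol n).cont_xi_integrand hε0).sub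
      (continuousOn_const.mul ((hl.sol n).cont_xi_integrand' hε0))) hu

lemma bound_xiIntegrand (u₀ a b : ℝ) (ha : 0 < a) : ∃ B, 0 ≤ B ∧ ∀ᶠ n in atTop, ∀ u s, 0 ≤ u →
    u ≤ u₀ → a ≤ s → s ≤ b →
    |gBar c (ε n) (hε n u) s * ((hε n u s - mean (ε n) (hε n u) s) / (s + ε n))
        - c ^ 2 * ((s + ε n) * mean (ε n) (hε n u) s * expNuLam (ε n) (hε n u) s)| ≤ B := by
  obtain ⟨B, hB0, hB⟩ := hl.bound' u₀ a b ha
  refine ⟨1 * (B / a) + c ^ 2 * (B * 1), by positivity, ?_⟩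
  filter_upwards [hB] with n hn u s hu hu₀ has hsb
  obtain ⟨h1, h2⟩ := hn u s hu hu₀ has hsb
  have hs := ha.trans_le has
  have hε0 := hl.eps_pos n
  have hp := hl.profile n hu
  have hg := hp.gBar_nonneg hs (hl.wCoef_pos n u s hu hs).le
  have hg1 := (hp.gBar_le hs).trans (expNuLam_le_one hε0.le (hε n u) hs.le)
  have hE := expNuLam_le_one hε0.le (hε n u) hs.le
  have hE0 := expNuLam_pos (ε n) (hε n u) s
  refine (abs_sub _ _).trans ?_
  rw [abs_mul, abs_mul, abs_mul, abs_of_nonneg hg, abs_of_nonneg (sq_nonneg c), abs_of_pos hE0,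
    abs_div, abs_of_pos (by linarith : 0 < s + ε n)]
  have : a ≤ s + ε n := by linarith
  gcongr

/-- Between 1 and r the integrand is bounded (0 ≤ ḡ ≤ E ≤ 1) and converges. Thus ξ_ε converges
pointwise up to a function of u alone. -/
lemma tendsto_xiReg_sub {u r : ℝ} (hu : 0 ≤ u) (hr : 0 < r) :
    Tendsto (fun n => xiReg c (ε n) (hε n u) r - xiReg c (ε n) (hε n u) 1) atTop
      (𝓝 (xiTrunc c (h u) r 1)) := by
  rw [(hl.isProfile hu).xiTrunc_eq hr one_pos]
  simp only [hl.xiReg_sub _ hu hr]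
  obtain ⟨B, hB0, hB⟩ := hl.bound_xiIntegrand u (min 1 r) (max 1 r) (lt_min one_pos hr)
  refine tendsto_intervalIntegral_of_bound (B := B) one_pos hr (fun n => ?_) ?_ fun s hs => ?_
  · have hε0 := hl.eps_pos n
    refine ContinuousOn.mono ?_ Ioi_subset_Ici_self
    exact continuousOn_right (F := fun u s => gBar c (ε n) (hε n u) s
      * ((hε n u s - mean (ε n) (hε n u) s) / (s + ε n))
        - c ^ 2 * ((s + ε n) * mean (ε n) (hε n u) s * expNuLam (ε n) (hε n u) s))
      (((hl.sol n).cont_xi_integrand hε0).sub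
        (continuousOn_const.mul ((hl.sol n).cont_xi_integrand' hε0))) hu
  · filter_upwards [hB] with n hn s hs using hn u s hu le_rfl hs.1 hs.2
  · have hρ := hl.tendsto_rho s
    rw [add_zero] at hρ
    exact ((hl.tendsto_gBar hu hs).mul ((hl.tendsto_dev hu hs).div hρ (ne_of_gt hs))).sub
      (((hρ.mul (hl.tendsto_mean u s hu hs)).mul (hl.tendsto_expNuLam hu hs)).const_mul _)

lemma bound_xiReg_sub (u₀ a b : ℝ) (ha : 0 < a) : ∃ B, 0 ≤ B ∧ ∀ᶠ n in atTop, ∀ u r, 0 ≤ u →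
    u ≤ u₀ → a ≤ r → r ≤ b → |xiReg c (ε n) (hε n u) r - xiReg c (ε n) (hε n u) 1| ≤ B := by
  obtain ⟨B, hB0, hB⟩ := hl.bound_xiIntegrand u₀ (min 1 a) (max 1 b) (lt_min one_pos ha)
  refine ⟨B * (1 + |b|), by positivity, ?_⟩
  filter_upwards [hB] with n hn u r hu hu₀ har hrb
  have hr := ha.trans_le har
  rw [hl.xiReg_sub n hu hr]
  have h1 := intervalIntegral.norm_integral_le_of_norm_le_const (a := 1) (b := r) (C := B)
    (f := fun s => gBar c (ε n) (hε n u) s * ((hε n u s - mean (ε n) (hε n u) s) / (s + ε n))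
        - c ^ 2 * ((s + ε n) * mean (ε n) (hε n u) s * expNuLam (ε n) (hε n u) s)) fun s hs => by
      have hs' := uIoc_subset_uIcc hs
      exact hn u s hu hu₀ ((min_le_min_left 1 har).trans hs'.1) (hs'.2.trans (max_le_max_left 1 hrb))
  refine h1.trans ?_
  gcongr
  rw [abs_le]
  constructor <;> linarith [le_abs_self b, abs_nonneg b]

/-- Beyond R ≥ 4C the exponent is controlled by the mass, between r and R by the local bound on the
deviation. This lower bound makes division by E harmless at fixed r. -/
lemma exists_expNuLam_ge (u₀ : ℝ) {r : ℝ} (hr : 0 < r) :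
    ∃ e, 0 < e ∧ ∀ u, 0 ≤ u → u ≤ u₀ → e ≤ expNuLam 0 (h u) r := by
  have hC := hl.C_nonneg
  set R := max r (4 * C) with hR
  have hrR : r ≤ R := le_max_left _ _
  have hR0 : 0 < R := hr.trans_le hrR
  obtain ⟨B, hB0, hB⟩ := hl.bound' u₀ r R hr
  refine ⟨Real.exp (-(4 * C / R) - 4 * Real.pi * (B ^ 2 / r * |R - r|)), Real.exp_pos _,
    fun u hu hu₀ => Real.exp_le_exp.2 ?_⟩
  have h1 := (hl.isProfile hu).nuLam_sub hr hR0
  have h2 := (abs_le.1 (hl.abs_nuLam_le hu hR0 (le_max_right _ _))).1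
  have h3 := intervalIntegral.norm_integral_le_of_norm_le_const (a := r) (b := R) (C := B ^ 2 / r)
    (f := fun s => (h u s - mean 0 (h u) s) ^ 2 / (s + 0)) fun s hs => by
      rw [uIoc_of_le hrR] at hs
      have hs0 := hr.trans hs.1
      have h4 : |h u s - mean 0 (h u) s| ≤ B :=
        le_of_tendsto (hl.tendsto_dev hu hs0).abs (hB.mono fun n hn => (hn u s hu hu₀ hs.1.le hs.2).1)
      rw [Real.norm_eq_abs, abs_div, abs_pow, add_zero, abs_of_pos hs0]
      have := hs.1.le
      gcongr
  have h5 := (le_abs_self _).trans h3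
  have hπ := Real.pi_pos
  have h6 := mul_le_mul_of_nonneg_left h5 (by positivity : 0 ≤ 4 * Real.pi)
  linarith

lemma cont_domain_xiReg (n : ℕ) :
    ContinuousOn (fun p : ℝ × ℝ => xiReg c (ε n) (hε n p.1) p.2) domain :=
  ((hl.sol n).cont_xiReg (hl.eps_pos n)).mono domain_subset_quadrant

lemma cont_domain_xiReg_one (n : ℕ) :
    ContinuousOn (fun p : ℝ × ℝ => xiReg c (ε n) (hε n p.1) 1) domain :=
  ((hl.sol n).cont_xiReg (hl.eps_pos n)).comp (f := fun p : ℝ × ℝ => (p.1, (1 : ℝ))) (by fun_prop)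
    fun _ hp => mem_quadrant.2 ⟨hp.1, zero_le_one⟩

lemma measurable_xiTrunc : Measurable (domain.indicator fun p : ℝ × ℝ => xiTrunc c (h p.1) p.2 1) :=
  measurable_indicator_domain (f := fun u r => xiTrunc c (h u) r 1)
    (fun n => (hl.cont_domain_xiReg n).sub (hl.cont_domain_xiReg_one n))
    fun _ _ hu hr => hl.tendsto_xiReg_sub hu hr

lemma measurable_expNuLam :
    Measurable (domain.indicator fun p : ℝ × ℝ => expNuLam 0 (h p.1) p.2) :=
  measurable_indicator_domain (f := fun u r => expNuLam 0 (h u) r)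
    (fun n => ((hl.sol n).cont_expNuLam).mono domain_subset_quadrant)
    fun _ _ hu hr => hl.tendsto_expNuLam hu hr

lemma measurable_gBar_mul_dev : Measurable (domain.indicator fun p : ℝ × ℝ =>
    gBar c 0 (h p.1) p.2 * (h p.1 p.2 - mean 0 (h p.1) p.2)) :=
  measurable_indicator_domain (f := fun u r => gBar c 0 (h u) r * (h u r - mean 0 (h u) r))
    (fun n => ((hl.sol n).cont_gBar_mul_dev (hl.eps_pos n)).mono domain_subset_quadrant)
    fun _ _ hu hr => (hl.tendsto_gBar hu hr).mul (hl.tendsto_dev hu hr)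

end IsBoundedLimit

/-! ### Energy on a single cone and behaviour at the center -/

/-- The weight `1 / max (1, s)²`. -/
def weight (s : ℝ) : ℝ := 1 / max 1 s ^ 2

lemma weight_pos (s : ℝ) : 0 < weight s := by
  have : (0 : ℝ) < max 1 s := one_pos.trans_le (le_max_left _ _)
  unfold weight; positivity

lemma weight_le_one (s : ℝ) : weight s ≤ 1 := by
  have : (1 : ℝ) ≤ max 1 s := le_max_left _ _
  unfold weight
  rw [div_le_one (by positivity)]
  nlinarith

lemma weight_anti {a b : ℝ} (hab : a ≤ b) : weight b ≤ weight a := by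
  have : (1 : ℝ) ≤ max 1 a := le_max_left _ _
  unfold weight
  gcongr

lemma weight_of_le_one {s : ℝ} (hs : s ≤ 1) : weight s = 1 := by simp [weight, max_eq_left hs]

lemma continuous_weight : Continuous weight :=
  continuous_const.div (by fun_prop) fun s => by
    have : (0 : ℝ) < max 1 s := one_pos.trans_le (le_max_left _ _)
    positivity

lemma weight_mul_le {s : ℝ} (hs : 0 < s) (c : ℝ) :
    weight s * (1 / s + c ^ 2) ≤ (1 + c ^ 2) * (1 / s) := by
  have h1 := weight_le_one s
  have h2 : weight s ≤ 1 / s := by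
    unfold weight
    refine one_div_le_one_div_of_le hs ?_
    have h3 : (1 : ℝ) ≤ max 1 s := le_max_left _ _
    have h4 : s ≤ max 1 s := le_max_right _ _
    nlinarith
  have h3 : weight s * (1 / s) ≤ 1 * (1 / s) := by gcongr
  have h4 : weight s * c ^ 2 ≤ 1 / s * c ^ 2 := by gcongr
  linarith

/-- The energy flux `(ḡ (f - f̄))² / e^{ν + λ}`. -/
def flux (c : ℝ) (f : ℝ → ℝ) (s : ℝ) : ℝ :=
  (gBar c 0 f s * (f s - mean 0 f s)) ^ 2 / expNuLam 0 f s

/-- The quotient `(e + ∫₁ʳ ξ')² / e^{ν + λ}` for a given value `e` at `r = 1`. -/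
def energy (c e : ℝ) (f : ℝ → ℝ) (r : ℝ) : ℝ := (e + xiTrunc c f r 1) ^ 2 / expNuLam 0 f r

lemma energy_nonneg (c e : ℝ) (f : ℝ → ℝ) (r : ℝ) : 0 ≤ energy c e f r :=
  div_nonneg (sq_nonneg _) (expNuLam_pos _ _ _).le

lemma flux_nonneg (c : ℝ) (f : ℝ → ℝ) (r : ℝ) : 0 ≤ flux c f r :=
  div_nonneg (sq_nonneg _) (expNuLam_pos _ _ _).le

/-- Monotone convergence along the intervals (1/(n+1), n+1], which exhaust (0, ∞). -/
lemma lintegral_Ioi_le_of_intervalIntegral_le {f : ℝ → ℝ} {B : ℝ} (hf : ContinuousOn f (Ioi 0))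
    (h0 : ∀ s, 0 < s → 0 ≤ f s) (hB : ∀ a b, 0 < a → a ≤ b → ∫ s in a..b, f s ≤ B) :
    ∫⁻ s in Ioi 0, ENNReal.ofReal (f s) ≤ ENNReal.ofReal B := by
  have hU : (⋃ n : ℕ, Ioc (1 / ((n : ℝ) + 1)) (n + 1)) = Ioi 0 := by
    refine Subset.antisymm (iUnion_subset fun n s hs => ?_) fun s hs => ?_
    · have : (0 : ℝ) < 1 / ((n : ℝ) + 1) := by positivity
      exact this.trans hs.1
    · have hs0 : 0 < s := hs
      obtain ⟨n, hn⟩ := exists_nat_gt (max s (1 / s))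
      have h1 := (le_max_left s (1 / s)).trans_lt hn
      have h2 := (le_max_right s (1 / s)).trans_lt hn
      refine mem_iUnion.2 ⟨n, ?_, by linarith⟩
      rw [div_lt_iff₀ hs0] at h2
      rw [div_lt_iff₀ (by positivity)]
      nlinarith
  have hmono : Monotone fun n : ℕ => Ioc (1 / ((n : ℝ) + 1)) ((n : ℝ) + 1) := by
    intro m n hmn
    have : (m : ℝ) ≤ n := Nat.cast_le.2 hmn
    refine Ioc_subset_Ioc ?_ (by linarith)
    gcongr
  rw [← hU, setLIntegral_iUnion_of_directed _ (directed_of_isDirected_le hmono)]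
  refine iSup_le fun n => ?_
  have ha : (0 : ℝ) < 1 / ((n : ℝ) + 1) := by positivity
  have hab : 1 / ((n : ℝ) + 1) ≤ n + 1 := by
    rw [div_le_iff₀ (by positivity)]
    have : (0 : ℝ) ≤ n := n.cast_nonneg
    nlinarith
  rw [← ofReal_integral_eq_lintegral_ofReal
    (intervalIntegrable_of_continuousOn_Ioi ha (ha.trans_le hab) hf).1
    ((ae_restrict_iff' measurableSet_Ioc).2 (Eventually.of_forall fun s hs => h0 s (ha.trans hs.1))),
    ← intervalIntegral.integral_of_le hab]
  exact ENNReal.ofReal_le_ofReal (hB _ _ ha hab)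

lemma lintegral_Ioo_const_div_eq_top {η δ : ℝ} (hη : 0 < η) (hδ : 0 < δ) :
    ∫⁻ s in Ioo 0 δ, ENNReal.ofReal (η / s) = ⊤ := by
  by_contra h
  have h1 : IntegrableOn (fun s : ℝ => η / s) (Ioo 0 δ) := by
    refine ⟨(ContinuousOn.aestronglyMeasurable (continuousOn_const.div continuousOn_id
      fun s hs => hs.1.ne') measurableSet_Ioo), ?_⟩
    rw [hasFiniteIntegral_iff_ofReal ((ae_restrict_iff' measurableSet_Ioo).2
      (Eventually.of_forall fun s hs => div_nonneg hη.le hs.1.le))]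
    exact lt_top_iff_ne_top.2 h
  have h2 : IntegrableOn (fun s : ℝ => s⁻¹) (Ioo 0 δ) := by
    refine (h1.const_mul η⁻¹).congr (Eventually.of_forall fun s => ?_)
    field_simp
  rw [← intervalIntegrable_iff_integrableOn_Ioo_of_le hδ.le] at h2
  have := intervalIntegrable_inv_iff.1 h2
  rcases this with h3 | h3
  · exact hδ.ne h3
  · exact h3 left_mem_uIcc

namespace IsProfile

variable {c C e : ℝ} {f : ℝ → ℝ} (hp : IsProfile c 0 f)
include hp

lemma cont_flux : ContinuousOn (flux c f) (Ioi 0) :=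
  ((hp.cont_gBar.mul hp.cont_dev).pow 2).div hp.cont_expNuLam fun _ _ => (expNuLam_pos _ _ _).ne'

lemma cont_xiTrunc : ContinuousOn (fun r => xiTrunc c f r 1) (Ioi 0) := fun _ hr =>
  (hp.hasDerivAt_xiTrunc hr).continuousAt.continuousWithinAt

lemma cont_energy : ContinuousOn (energy c e f) (Ioi 0) :=
  ((continuousOn_const.add hp.cont_xiTrunc).pow 2).div hp.cont_expNuLam
    fun _ _ => (expNuLam_pos _ _ _).ne'

variable (hw : ∀ r, 0 < r → 0 ≤ wCoef c 0 f r)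
include hw

lemma flux_le {r : ℝ} (hr : 0 < r) :
    flux c f r ≤ expNuLam 0 f r * (f r - mean 0 f r) ^ 2 := by
  have h1 := hp.gBar_nonneg hr (hw r hr)
  have h2 := hp.gBar_le hr
  have h3 := expNuLam_pos 0 f r
  unfold flux
  rw [div_le_iff₀ h3, mul_pow]
  have : gBar c 0 f r ^ 2 ≤ expNuLam 0 f r ^ 2 := by gcongr
  nlinarith [mul_le_mul_of_nonneg_right this (sq_nonneg (f r - mean 0 f r))]

/-- From ḡ ≤ E the integrand is at most E K²/s = E'/(4π), and E ranges in (0, 1]. The bound is the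
same for every cone. -/
lemma lintegral_flux_le :
    ∫⁻ s in Ioi 0, ENNReal.ofReal (1 / s * flux c f s) ≤ ENNReal.ofReal (1 / (4 * Real.pi)) := by
  have h1 := hp.cont_flux
  have h2 : ContinuousOn (fun s : ℝ => 1 / s) (Ioi 0) :=
    continuousOn_const.div continuousOn_id fun s hs => ne_of_gt hs
  have h3 := hp.cont_expNuLam
  have h4 := hp.cont_density
  refine lintegral_Ioi_le_of_intervalIntegral_le (by fun_prop)
    (fun s hs => mul_nonneg (by positivity) (flux_nonneg _ _ _)) fun a b ha hab => ?_
  refine le_trans ?_ (hp.integral_exp_density_le ha hab)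
  refine intervalIntegral.integral_mono_on hab
    (intervalIntegrable_of_continuousOn_Ioi ha (ha.trans_le hab) (by fun_prop))
    (intervalIntegrable_of_continuousOn_Ioi ha (ha.trans_le hab) (by fun_prop)) fun s hs => ?_
  have hs0 := ha.trans_le hs.1
  have := mul_le_mul_of_nonneg_left (hp.flux_le hw hs0) (one_div_nonneg.2 hs0.le)
  refine this.trans_eq ?_
  rw [add_zero]; ring

variable (hm : ∀ r, 0 < r → hawkingMass c 0 f r ≤ C)
include hm

lemma lintegral_source_le :
    ∫⁻ s in Ioi 0, ENNReal.ofReal (1 / s * flux c f s + c ^ 2 * (s * mean 0 f s) ^ 2)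
      ≤ ENNReal.ofReal (1 / (4 * Real.pi) + C / (2 * Real.pi)) := by
  have hπ := Real.pi_pos
  have hC : 0 ≤ C := (hp.hawkingMass_nonneg one_pos).trans (hm 1 one_pos)
  have h1 := hp.cont_mean
  have h2 : ∫⁻ s in Ioi 0, ENNReal.ofReal (c ^ 2 * (s * mean 0 f s) ^ 2)
      ≤ ENNReal.ofReal (C / (2 * Real.pi)) := by
    refine lintegral_Ioi_le_of_intervalIntegral_le (by fun_prop) (fun s hs => by positivity)
      fun a b ha hab => ?_
    have h3 := (hp.integral_mean_sq_le ha hab hw).trans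
      (div_le_div_of_nonneg_right (hm b (ha.trans_le hab)) (by positivity : 0 ≤ 2 * Real.pi))
    simpa only [add_zero] using h3
  rw [ENNReal.ofReal_add (by positivity) (by positivity)]
  refine le_trans ?_ (add_le_add (hp.lintegral_flux_le hw) h2)
  rw [← lintegral_add_right']
  · refine lintegral_mono_ae ((ae_restrict_iff' measurableSet_Ioi).2
      (Eventually.of_forall fun s hs => ?_))
    exact ENNReal.ofReal_add_le
  · exact ((by fun_prop : ContinuousOn (fun s => c ^ 2 * (s * mean 0 f s) ^ 2)
      (Ioi 0)).aemeasurable measurableSet_Ioi).ennreal_ofReal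

omit hw hm in
-- In the derivative of y²/E the term coming from E' has a favourable sign and is dropped. The two
-- terms from y' are split by Young's inequality, the second one using y² ≤ y²/E.
lemma energy_sub_le {a r : ℝ} (ha : 0 < a) (har : a ≤ r) :
    energy c e f r - energy c e f a ≤ ∫ s in a..r, ((1 / s + c ^ 2) * energy c e f s
      + (1 / s * flux c f s + c ^ 2 * (s * mean 0 f s) ^ 2)) := by
  have h1 := hp.cont_flux
  have h2 : ContinuousOn (fun s : ℝ => 1 / s) (Ioi 0) :=
    continuousOn_const.div continuousOn_id fun s hs => ne_of_gt hs
  have h3 := hp.cont_energy (e := e)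
  have h4 := hp.cont_mean
  have hpos : ∀ s ∈ Icc a r, 0 < s := fun s hs => ha.trans_le hs.1
  refine intervalIntegral.sub_le_integral_of_hasDeriv_right_of_le har (h3.mono hpos)
    (fun s hs => (((hp.hasDerivAt_xiTrunc (ha.trans hs.1)).const_add e).pow 2 |>.div
      (hp.hasDerivAt_expNuLam (ha.trans hs.1)) (expNuLam_pos _ _ _).ne').hasDerivWithinAt)
    ((ContinuousOn.mono (by fun_prop) hpos).integrableOn_Icc) fun s hs => ?_
  have hs0 : 0 < s := ha.trans hs.1
  have hE := expNuLam_pos 0 f s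
  have hE1 := expNuLam_le_one le_rfl f hs0.le
  have hπ := Real.pi_pos
  simp only [Pi.pow_apply, add_zero, energy, flux, xiIntegrand]
  set y := e + xiTrunc c f s 1 with hy
  set E := expNuLam 0 f s with hEd
  set k := f s - mean 0 f s with hk
  set g := gBar c 0 f s with hg
  set v := s * mean 0 f s with hv
  have e1 : ((2 : ℕ) * y ^ (2 - 1) * (g * (k / s) - c ^ 2 * (v * E)) * E
      - y ^ 2 * (4 * Real.pi * (k ^ 2 / s) * E)) / E ^ 2
      = 1 / s * (2 * y * (g * k) / E) - c ^ 2 * (2 * y * v)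
        - 4 * Real.pi * (k ^ 2 / s) * (y ^ 2 / E) := by
    field_simp
    push_cast
    ring
  rw [e1]
  have h5 : 0 ≤ 4 * Real.pi * (k ^ 2 / s) * (y ^ 2 / E) := by positivity
  have h6 : 2 * y * (g * k) / E ≤ y ^ 2 / E + (g * k) ^ 2 / E := by
    rw [← add_div]
    refine div_le_div_of_nonneg_right ?_ hE.le
    nlinarith [sq_nonneg (y - g * k)]
  have h7 : -(2 * y * v) ≤ y ^ 2 / E + v ^ 2 := by
    have : y ^ 2 ≤ y ^ 2 / E := by
      rw [le_div_iff₀ hE]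
      nlinarith [sq_nonneg y]
    nlinarith [sq_nonneg (y + v)]
  have h8 := mul_le_mul_of_nonneg_left h6 (one_div_nonneg.2 hs0.le)
  have h9 := mul_le_mul_of_nonneg_left h7 (sq_nonneg c)
  linarith

variable (hfin : ∫⁻ s in Ioi 0, ENNReal.ofReal (weight s * (1 / s + c ^ 2) * energy c e f s) ≠ ⊤)
include hfin

omit hp hw hm in
-- An energy bounded below by η > 0 near the center would make the integral diverge logarithmically.
lemma exists_energy_lt {δ η : ℝ} (hδ : 0 < δ) (hη : 0 < η) :
    ∃ a, 0 < a ∧ a < δ ∧ energy c e f a < η := by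
  by_contra! hcon
  refine hfin (top_le_iff.1 ?_)
  rw [← lintegral_Ioo_const_div_eq_top hη (lt_min hδ one_pos)]
  refine (setLIntegral_mono' measurableSet_Ioo fun s hs => ENNReal.ofReal_le_ofReal ?_).trans
    (lintegral_mono_set Ioo_subset_Ioi_self)
  have h1 := hcon s hs.1 (hs.2.trans_le (min_le_left _ _))
  rw [weight_of_le_one (hs.2.le.trans (min_le_right _ _)), one_mul]
  have hs0 := hs.1
  calc η / s = 1 / s * η := by ring
    _ ≤ (1 / s + c ^ 2) * energy c e f s :=
      mul_le_mul (by linarith [sq_nonneg c]) h1 hη.le (by positivity)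

/-- The differential inequality is integrated from a radius a < r where the energy is below η. No
Gronwall argument is needed: the energy term on the right is integrable by assumption, and its
weight enters because `weight r ≤ weight s` for s ≤ r. -/
lemma weight_mul_energy_le {r : ℝ} (hr : 0 < r) :
    weight r * energy c e f r
      ≤ (∫⁻ s in Ioi 0, ENNReal.ofReal (weight s * (1 / s + c ^ 2) * energy c e f s)).toReal
        + (1 / (4 * Real.pi) + C / (2 * Real.pi)) := by
  have hπ := Real.pi_pos
  have hC : 0 ≤ C := (hp.hawkingMass_nonneg one_pos).trans (hm 1 one_pos)
  refine le_of_forall_pos_le_add fun η hη => ?_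
  obtain ⟨a, ha, har, haη⟩ := exists_energy_lt hfin hr hη
  have h1 := hp.cont_flux
  have h2 : ContinuousOn (fun s : ℝ => 1 / s) (Ioi 0) :=
    continuousOn_const.div continuousOn_id fun s hs => ne_of_gt hs
  have h3 := hp.cont_energy (e := e)
  have h4 := hp.cont_mean
  have h5 := continuous_weight
  have hcA : ContinuousOn (fun s => weight s * (1 / s + c ^ 2) * energy c e f s) (Ioi 0) := by
    fun_prop
  have hcS : ContinuousOn (fun s => 1 / s * flux c f s + c ^ 2 * (s * mean 0 f s) ^ 2) (Ioi 0) := by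
    fun_prop
  have hA0 : ∀ s, 0 < s → 0 ≤ weight s * (1 / s + c ^ 2) * energy c e f s := fun s hs =>
    mul_nonneg (mul_nonneg (weight_pos s).le (by positivity)) (energy_nonneg _ _ _ _)
  have hS0 : ∀ s, 0 < s → 0 ≤ 1 / s * flux c f s + c ^ 2 * (s * mean 0 f s) ^ 2 := fun s hs =>
    add_nonneg (mul_nonneg (by positivity) (flux_nonneg _ _ _)) (by positivity)
  have hle : ∀ {g : ℝ → ℝ}, ContinuousOn g (Ioi 0) → (∀ s, 0 < s → 0 ≤ g s) →
      ∫⁻ s in Ioi 0, ENNReal.ofReal (g s) ≠ ⊤ →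
      ∫ s in a..r, g s ≤ (∫⁻ s in Ioi 0, ENNReal.ofReal (g s)).toReal := by
    intro g hg hg0 hgt
    rw [intervalIntegral.integral_of_le har.le, integral_eq_lintegral_of_nonneg_ae
      ((ae_restrict_iff' measurableSet_Ioc).2
        (Eventually.of_forall fun s hs => hg0 s (ha.trans hs.1)))
      ((hg.mono fun s hs => ha.trans hs.1).aestronglyMeasurable measurableSet_Ioc)]
    exact ENNReal.toReal_mono hgt (lintegral_mono_set fun s hs => ha.trans hs.1)
  have hsrc := hp.lintegral_source_le hw hm
  have h6 := hle hcA hA0 hfin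
  have h7 := (hle hcS hS0 (ne_top_of_le_ne_top ENNReal.ofReal_ne_top hsrc)).trans
    (ENNReal.toReal_le_of_le_ofReal (by positivity) hsrc)
  have h8 := hp.energy_sub_le (e := e) ha har.le
  have h9 : weight r * ∫ s in a..r, ((1 / s + c ^ 2) * energy c e f s
      + (1 / s * flux c f s + c ^ 2 * (s * mean 0 f s) ^ 2))
      ≤ (∫ s in a..r, weight s * (1 / s + c ^ 2) * energy c e f s)
        + ∫ s in a..r, (1 / s * flux c f s + c ^ 2 * (s * mean 0 f s) ^ 2) := by
    rw [← intervalIntegral.integral_add (intervalIntegrable_of_continuousOn_Ioi ha hr hcA)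
      (intervalIntegrable_of_continuousOn_Ioi ha hr hcS), ← intervalIntegral.integral_const_mul]
    refine intervalIntegral.integral_mono_on har.le
      (intervalIntegrable_of_continuousOn_Ioi ha hr (by fun_prop))
      (intervalIntegrable_of_continuousOn_Ioi ha hr (hcA.add hcS)) fun s hs => ?_
    have hs0 := ha.trans_le hs.1
    have h10 : weight r * ((1 / s + c ^ 2) * energy c e f s)
        ≤ weight s * ((1 / s + c ^ 2) * energy c e f s) :=
      mul_le_mul_of_nonneg_right (weight_anti hs.2)
        (mul_nonneg (by positivity) (energy_nonneg _ _ _ _))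
    have h11 := mul_le_of_le_one_left (hS0 s hs0) (weight_le_one r)
    linarith
  have h10 : weight r * energy c e f a ≤ η :=
    (mul_le_of_le_one_left (energy_nonneg _ _ _ _) (weight_le_one r)).trans haη.le
  have h11 := mul_le_mul_of_nonneg_left h8 (weight_pos r).le
  linarith

/-- Near the center the energy tends to zero. -/
lemma tendsto_energy : Tendsto (energy c e f) (𝓝[>] 0) (𝓝 0) := by
  have h1 := hp.cont_flux
  have h2 : ContinuousOn (fun s : ℝ => 1 / s) (Ioi 0) :=
    continuousOn_const.div continuousOn_id fun s hs => ne_of_gt hs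
  have h3 := hp.cont_energy (e := e)
  have h4 := hp.cont_mean
  have hcA : ContinuousOn (fun s => (1 / s + c ^ 2) * energy c e f s) (Ioi 0) := by fun_prop
  have hcS : ContinuousOn (fun s => 1 / s * flux c f s + c ^ 2 * (s * mean 0 f s) ^ 2) (Ioi 0) := by
    fun_prop
  have hA0 : ∀ s, 0 < s → 0 ≤ (1 / s + c ^ 2) * energy c e f s := fun s hs =>
    mul_nonneg (by positivity) (energy_nonneg _ _ _ _)
  have hS0 : ∀ s, 0 < s → 0 ≤ 1 / s * flux c f s + c ^ 2 * (s * mean 0 f s) ^ 2 := fun s hs =>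
    add_nonneg (mul_nonneg (by positivity) (flux_nonneg _ _ _)) (by positivity)
  have hint : ∀ {g : ℝ → ℝ}, ContinuousOn g (Ioi 0) → (∀ s, 0 < s → 0 ≤ g s) →
      ∫⁻ s in Ioc 0 1, ENNReal.ofReal (g s) ≠ ⊤ → IntegrableOn g (Ioc 0 1) := by
    intro g hg hg0 hgt
    refine ⟨(hg.mono fun s hs => hs.1).aestronglyMeasurable measurableSet_Ioc, ?_⟩
    rw [hasFiniteIntegral_iff_ofReal ((ae_restrict_iff' measurableSet_Ioc).2
      (Eventually.of_forall fun s hs => hg0 s hs.1))]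
    exact lt_top_iff_ne_top.2 hgt
  have iA : IntegrableOn (fun s => (1 / s + c ^ 2) * energy c e f s) (Ioc 0 1) := by
    refine hint hcA hA0 (ne_top_of_le_ne_top hfin ?_)
    refine (setLIntegral_mono' measurableSet_Ioc fun s hs => ?_).trans
      (lintegral_mono_set Ioc_subset_Ioi_self)
    rw [weight_of_le_one hs.2, one_mul]
  have iS : IntegrableOn (fun s => 1 / s * flux c f s + c ^ 2 * (s * mean 0 f s) ^ 2) (Ioc 0 1) :=
    hint hcS hS0 (ne_top_of_le_ne_top ENNReal.ofReal_ne_top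
      ((lintegral_mono_set Ioc_subset_Ioi_self).trans (hp.lintegral_source_le hw hm)))
  set G : ℝ → ℝ := fun s => (1 / s + c ^ 2) * energy c e f s
      + (1 / s * flux c f s + c ^ 2 * (s * mean 0 f s) ^ 2) with hG
  have iG : IntervalIntegrable G volume 0 1 :=
    (intervalIntegrable_iff_integrableOn_Ioc_of_le zero_le_one).2 (iA.add iS)
  have hG0 : ∀ s, 0 < s → 0 ≤ G s := fun s hs => add_nonneg (hA0 s hs) (hS0 s hs)
  have hlim : Tendsto (fun r => ∫ s in (0 : ℝ)..r, G s) (𝓝[>] 0) (𝓝 0) := by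
    have h5 := (intervalIntegral.continuousOn_primitive_interval' iG left_mem_uIcc) 0 left_mem_uIcc
    rw [uIcc_of_le zero_le_one, ContinuousWithinAt, intervalIntegral.integral_same] at h5
    refine h5.mono_left ?_
    rw [← nhdsWithin_Ioo_eq_nhdsGT zero_lt_one]
    exact nhdsWithin_mono _ Ioo_subset_Icc_self
  refine tendsto_of_tendsto_of_tendsto_of_le_of_le' tendsto_const_nhds hlim
    (Eventually.of_forall fun r => energy_nonneg _ _ _ _) ?_
  filter_upwards [Ioo_mem_nhdsGT (zero_lt_one (α := ℝ))] with r hr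
  refine le_of_forall_pos_le_add fun η hη => ?_
  -- Starting from radii a → 0 of arbitrarily small energy gives energy(r) ≤ ∫₀ʳ G, which tends to 0
  -- because G is integrable at the center.
  obtain ⟨a, ha, har, haη⟩ := exists_energy_lt hfin hr.1 hη
  have h6 := hp.energy_sub_le (e := e) ha har.le
  have h7 : ∫ s in a..r, G s ≤ ∫ s in (0 : ℝ)..r, G s := by
    have i1 : IntervalIntegrable G volume 0 a := iG.mono_set (by
      rw [uIcc_of_le ha.le, uIcc_of_le zero_le_one]
      exact Icc_subset_Icc_right (har.le.trans hr.2.le))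
    have i2 : IntervalIntegrable G volume a r :=
      intervalIntegrable_of_continuousOn_Ioi ha hr.1 (hcA.add hcS)
    rw [← intervalIntegral.integral_add_adjacent_intervals i1 i2]
    have : 0 ≤ ∫ s in (0 : ℝ)..a, G s := by
      rw [intervalIntegral.integral_of_le ha.le]
      exact setIntegral_nonneg measurableSet_Ioc fun s hs => hG0 s hs.1
    linarith
  linarith

lemma tendsto_xiTrunc_one : Tendsto (fun r => e + xiTrunc c f r 1) (𝓝[>] 0) (𝓝 0) := by
  have h1 := (hp.tendsto_energy hw hm hfin).sqrt
  rw [Real.sqrt_zero] at h1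
  refine squeeze_zero_norm' ?_ h1
  filter_upwards [self_mem_nhdsWithin] with r hr
  have hr0 : 0 < r := hr
  rw [Real.norm_eq_abs]
  refine Real.abs_le_sqrt ?_
  have hE := expNuLam_pos 0 f r
  have hE1 := expNuLam_le_one le_rfl f hr0.le
  unfold energy
  rw [le_div_iff₀ hE]
  nlinarith [sq_nonneg (e + xiTrunc c f r 1)]

lemma tendsto_xiTrunc {r : ℝ} (hr : 0 < r) :
    Tendsto (xiTrunc c f r) (𝓝[>] 0) (𝓝 (e + xiTrunc c f r 1)) := by
  have h1 := (hp.tendsto_xiTrunc_one hw hm hfin).const_sub (e + xiTrunc c f r 1)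
  rw [sub_zero] at h1
  refine h1.congr' ?_
  filter_upwards [self_mem_nhdsWithin] with δ hδ
  rw [hp.xiTrunc_sub hr hδ]
  ring

/-- Finite weighted energy forces e to be the improper integral of the integrand from 0 to 1. The
constant is therefore determined by the profile, and `xi` takes no default value on such a cone. -/
lemma xi_eq {r : ℝ} (hr : 0 < r) : xi c f r = e + xiTrunc c f r 1 :=
  (hp.tendsto_xiTrunc hw hm hfin hr).limUnder_eq

end IsProfile

/-! ### Weak limits and measurability -/

/-- Sequences bounded in `L²` have weak limits along ultrafilters. -/
lemma exists_weak_limit {μ : Measure ℝ} {X : ℕ → ℝ → ℝ} (hX : ∀ n, MemLp (X n) 2 μ) {B : ℝ}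
    (𝒰 : Ultrafilter ℕ) (hB : ∀ᶠ n in (𝒰 : Filter ℕ), ∫ u, X n u ^ 2 ∂μ ≤ B) :
    ∃ η : ℝ → ℝ, Measurable η ∧ MemLp η 2 μ ∧ ∀ ψ, MemLp ψ 2 μ →
      Tendsto (fun n => ∫ u, X n u * ψ u ∂μ) 𝒰 (𝓝 (∫ u, η u * ψ u ∂μ)) := by
  have hinner : ∀ {x y : ℝ → ℝ} (hx : MemLp x 2 μ) (hy : MemLp y 2 μ),
      inner ℝ (hx.toLp x) (hy.toLp y) = ∫ u, x u * y u ∂μ := by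
    intro x y hx hy
    rw [L2.inner_def]
    refine integral_congr_ae ?_
    filter_upwards [hx.coeFn_toLp, hy.coeFn_toLp] with u h1 h2
    rw [h1, h2]
    simp [mul_comm]
  let Y : ℕ → WeakDual ℝ (Lp ℝ 2 μ) := fun n =>
    StrongDual.toWeakDual (InnerProductSpace.toDual ℝ (Lp ℝ 2 μ) ((hX n).toLp (X n)))
  have hball : ∀ᶠ n in (𝒰 : Filter ℕ),
      Y n ∈ WeakDual.toStrongDual ⁻¹' Metric.closedBall (0 : StrongDual ℝ (Lp ℝ 2 μ)) (√B) := by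
    filter_upwards [hB] with n hn
    have h1 : ‖(hX n).toLp (X n)‖ ^ 2 ≤ B := by
      rw [← real_inner_self_eq_norm_sq, hinner]
      simpa only [← sq] using hn
    have h2 : ‖(hX n).toLp (X n)‖ ≤ √B := Real.le_sqrt_of_sq_le h1
    have h3 : ‖InnerProductSpace.toDual ℝ (Lp ℝ 2 μ) ((hX n).toLp (X n))‖ ≤ √B := by
      rwa [LinearIsometryEquiv.norm_map]
    rw [mem_preimage, mem_closedBall_zero_iff]
    exact h3
  -- Banach–Alaoglu: the closed ball of radius √B is weak-* compact, so the image ultrafilter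
  -- converges. The Riesz isomorphism turns its limit into a function.
  obtain ⟨y, -, hy⟩ := (WeakDual.isCompact_closedBall (0 : StrongDual ℝ (Lp ℝ 2 μ))
    (√B)).ultrafilter_le_nhds (𝒰.map Y) (by
      rw [le_principal_iff]
      exact hball)
  set z : Lp ℝ 2 μ := (InnerProductSpace.toDual ℝ (Lp ℝ 2 μ)).symm (WeakDual.toStrongDual y) with hz
  have hzm : AEStronglyMeasurable z μ := (Lp.memLp z).1
  have hae : z =ᵐ[μ] hzm.mk z := hzm.ae_eq_mk
  -- A genuinely measurable representative is chosen, so that the energy built from it is jointly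
  -- measurable and Tonelli's theorem applies.
  refine ⟨hzm.mk z, hzm.stronglyMeasurable_mk.measurable, (memLp_congr_ae hae).1 (Lp.memLp z),
    fun ψ hψ => ?_⟩
  have h1 : Tendsto (fun n => (Y n) (hψ.toLp ψ)) 𝒰 (𝓝 (y (hψ.toLp ψ))) :=
    ((WeakDual.eval_continuous (hψ.toLp ψ)).tendsto y).comp hy
  have h2 : ∀ n, (Y n) (hψ.toLp ψ) = ∫ u, X n u * ψ u ∂μ := fun n => hinner (hX n) hψ
  have h3 : y (hψ.toLp ψ) = ∫ u, hzm.mk z u * ψ u ∂μ := by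
    have h4 : inner ℝ z (hψ.toLp ψ) = y (hψ.toLp ψ) :=
      InnerProductSpace.toDual_symm_apply
    have h5 := hinner (Lp.memLp z) hψ
    rw [Lp.toLp_coeFn] at h5
    rw [← h4, h5]
    refine integral_congr_ae ?_
    filter_upwards [hae] with u hu
    rw [hu]
  simpa only [h2, h3] using h1

lemma integrableOn_weight : IntegrableOn weight (Ioi 0) := by
  refine (integrable_inv_one_add_sq.const_mul 2).integrableOn.mono'
    continuous_weight.aestronglyMeasurable ((ae_restrict_iff' measurableSet_Ioi).2
      (Eventually.of_forall fun s hs => ?_))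
  have h1 : (1 : ℝ) ≤ max 1 s ^ 2 := one_le_pow₀ (le_max_left _ _)
  have h2 : s ^ 2 ≤ max 1 s ^ 2 := pow_le_pow_left₀ (le_of_lt hs) (le_max_right _ _) 2
  rw [Real.norm_of_nonneg (weight_pos s).le]
  unfold weight
  rw [← div_eq_mul_inv, div_le_div_iff₀ (by positivity) (by positivity)]
  linarith

lemma memLp_of_continuousOn_Ici {f : ℝ → ℝ} (hf : ContinuousOn f (Ici 0)) (u₀ : ℝ) :
    MemLp f 2 (volume.restrict (Ioo 0 u₀)) := by
  obtain ⟨B, hB⟩ := (isCompact_Icc (a := (0 : ℝ)) (b := u₀)).exists_bound_of_continuousOn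
    (hf.mono fun x hx => hx.1)
  exact MemLp.of_bound ((hf.mono fun x hx => hx.1.le).aestronglyMeasurable measurableSet_Ioo) B
    ((ae_restrict_iff' measurableSet_Ioo).2 (Eventually.of_forall fun u hu =>
      hB u ⟨hu.1.le, hu.2.le⟩))

lemma aestronglyMeasurable_of_indicator {f : ℝ → ℝ → ℝ}
    (hf : Measurable (domain.indicator fun p : ℝ × ℝ => f p.1 p.2)) {u₀ r : ℝ} (hr : 0 < r) :
    AEStronglyMeasurable (fun u => f u r) (volume.restrict (Ioo 0 u₀)) := by
  refine (hf.comp (by fun_prop : Measurable fun u : ℝ => (u, r))).aestronglyMeasurable.congr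
    ((ae_restrict_iff' measurableSet_Ioo).2 (Eventually.of_forall fun u hu => ?_))
  exact indicator_of_mem (mem_domain.2 ⟨hu.1.le, hr⟩) _

lemma aemeasurable_prod_of_indicator {f : ℝ → ℝ → ℝ}
    (hf : Measurable (domain.indicator fun p : ℝ × ℝ => f p.1 p.2)) (u₀ : ℝ) {s : Set ℝ}
    (hs : MeasurableSet s) (hs0 : s ⊆ Ioi 0) :
    AEMeasurable (fun p : ℝ × ℝ => f p.1 p.2)
      ((volume.restrict (Ioo 0 u₀)).prod (volume.restrict s)) := by
  refine hf.aemeasurable.congr ?_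
  rw [Measure.prod_restrict]
  refine (ae_restrict_iff' (measurableSet_Ioo.prod hs)).2 (Eventually.of_forall fun p hp => ?_)
  exact indicator_of_mem (mem_domain.2 ⟨hp.1.1.le, hs0 hp.2⟩) _

/-! ### Energy estimate for the weak limit -/

namespace IsBoundedLimit

variable {c C : ℝ} {h₀ : ℝ → ℝ} {ε : ℕ → ℝ} {hε : ℕ → ℝ → ℝ → ℝ} {h : ℝ → ℝ → ℝ}
  (hl : IsBoundedLimit c C h₀ ε hε h)
include hl

/-- Both bounds are kept: r/2 compensates the weight 1/r at the center, C is used at large radii. -/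
lemma mass_le_min (n : ℕ) {u r : ℝ} (hu : 0 ≤ u) (hr : 0 < r) :
    hawkingMass c (ε n) (hε n u) r ≤ min C ((r + ε n) / 2) :=
  le_min (hl.mass_le n u r hu hr) (hl.hawkingMass_le_half n hu hr)

lemma cont_xiReg_sq_div (n : ℕ) {r : ℝ} (hr : 0 < r) : ContinuousOn (fun u =>
    xiReg c (ε n) (hε n u) r ^ 2 / expNuLam (ε n) (hε n u) r) (Ici 0) :=
  (((hl.sol n).cont_xiReg_left (hl.eps_pos n) hr.le).pow 2).div
    ((hl.sol n).cont_expNuLam_left hr.le) fun _ _ => (expNuLam_pos _ _ _).ne'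

lemma cont_flux_left (n : ℕ) {r : ℝ} (hr : 0 < r) : ContinuousOn (fun u =>
    (gBar c (ε n) (hε n u) r * (hε n u r - mean (ε n) (hε n u) r)) ^ 2
      / expNuLam (ε n) (hε n u) r) (Ici 0) :=
  (((hl.sol n).cont_gBar_mul_dev_left (hl.eps_pos n) hr.le).pow 2).div
    ((hl.sol n).cont_expNuLam_left hr.le) fun _ _ => (expNuLam_pos _ _ _).ne'

omit hl in
lemma integrable_of_cont {f : ℝ → ℝ} (hf : ContinuousOn f (Ici 0)) (u₀ : ℝ) :
    Integrable f (volume.restrict (Ioo 0 u₀)) :=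
  ((hf.mono fun _ hx => hx.1).integrableOn_Icc (a := 0) (b := u₀)).mono_set Ioo_subset_Icc_self

variable {u₀ : ℝ} (hu₀ : 0 < u₀)
include hu₀

lemma integral_xiReg_sq_le (n : ℕ) {r : ℝ} (hr : 0 < r) :
    ∫ u in Ioo 0 u₀, xiReg c (ε n) (hε n u) r ^ 2 / expNuLam (ε n) (hε n u) r
      ≤ (∫ u in Ioo 0 u₀, (gBar c (ε n) (hε n u) r * (hε n u r - mean (ε n) (hε n u) r)) ^ 2
          / expNuLam (ε n) (hε n u) r) + min C ((r + ε n) / 2) / Real.pi := by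
  have h1 := (hl.sol n).integral_xiReg_sq_le (hl.eps_pos n) hu₀.le hr
  rw [intervalIntegral.integral_of_le hu₀.le, intervalIntegral.integral_of_le hu₀.le,
    integral_Ioc_eq_integral_Ioo, integral_Ioc_eq_integral_Ioo] at h1
  refine h1.trans ?_
  have := hl.mass_le_min n le_rfl hr
  have := Real.pi_pos
  gcongr

omit hu₀ in
lemma flux_bound {r : ℝ} (hr : 0 < r) : ∃ B, 0 ≤ B ∧ ∀ᶠ n in atTop, ∀ u, 0 ≤ u → u ≤ u₀ →
    (gBar c (ε n) (hε n u) r * (hε n u r - mean (ε n) (hε n u) r)) ^ 2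
      / expNuLam (ε n) (hε n u) r ≤ B := by
  obtain ⟨B, hB0, hB⟩ := hl.bound' u₀ r r hr
  refine ⟨B ^ 2, by positivity, ?_⟩
  filter_upwards [hB] with n hn u hu hu₀'
  have h1 := (hn u r hu hu₀' le_rfl le_rfl).1
  have hp := hl.profile n hu
  have hg := hp.gBar_nonneg hr (hl.wCoef_pos n u r hu hr).le
  have hg1 := hp.gBar_le hr
  have hE := expNuLam_pos (ε n) (hε n u) r
  have hE1 := expNuLam_le_one (hl.eps_pos n).le (hε n u) hr.le
  rw [div_le_iff₀ hE, mul_pow, ← sq_abs (hε n u r - mean (ε n) (hε n u) r)]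
  have h2 : gBar c (ε n) (hε n u) r ^ 2 ≤ expNuLam (ε n) (hε n u) r := by nlinarith
  rw [mul_comm]
  gcongr

omit hu₀ in
lemma tendsto_integral_flux {r : ℝ} (hr : 0 < r) : Tendsto (fun n => ∫ u in Ioo 0 u₀,
      (gBar c (ε n) (hε n u) r * (hε n u r - mean (ε n) (hε n u) r)) ^ 2
        / expNuLam (ε n) (hε n u) r) atTop (𝓝 (∫ u in Ioo 0 u₀, flux c (h u) r)) := by
  obtain ⟨B, hB0, hB⟩ := hl.flux_bound (u₀ := u₀) hr
  refine tendsto_integral_filter_of_dominated_convergence (fun _ => B)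
    (Eventually.of_forall fun n => (integrable_of_cont (hl.cont_flux_left n hr) u₀).1)
    ?_ (integrable_const B) ?_
  · filter_upwards [hB] with n hn
    refine (ae_restrict_iff' measurableSet_Ioo).2 (Eventually.of_forall fun u hu => ?_)
    rw [Real.norm_of_nonneg (div_nonneg (sq_nonneg _) (expNuLam_pos _ _ _).le)]
    exact hn u hu.1.le hu.2.le
  · refine (ae_restrict_iff' measurableSet_Ioo).2 (Eventually.of_forall fun u hu => ?_)
    exact (((hl.tendsto_gBar hu.1.le hr).mul (hl.tendsto_dev hu.1.le hr)).pow 2).div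
      (hl.tendsto_expNuLam hu.1.le hr) (expNuLam_pos _ _ _).ne'

/-- The mass balance at r = 1 bounds ξ_ε²/E, hence ξ_ε² because E ≤ 1; the flux at r = 1 converges.
-/
lemma eventually_integral_xiReg_one_le : ∃ B, ∀ᶠ n in atTop,
    ∫ u in Ioo 0 u₀, xiReg c (ε n) (hε n u) 1 ^ 2 ≤ B := by
  refine ⟨(∫ u in Ioo 0 u₀, flux c (h u) 1) + 1 + C / Real.pi, ?_⟩
  filter_upwards [(hl.tendsto_integral_flux (u₀ := u₀) one_pos).eventually_le_const
    (lt_add_one _)] with n hn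
  have h1 := hl.integral_xiReg_sq_le hu₀ n one_pos
  have hπ := Real.pi_pos
  have h2 : min C ((1 + ε n) / 2) / Real.pi ≤ C / Real.pi :=
    div_le_div_of_nonneg_right (min_le_left _ _) hπ.le
  have h3 : ∫ u in Ioo 0 u₀, xiReg c (ε n) (hε n u) 1 ^ 2
      ≤ ∫ u in Ioo 0 u₀, xiReg c (ε n) (hε n u) 1 ^ 2 / expNuLam (ε n) (hε n u) 1 := by
    refine setIntegral_mono_on (integrable_of_cont
      (((hl.sol n).cont_xiReg_left (hl.eps_pos n) zero_le_one).pow 2) u₀)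
      (integrable_of_cont (hl.cont_xiReg_sq_div n one_pos) u₀) measurableSet_Ioo fun u hu => ?_
    have hE := expNuLam_pos (ε n) (hε n u) 1
    have hE1 := expNuLam_le_one (hl.eps_pos n).le (hε n u) zero_le_one
    rw [le_div_iff₀ hE]
    exact mul_le_of_le_one_right (sq_nonneg _) hE1
  linarith

omit hu₀ in
lemma memLp_xiTrunc {r : ℝ} (hr : 0 < r) :
    MemLp (fun u => xiTrunc c (h u) r 1) 2 (volume.restrict (Ioo 0 u₀)) := by
  obtain ⟨B, hB0, hB⟩ := hl.bound_xiReg_sub u₀ r r hr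
  refine MemLp.of_bound (aestronglyMeasurable_of_indicator
    (f := fun u r => xiTrunc c (h u) r 1) hl.measurable_xiTrunc hr) B
    ((ae_restrict_iff' measurableSet_Ioo).2 (Eventually.of_forall fun u hu => ?_))
  exact le_of_tendsto (hl.tendsto_xiReg_sub hu.1.le hr).abs
    (hB.mono fun n hn => hn u r hu.1.le hu.2.le le_rfl le_rfl)

omit hu₀ in
lemma memLp_xiReg (n : ℕ) {r : ℝ} (hr : 0 < r) :
    MemLp (fun u => xiReg c (ε n) (hε n u) r) 2 (volume.restrict (Ioo 0 u₀)) :=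
  memLp_of_continuousOn_Ici ((hl.sol n).cont_xiReg_left (hl.eps_pos n) hr.le) u₀

omit hu₀ in
lemma tendsto_integral_xiReg_sub_mul {r : ℝ} (hr : 0 < r) {ψ : ℝ → ℝ}
    (hψ : MemLp ψ 2 (volume.restrict (Ioo 0 u₀))) :
    Tendsto (fun n => ∫ u in Ioo 0 u₀, (xiReg c (ε n) (hε n u) r - xiReg c (ε n) (hε n u) 1) * ψ u)
      atTop (𝓝 (∫ u in Ioo 0 u₀, xiTrunc c (h u) r 1 * ψ u)) := by
  obtain ⟨B, hB0, hB⟩ := hl.bound_xiReg_sub u₀ r r hr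
  refine tendsto_integral_filter_of_dominated_convergence (fun u => B * |ψ u|)
    (Eventually.of_forall fun n => ?_) ?_ ((hψ.integrable one_le_two).abs.const_mul B) ?_
  · exact ((hl.memLp_xiReg n hr).1.sub (hl.memLp_xiReg n one_pos).1).mul hψ.1
  · filter_upwards [hB] with n hn
    refine (ae_restrict_iff' measurableSet_Ioo).2 (Eventually.of_forall fun u hu => ?_)
    rw [norm_mul, Real.norm_eq_abs, Real.norm_eq_abs]
    exact mul_le_mul_of_nonneg_right (hn u r hu.1.le hu.2.le le_rfl le_rfl) (abs_nonneg _)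
  · refine (ae_restrict_iff' measurableSet_Ioo).2 (Eventually.of_forall fun u hu => ?_)
    exact (hl.tendsto_xiReg_sub hu.1.le hr).mul_const _

variable {𝒰 : Ultrafilter ℕ} (h𝒰 : (𝒰 : Filter ℕ) ≤ atTop) {η : ℝ → ℝ}
  (hη : MemLp η 2 (volume.restrict (Ioo 0 u₀)))
  (hlim : ∀ ψ, MemLp ψ 2 (volume.restrict (Ioo 0 u₀)) →
    Tendsto (fun n => ∫ u in Ioo 0 u₀, xiReg c (ε n) (hε n u) 1 * ψ u) 𝒰
      (𝓝 (∫ u in Ioo 0 u₀, η u * ψ u)))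
include h𝒰 hη hlim

omit hu₀ in
lemma tendsto_integral_xiReg_mul {r : ℝ} (hr : 0 < r) {ψ : ℝ → ℝ}
    (hψ : MemLp ψ 2 (volume.restrict (Ioo 0 u₀))) :
    Tendsto (fun n => ∫ u in Ioo 0 u₀, xiReg c (ε n) (hε n u) r * ψ u) 𝒰
      (𝓝 (∫ u in Ioo 0 u₀, (η u + xiTrunc c (h u) r 1) * ψ u)) := by
  have h1 := (hlim ψ hψ).add ((hl.tendsto_integral_xiReg_sub_mul hr hψ).mono_left h𝒰)
  have h2 : ∫ u in Ioo 0 u₀, (η u + xiTrunc c (h u) r 1) * ψ u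
      = (∫ u in Ioo 0 u₀, η u * ψ u) + ∫ u in Ioo 0 u₀, xiTrunc c (h u) r 1 * ψ u := by
    have i1 : Integrable (fun u => η u * ψ u) (volume.restrict (Ioo 0 u₀)) := hη.integrable_mul hψ
    have i2 : Integrable (fun u => xiTrunc c (h u) r 1 * ψ u) (volume.restrict (Ioo 0 u₀)) :=
      (hl.memLp_xiTrunc hr).integrable_mul hψ
    rw [← integral_add i1 i2]
    simp only [add_mul]
  rw [h2]
  refine h1.congr fun n => ?_
  have i1 : Integrable (fun u => xiReg c (ε n) (hε n u) 1 * ψ u) (volume.restrict (Ioo 0 u₀)) :=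
    (hl.memLp_xiReg n one_pos).integrable_mul hψ
  have i2 : Integrable (fun u => (xiReg c (ε n) (hε n u) r - xiReg c (ε n) (hε n u) 1) * ψ u)
      (volume.restrict (Ioo 0 u₀)) :=
    ((hl.memLp_xiReg n hr).sub (hl.memLp_xiReg n one_pos)).integrable_mul hψ
  rw [← integral_add i1 i2]
  refine integral_congr_ae (Eventually.of_forall fun u => ?_)
  simp only
  ring

omit hu₀ h𝒰 hlim in
-- This makes the limit divided by E an admissible test function in the energy estimate.
lemma memLp_add_div {r : ℝ} (hr : 0 < r) :
    MemLp (fun u => (η u + xiTrunc c (h u) r 1) / expNuLam 0 (h u) r) 2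
      (volume.restrict (Ioo 0 u₀)) := by
  obtain ⟨e, he, hE⟩ := hl.exists_expNuLam_ge u₀ hr
  have h1 := hη.add (hl.memLp_xiTrunc hr)
  have hEm : AEStronglyMeasurable (fun u => expNuLam 0 (h u) r) (volume.restrict (Ioo 0 u₀)) :=
    aestronglyMeasurable_of_indicator (f := fun u r => expNuLam 0 (h u) r) hl.measurable_expNuLam hr
  refine (h1.const_mul e⁻¹).mono (h1.1.div₀ hEm) ((ae_restrict_iff' measurableSet_Ioo).2
    (Eventually.of_forall fun u hu => ?_))
  have h2 := hE u hu.1.le hu.2.le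
  simp only [Pi.add_apply, norm_mul, norm_div, Real.norm_eq_abs, abs_of_pos (inv_pos.2 he),
    abs_of_pos (expNuLam_pos 0 (h u) r)]
  rw [div_eq_inv_mul]
  gcongr

omit hu₀ h𝒰 hlim in
lemma integrable_energy {r : ℝ} (hr : 0 < r) :
    Integrable (fun u => energy c (η u) (h u) r) (volume.restrict (Ioo 0 u₀)) := by
  refine ((hη.add (hl.memLp_xiTrunc hr)).integrable_mul (hl.memLp_add_div hη hr)).congr
    (Eventually.of_forall fun u => ?_)
  simp only [Pi.mul_apply, Pi.add_apply, energy]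
  ring

/-- The energy estimate for the weak limit. -/
lemma integral_energy_le {r : ℝ} (hr : 0 < r) :
    ∫ u in Ioo 0 u₀, energy c (η u) (h u) r
      ≤ (∫ u in Ioo 0 u₀, flux c (h u) r) + min C (r / 2) / Real.pi := by
  -- Lower semicontinuity with a weight depending on n: test with ψ = y/E, where y is the weak
  -- limit, and use 2xψ ≤ x²/E_n + E_n ψ². In the limit this reads 2 ∫ y²/E ≤ (flux + mass term) + ∫
  -- y²/E.
  set ψ : ℝ → ℝ := fun u => (η u + xiTrunc c (h u) r 1) / expNuLam 0 (h u) r with hψd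
  have hψ : MemLp ψ 2 (volume.restrict (Ioo 0 u₀)) := hl.memLp_add_div hη hr
  have h1 := (hl.tendsto_integral_xiReg_mul h𝒰 hη hlim hr hψ).const_mul 2
  have h2 : Tendsto (fun n => ∫ u in Ioo 0 u₀, expNuLam (ε n) (hε n u) r * ψ u ^ 2) atTop
      (𝓝 (∫ u in Ioo 0 u₀, expNuLam 0 (h u) r * ψ u ^ 2)) := by
    refine tendsto_integral_filter_of_dominated_convergence (fun u => ψ u ^ 2)
      (Eventually.of_forall fun n => ?_) (Eventually.of_forall fun n => ?_) hψ.integrable_sq ?_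
    · exact (integrable_of_cont ((hl.sol n).cont_expNuLam_left hr.le) u₀).1.mul (hψ.1.pow 2)
    · refine Eventually.of_forall fun u => ?_
      rw [Real.norm_of_nonneg (mul_nonneg (expNuLam_pos _ _ _).le (sq_nonneg _))]
      exact mul_le_of_le_one_left (sq_nonneg _) (expNuLam_le_one (hl.eps_pos n).le _ hr.le)
    · refine (ae_restrict_iff' measurableSet_Ioo).2 (Eventually.of_forall fun u hu => ?_)
      exact (hl.tendsto_expNuLam hu.1.le hr).mul_const _
  have h3 : Tendsto (fun n => ((∫ u in Ioo 0 u₀, (gBar c (ε n) (hε n u) r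
      * (hε n u r - mean (ε n) (hε n u) r)) ^ 2 / expNuLam (ε n) (hε n u) r)
      + min C ((r + ε n) / 2) / Real.pi)
      + ∫ u in Ioo 0 u₀, expNuLam (ε n) (hε n u) r * ψ u ^ 2) 𝒰
      (𝓝 (((∫ u in Ioo 0 u₀, flux c (h u) r) + min C ((r + 0) / 2) / Real.pi)
        + ∫ u in Ioo 0 u₀, expNuLam 0 (h u) r * ψ u ^ 2)) :=
    (((hl.tendsto_integral_flux hr).add (((tendsto_const_nhds (x := C)).min
      ((hl.tendsto_rho r).div_const 2)).div_const _)).add h2).mono_left h𝒰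
  have h4 := le_of_tendsto_of_tendsto h1 h3 (Eventually.of_forall fun n => ?_)
  · rw [add_zero] at h4
    have e1 : ∫ u in Ioo 0 u₀, (η u + xiTrunc c (h u) r 1) * ψ u
        = ∫ u in Ioo 0 u₀, energy c (η u) (h u) r :=
      integral_congr_ae (Eventually.of_forall fun u => by simp only [hψd, energy]; ring)
    have e2 : ∫ u in Ioo 0 u₀, expNuLam 0 (h u) r * ψ u ^ 2
        = ∫ u in Ioo 0 u₀, energy c (η u) (h u) r :=
      integral_congr_ae (Eventually.of_forall fun u => by
        have := (expNuLam_pos 0 (h u) r).ne'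
        simp only [hψd, energy]; field_simp)
    rw [e1, e2] at h4
    linarith
  · have i1 := integrable_of_cont (hl.cont_xiReg_sq_div n hr) u₀
    have i2 : Integrable (fun u => expNuLam (ε n) (hε n u) r * ψ u ^ 2)
        (volume.restrict (Ioo 0 u₀)) := by
      refine hψ.integrable_sq.mono' ((integrable_of_cont
        ((hl.sol n).cont_expNuLam_left hr.le) u₀).1.mul (hψ.1.pow 2))
        (Eventually.of_forall fun u => ?_)
      rw [Real.norm_of_nonneg (mul_nonneg (expNuLam_pos _ _ _).le (sq_nonneg _))]
      exact mul_le_of_le_one_left (sq_nonneg _) (expNuLam_le_one (hl.eps_pos n).le _ hr.le)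
    refine le_trans ?_ (add_le_add_left (hl.integral_xiReg_sq_le hu₀ n hr) _)
    beta_reduce
    rw [← integral_add i1 i2, ← integral_const_mul]
    refine integral_mono (((hl.memLp_xiReg n hr).integrable_mul hψ).const_mul 2) (i1.add i2)
      fun u => ?_
    have hE := expNuLam_pos (ε n) (hε n u) r
    set x := xiReg c (ε n) (hε n u) r
    set E := expNuLam (ε n) (hε n u) r
    have : x ^ 2 / E + E * ψ u ^ 2 - 2 * (x * ψ u) = (x - E * ψ u) ^ 2 / E := by
      field_simp; ring
    have h5 : 0 ≤ (x - E * ψ u) ^ 2 / E := by positivity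
    change 2 * (x * ψ u) ≤ x ^ 2 / E + E * ψ u ^ 2
    linarith

omit h𝒰 hη hlim hu₀ in
lemma aemeasurable_energy (hηm : Measurable η) {s : Set ℝ} (hs : MeasurableSet s)
    (hs0 : s ⊆ Ioi 0) : AEMeasurable (fun p : ℝ × ℝ => energy c (η p.1) (h p.1) p.2)
      ((volume.restrict (Ioo 0 u₀)).prod (volume.restrict s)) := by
  have h1 := aemeasurable_prod_of_indicator (f := fun u r => xiTrunc c (h u) r 1)
    hl.measurable_xiTrunc u₀ hs hs0
  have h2 := aemeasurable_prod_of_indicator (f := fun u r => expNuLam 0 (h u) r)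
    hl.measurable_expNuLam u₀ hs hs0
  exact (((hηm.comp measurable_fst).aemeasurable.add h1).pow_const 2).div h2

omit h𝒰 hη hlim hu₀ in
lemma aemeasurable_flux {s : Set ℝ} (hs : MeasurableSet s) (hs0 : s ⊆ Ioi 0) :
    AEMeasurable (fun p : ℝ × ℝ => flux c (h p.1) p.2)
      ((volume.restrict (Ioo 0 u₀)).prod (volume.restrict s)) := by
  have h1 := aemeasurable_prod_of_indicator
    (f := fun u r => gBar c 0 (h u) r * (h u r - mean 0 (h u) r))
    hl.measurable_gBar_mul_dev u₀ hs hs0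
  have h2 := aemeasurable_prod_of_indicator (f := fun u r => expNuLam 0 (h u) r)
    hl.measurable_expNuLam u₀ hs hs0
  exact (h1.pow_const 2).div h2

omit h𝒰 hη hlim hu₀ in
lemma integrable_flux {r : ℝ} (hr : 0 < r) :
    Integrable (fun u => flux c (h u) r) (volume.restrict (Ioo 0 u₀)) := by
  obtain ⟨B, hB0, hB⟩ := hl.flux_bound (u₀ := u₀) hr
  have h1 := aestronglyMeasurable_of_indicator (u₀ := u₀)
    (f := fun u r => gBar c 0 (h u) r * (h u r - mean 0 (h u) r)) hl.measurable_gBar_mul_dev hr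
  have h2 := aestronglyMeasurable_of_indicator (u₀ := u₀)
    (f := fun u r => expNuLam 0 (h u) r) hl.measurable_expNuLam hr
  refine Integrable.of_bound ((h1.pow 2).div₀ h2) B ((ae_restrict_iff' measurableSet_Ioo).2
    (Eventually.of_forall fun u hu => ?_))
  refine le_of_tendsto (((((hl.tendsto_gBar hu.1.le hr).mul (hl.tendsto_dev hu.1.le hr)).pow 2).div
      (hl.tendsto_expNuLam hu.1.le hr) (expNuLam_pos _ _ _).ne').norm) (hB.mono fun n hn => ?_)
  rw [Pi.div_apply]
  rw [Real.norm_of_nonneg (div_nonneg (sq_nonneg _) (expNuLam_pos _ _ _).le)]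
  exact hn u hu.1.le hu.2.le

/-- The weighted space-time integral of the energy is finite. -/
lemma lintegral_energy_ne_top (hηm : Measurable η) :
    ∫⁻ u in Ioo 0 u₀, ∫⁻ s in Ioi 0,
      ENNReal.ofReal (weight s * (1 / s + c ^ 2) * energy c (η u) (h u) s) ≠ ⊤ := by
  have hπ := Real.pi_pos
  have hC := hl.C_nonneg
  have hw : Measurable fun p : ℝ × ℝ => weight p.2 * (1 / p.2 + c ^ 2) :=
    (continuous_weight.measurable.comp measurable_snd).mul
      ((measurable_const.div measurable_snd).add_const _)
  have m1 : AEMeasurable (Function.uncurry fun u s =>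
      ENNReal.ofReal (weight s * (1 / s + c ^ 2) * energy c (η u) (h u) s))
      ((volume.restrict (Ioo 0 u₀)).prod (volume.restrict (Ioi 0))) :=
    (hw.aemeasurable.mul (hl.aemeasurable_energy hηm measurableSet_Ioi subset_rfl)).ennreal_ofReal
  have m2 : AEMeasurable (Function.uncurry fun u s =>
      ENNReal.ofReal ((1 + c ^ 2) * (1 / s * flux c (h u) s)))
      ((volume.restrict (Ioo 0 u₀)).prod (volume.restrict (Ioi 0))) :=
    (((measurable_const.div measurable_snd).aemeasurable.mul
      (hl.aemeasurable_flux measurableSet_Ioi subset_rfl)).const_mul (1 + c ^ 2)).ennreal_ofReal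
  rw [lintegral_lintegral_swap m1]
  -- The mass term min(C, s/2)/π times 1/s is at most 1/(2π), and times c² at most c²C/π.
  set κ := (1 / 2 + c ^ 2 * C) / Real.pi with hκ
  have hκ0 : 0 ≤ κ := by positivity
  have hpt : ∀ s ∈ Ioi (0 : ℝ), ∫⁻ u in Ioo 0 u₀,
      ENNReal.ofReal (weight s * (1 / s + c ^ 2) * energy c (η u) (h u) s)
      ≤ (∫⁻ u in Ioo 0 u₀, ENNReal.ofReal ((1 + c ^ 2) * (1 / s * flux c (h u) s)))
        + ENNReal.ofReal (κ * weight s) := by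
    intro s hs
    have hs0 : 0 < s := hs
    have hw0 := weight_pos s
    have hα : 0 ≤ weight s * (1 / s + c ^ 2) := by positivity
    rw [← ofReal_integral_eq_lintegral_ofReal ((hl.integrable_energy hη hs0).const_mul _)
        (Eventually.of_forall fun u => mul_nonneg hα (energy_nonneg _ _ _ _)),
      ← ofReal_integral_eq_lintegral_ofReal (((hl.integrable_flux hs0).const_mul _).const_mul _)
        (Eventually.of_forall fun u => mul_nonneg (by positivity)
          (mul_nonneg (by positivity) (flux_nonneg _ _ _))),
      ← ENNReal.ofReal_add (integral_nonneg fun u => mul_nonneg (by positivity)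
          (mul_nonneg (by positivity) (flux_nonneg _ _ _))) (by positivity)]
    refine ENNReal.ofReal_le_ofReal ?_
    rw [integral_const_mul, integral_const_mul, integral_const_mul]
    have h1 := mul_le_mul_of_nonneg_left (hl.integral_energy_le hu₀ h𝒰 hη hlim hs0) hα
    have h2 : 0 ≤ ∫ u in Ioo 0 u₀, flux c (h u) s := integral_nonneg fun u => flux_nonneg _ _ _
    have h3 := mul_le_mul_of_nonneg_right (weight_mul_le hs0 c) h2
    have h4 : weight s * (1 / s + c ^ 2) * (min C (s / 2) / Real.pi) ≤ κ * weight s := by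
      have h5 : 1 / s * min C (s / 2) ≤ 1 / 2 := by
        refine (mul_le_mul_of_nonneg_left (min_le_right _ _) (by positivity)).trans_eq ?_
        field_simp
      have h6 : c ^ 2 * min C (s / 2) ≤ c ^ 2 * C :=
        mul_le_mul_of_nonneg_left (min_le_left _ _) (sq_nonneg c)
      calc _ = weight s * ((1 / s * min C (s / 2) + c ^ 2 * min C (s / 2)) / Real.pi) := by ring
        _ ≤ weight s * ((1 / 2 + c ^ 2 * C) / Real.pi) := by gcongr
        _ = κ * weight s := by rw [hκ]; ring
    linarith
  have m3 : Measurable fun s => ENNReal.ofReal (κ * weight s) :=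
    (continuous_weight.measurable.const_mul κ).ennreal_ofReal
  refine ne_top_of_le_ne_top ?_ (setLIntegral_mono' measurableSet_Ioi hpt)
  rw [lintegral_add_right _ m3]
  refine ENNReal.add_ne_top.2 ⟨?_, ?_⟩
  · rw [← lintegral_lintegral_swap m2]
    have h1 : ∀ u ∈ Ioo 0 u₀, ∫⁻ s in Ioi 0, ENNReal.ofReal ((1 + c ^ 2) * (1 / s * flux c (h u) s))
        ≤ ENNReal.ofReal (1 + c ^ 2) * ENNReal.ofReal (1 / (4 * Real.pi)) := by
      intro u hu
      have h2 : ∀ s, ENNReal.ofReal ((1 + c ^ 2) * (1 / s * flux c (h u) s))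
          = ENNReal.ofReal (1 + c ^ 2) * ENNReal.ofReal (1 / s * flux c (h u) s) :=
        fun s => ENNReal.ofReal_mul (by positivity)
      simp only [h2]
      rw [lintegral_const_mul' _ _ ENNReal.ofReal_ne_top]
      gcongr
      exact (hl.isProfile hu.1.le).lintegral_flux_le fun r hr => hl.wCoef_nonneg hu.1.le hr
    refine ne_top_of_le_ne_top ?_ (setLIntegral_mono' measurableSet_Ioo h1)
    rw [setLIntegral_const]
    exact ENNReal.mul_ne_top (ENNReal.mul_ne_top ENNReal.ofReal_ne_top ENNReal.ofReal_ne_top)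
      (by simp)
  · exact (integrableOn_weight.const_mul κ).lintegral_lt_top.ne

end IsBoundedLimit

/-! ### Identification of the weak limit with ξ, and its properties -/

lemma abs_div_sqrt_eq (x : ℝ) {E : ℝ} (hE : 0 < E) : |x / √E| = √(x ^ 2 / E) := by
  rw [Real.sqrt_div' _ hE.le, Real.sqrt_sq_eq_abs, abs_div, abs_of_pos (Real.sqrt_pos.2 hE)]

lemma sq_div_max_mul_sqrt (x r : ℝ) {E : ℝ} (hE : 0 < E) :
    (x / (max 1 r * √E)) ^ 2 = weight r * (x ^ 2 / E) := by
  rw [div_pow, mul_pow, Real.sq_sqrt hE.le, weight]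
  field_simp

namespace IsBoundedLimit

variable {c C : ℝ} {h₀ : ℝ → ℝ} {ε : ℕ → ℝ} {hε : ℕ → ℝ → ℝ → ℝ} {h : ℝ → ℝ → ℝ}
  (hl : IsBoundedLimit c C h₀ ε hε h)
include hl

/-- Along every ultrafilter, the values at `r = 1` of the regularized functions have a weak limit,
which is the value of `ξ` at `r = 1`; and the resulting function has finite energy on almost every
cone. -/
theorem exists_weak_limit_xi {u₀ : ℝ} (hu₀ : 0 < u₀) {𝒰 : Ultrafilter ℕ}
    (h𝒰 : (𝒰 : Filter ℕ) ≤ atTop) : ∃ η Φ : ℝ → ℝ,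
      MemLp η 2 (volume.restrict (Ioo 0 u₀)) ∧ Integrable Φ (volume.restrict (Ioo 0 u₀)) ∧
      (∀ ψ, MemLp ψ 2 (volume.restrict (Ioo 0 u₀)) →
        Tendsto (fun n => ∫ u in Ioo 0 u₀, xiReg c (ε n) (hε n u) 1 * ψ u) 𝒰
          (𝓝 (∫ u in Ioo 0 u₀, η u * ψ u))) ∧
      ∀ᵐ u ∂(volume.restrict (Ioo 0 u₀)), 0 ≤ u ∧
        (∀ r, 0 < r → xi c (h u) r = η u + xiTrunc c (h u) r 1) ∧
        (∀ r, 0 < r → Tendsto (xiTrunc c (h u) r) (𝓝[>] 0) (𝓝 (xi c (h u) r))) ∧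
        (∀ r, 0 < r → weight r * (xi c (h u) r ^ 2 / expNuLam 0 (h u) r) ≤ Φ u) ∧
        Tendsto (fun r => xi c (h u) r ^ 2 / expNuLam 0 (h u) r) (𝓝[>] 0) (𝓝 0) := by
  obtain ⟨B, hB⟩ := hl.eventually_integral_xiReg_one_le hu₀
  obtain ⟨η, hηm, hη, hlim⟩ := exists_weak_limit (fun n => hl.memLp_xiReg n one_pos) 𝒰
    (hB.filter_mono h𝒰)
  have hw : Measurable fun p : ℝ × ℝ => weight p.2 * (1 / p.2 + c ^ 2) :=
    (continuous_weight.measurable.comp measurable_snd).mul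
      ((measurable_const.div measurable_snd).add_const _)
  have hm : AEMeasurable (fun u => ∫⁻ s in Ioi 0,
      ENNReal.ofReal (weight s * (1 / s + c ^ 2) * energy c (η u) (h u) s))
      (volume.restrict (Ioo 0 u₀)) :=
    ((hw.aemeasurable.mul (hl.aemeasurable_energy hηm measurableSet_Ioi
      subset_rfl)).ennreal_ofReal).lintegral_prod_right'
  have htop := hl.lintegral_energy_ne_top hu₀ h𝒰 hη hlim hηm
  refine ⟨η, _, hη, (integrable_toReal_of_lintegral_ne_top hm htop).add (integrable_const
    (1 / (4 * Real.pi) + C / (2 * Real.pi))), hlim, ?_⟩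
  -- Finiteness of the space-time integral gives finite weighted energy on almost every cone; on
  -- such a cone the rest is the one-dimensional analysis above.
  filter_upwards [ae_lt_top' hm htop, ae_restrict_mem measurableSet_Ioo] with u hfin hu
  have hp := hl.isProfile hu.1.le
  have hw : ∀ r, 0 < r → 0 ≤ wCoef c 0 (h u) r := fun r hr => hl.wCoef_nonneg hu.1.le hr
  have hM : ∀ r, 0 < r → hawkingMass c 0 (h u) r ≤ C := fun r hr => hl.hawkingMass_le hu.1.le hr
  have hxi : ∀ r, 0 < r → xi c (h u) r = η u + xiTrunc c (h u) r 1 := fun r hr =>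
    hp.xi_eq hw hM hfin.ne hr
  refine ⟨hu.1.le, hxi, fun r hr => ?_, fun r hr => ?_, ?_⟩
  · rw [hxi r hr]
    exact hp.tendsto_xiTrunc hw hM hfin.ne hr
  · rw [hxi r hr]
    exact hp.weight_mul_energy_le hw hM hfin.ne hr
  · refine (hp.tendsto_energy hw hM hfin.ne).congr' ?_
    filter_upwards [self_mem_nhdsWithin] with r hr
    rw [hxi r hr, energy]

lemma continuousOn_xi {u e : ℝ} (hu : 0 ≤ u)
    (hxi : ∀ r, 0 < r → xi c (h u) r = e + xiTrunc c (h u) r 1) :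
    ContinuousOn (xi c (h u)) (Ioi 0) :=
  (continuousOn_const.add (hl.isProfile hu).cont_xiTrunc).congr hxi

lemma continuousOn_xi_div {u e : ℝ} (hu : 0 ≤ u)
    (hxi : ∀ r, 0 < r → xi c (h u) r = e + xiTrunc c (h u) r 1) :
    ContinuousOn (fun r => xi c (h u) r / √(expNuLam 0 (h u) r)) (Ioi 0) :=
  (hl.continuousOn_xi hu hxi).div (hl.isProfile hu).cont_expNuLam.sqrt
    fun _ _ => (Real.sqrt_pos.2 (expNuLam_pos _ _ _)).ne'

theorem ae_tendsto_and_continuousOn : ∀ᵐ u ∂(volume.restrict (Ici (0 : ℝ))),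
    (∀ r, 0 < r → Tendsto (xiTrunc c (h u) r) (𝓝[>] 0) (𝓝 (xi c (h u) r))) ∧
    ContinuousOn (fun r => xi c (h u) r / √(expNuLam 0 (h u) r)) (Ioi 0) ∧
    Tendsto (fun r => xi c (h u) r / √(expNuLam 0 (h u) r)) (𝓝[>] 0) (𝓝 0) := by
  have hU : Ioi (0 : ℝ) = ⋃ n : ℕ, Ioo 0 ((n : ℝ) + 1) := by
    ext x
    simp only [mem_Ioi, mem_iUnion, mem_Ioo]
    refine ⟨fun hx => ?_, fun ⟨_, hx⟩ => hx.1⟩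
    obtain ⟨n, hn⟩ := exists_nat_gt x
    exact ⟨n, hx, hn.trans (lt_add_one _)⟩
  -- The cone u = 0 is a null set, and the half-line is exhausted by countably many bounded
  -- intervals, on each of which the weak limit is available.
  have hμ : volume.restrict (Ici (0 : ℝ)) = volume.restrict (⋃ n : ℕ, Ioo 0 ((n : ℝ) + 1)) := by
    rw [← hU, Measure.restrict_congr_set Ioi_ae_eq_Ici]
  rw [hμ, ae_restrict_iUnion_iff]
  intro n
  obtain ⟨η, Φ, -, -, -, hae⟩ := hl.exists_weak_limit_xi (u₀ := (n : ℝ) + 1) (by positivity)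
    Nat.hyperfilter_le_atTop
  filter_upwards [hae] with u hgood
  obtain ⟨hu, hxi, ht, -, h0⟩ := hgood
  refine ⟨ht, hl.continuousOn_xi_div hu hxi, ?_⟩
  rw [tendsto_zero_iff_abs_tendsto_zero]
  have h1 := h0.sqrt
  rw [Real.sqrt_zero] at h1
  exact h1.congr fun r => (abs_div_sqrt_eq _ (expNuLam_pos _ _ _)).symm

variable {u₀ : ℝ} (hu₀ : 0 < u₀)
include hu₀

lemma aestronglyMeasurable_xi {r : ℝ} (hr : 0 < r) :
    AEStronglyMeasurable (fun u => xi c (h u) r) (volume.restrict (Ioo 0 u₀)) := by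
  obtain ⟨η, Φ, hη, -, -, hae⟩ := hl.exists_weak_limit_xi hu₀ Nat.hyperfilter_le_atTop
  refine (hη.1.add (hl.memLp_xiTrunc hr).1).congr ?_
  filter_upwards [hae] with u hu using (hu.2.1 r hr).symm

omit hu₀ in
lemma aestronglyMeasurable_expNuLam {r : ℝ} (hr : 0 < r) :
    AEStronglyMeasurable (fun u => expNuLam 0 (h u) r) (volume.restrict (Ioo 0 u₀)) :=
  aestronglyMeasurable_of_indicator (f := fun u r => expNuLam 0 (h u) r) hl.measurable_expNuLam hr

omit hu₀ in
lemma aestronglyMeasurable_sqrt_expNuLam {r : ℝ} (hr : 0 < r) :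
    AEStronglyMeasurable (fun u => √(expNuLam 0 (h u) r)) (volume.restrict (Ioo 0 u₀)) :=
  Real.continuous_sqrt.comp_aestronglyMeasurable (hl.aestronglyMeasurable_expNuLam hr)

theorem memLp_xi_div {r : ℝ} (hr : 0 < r) :
    MemLp (fun u => xi c (h u) r / √(expNuLam 0 (h u) r)) 2 (volume.restrict (Ioo 0 u₀)) := by
  obtain ⟨η, Φ, hη, -, -, hae⟩ := hl.exists_weak_limit_xi hu₀ Nat.hyperfilter_le_atTop
  refine (memLp_two_iff_integrable_sq ((hl.aestronglyMeasurable_xi hu₀ hr).div₀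
    (hl.aestronglyMeasurable_sqrt_expNuLam hr))).2 ((hl.integrable_energy hη hr).congr ?_)
  filter_upwards [hae] with u hu
  rw [Pi.div_apply, hu.2.1 r hr, div_pow, Real.sq_sqrt (expNuLam_pos _ _ _).le, energy]

/-- A real supremum over an unbounded family has the default value 0, so boundedness is asserted
separately. The square of each quotient is at most the integrable function Φ(u). -/
theorem memLp_iSup :
    (∀ᵐ u ∂(volume.restrict (Ioo 0 u₀)), BddAbove (range fun r : Ioi (0 : ℝ) =>
        |xi c (h u) r / (max 1 (r : ℝ) * √(expNuLam 0 (h u) r))|)) ∧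
      MemLp (fun u => ⨆ r : Ioi (0 : ℝ),
        |xi c (h u) r / (max 1 (r : ℝ) * √(expNuLam 0 (h u) r))|) 2
        (volume.restrict (Ioo 0 u₀)) := by
  obtain ⟨η, Φ, hη, hΦ, -, hae⟩ := hl.exists_weak_limit_xi hu₀ Nat.hyperfilter_le_atTop
  set F : ℝ → Ioi (0 : ℝ) → ℝ := fun u r =>
    |xi c (h u) r / (max 1 (r : ℝ) * √(expNuLam 0 (h u) r))| with hF
  have hle : ∀ᵐ u ∂(volume.restrict (Ioo 0 u₀)), ∀ r, F u r ≤ √(Φ u) := by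
    filter_upwards [hae] with u hu r
    refine Real.abs_le_sqrt ?_
    rw [sq_div_max_mul_sqrt _ _ (expNuLam_pos _ _ _)]
    exact hu.2.2.2.1 r r.2
  have hbdd : ∀ᵐ u ∂(volume.restrict (Ioo 0 u₀)), BddAbove (range (F u)) := by
    filter_upwards [hle] with u hu using ⟨_, forall_mem_range.2 hu⟩
  refine ⟨hbdd, ?_⟩
  have : Nonempty (Ioi (0 : ℝ)) := ⟨⟨1, mem_Ioi.2 one_pos⟩⟩
  have hFm : ∀ r, AEStronglyMeasurable (fun u => F u r) (volume.restrict (Ioo 0 u₀)) := fun r =>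
    ((hl.aestronglyMeasurable_xi hu₀ r.2).div₀
      ((hl.aestronglyMeasurable_sqrt_expNuLam r.2).const_mul (max 1 (r : ℝ)))).norm
  -- Continuity in r for almost every u reduces the uncountable supremum to one over a countable
  -- dense set of radii.
  have hmeas : AEMeasurable (fun u => ⨆ r, F u r) (volume.restrict (Ioo 0 u₀)) := by
    refine AEMeasurable.isLUB (f := fun n u => F u (TopologicalSpace.denseSeq (Ioi (0 : ℝ)) n))
      (fun n => (hFm _).aemeasurable) ?_
    filter_upwards [hae, hbdd] with u hu hb
    refine ⟨?_, fun y hy => ciSup_le fun r => ?_⟩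
    · rintro _ ⟨n, rfl⟩
      exact le_ciSup hb _
    · have hcont : Continuous (F u) := by
        have h1 := continuousOn_iff_continuous_domRestrict.1 (hl.continuousOn_xi_div hu.1 hu.2.1)
        have h2 : Continuous fun r : Ioi (0 : ℝ) => max 1 (r : ℝ) := by fun_prop
        refine ((h1.div h2 fun r => ?_).abs).congr fun r => ?_
        · have : (0 : ℝ) < max 1 (r : ℝ) := one_pos.trans_le (le_max_left _ _)
          exact this.ne'
        · simp only [hF, domRestrict_apply, Pi.div_apply, div_div]
          rw [mul_comm]
      refine (TopologicalSpace.denseRange_denseSeq (Ioi (0 : ℝ))).induction_on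
        (p := fun r => F u r ≤ y) r (isClosed_le hcont continuous_const) fun n => hy ⟨n, rfl⟩
  refine (memLp_two_iff_integrable_sq hmeas.aestronglyMeasurable).2
    (hΦ.abs.mono' (hmeas.pow_const 2).aestronglyMeasurable ?_)
  filter_upwards [hle, hae] with u hu hu'
  have h0 : 0 ≤ Φ u := (mul_nonneg (weight_pos 1).le
    (div_nonneg (sq_nonneg _) (expNuLam_pos _ _ _).le)).trans (hu'.2.2.2.1 1 one_pos)
  have h1 : 0 ≤ ⨆ r, F u r := Real.iSup_nonneg fun r => abs_nonneg _
  rw [Real.norm_of_nonneg (sq_nonneg _), abs_of_nonneg h0, ← Real.le_sqrt h1 h0]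
  exact ciSup_le hu

/-- Dominated convergence: the integrand tends to 0 on almost every cone, and for r ≤ 1, where the
weight is 1, it is bounded by Φ. -/
theorem tendsto_integral_xi_sq_div :
    Tendsto (fun r => ∫ u in (0 : ℝ)..u₀, xi c (h u) r ^ 2 / expNuLam 0 (h u) r)
      (𝓝[>] 0) (𝓝 0) := by
  obtain ⟨η, Φ, hη, hΦ, -, hae⟩ := hl.exists_weak_limit_xi hu₀ Nat.hyperfilter_le_atTop
  simp only [intervalIntegral.integral_of_le hu₀.le, integral_Ioc_eq_integral_Ioo]
  suffices Tendsto (fun r => ∫ u in Ioo 0 u₀, xi c (h u) r ^ 2 / expNuLam 0 (h u) r) (𝓝[>] 0)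
      (𝓝 (∫ _ in Ioo 0 u₀, (0 : ℝ))) by rwa [integral_zero] at this
  refine tendsto_integral_filter_of_dominated_convergence Φ ?_ ?_ hΦ ?_
  · filter_upwards [self_mem_nhdsWithin] with r hr
    exact ((hl.aestronglyMeasurable_xi hu₀ hr).pow 2).div₀ (hl.aestronglyMeasurable_expNuLam hr)
  · filter_upwards [Ioo_mem_nhdsGT one_pos] with r hr
    filter_upwards [hae] with u hu
    rw [Real.norm_of_nonneg (div_nonneg (sq_nonneg _) (expNuLam_pos _ _ _).le)]
    have h1 := hu.2.2.2.1 r hr.1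
    rwa [weight_of_le_one hr.2.le, one_mul] at h1
  · filter_upwards [hae] with u hu using hu.2.2.2.2

end IsBoundedLimit

/-! ### Testing against compactly supported functions -/

/-- A compact subset of the domain may touch u = 0 but not r = 0, hence the half-open interval in u.
The null line u = 0 is then removed to match the interval on which weak limits are taken. -/
lemma setIntegral_domain_eq {φ : ℝ × ℝ → ℝ} {u₀ a b : ℝ} (ha : 0 < a)
    (hφ : Function.support φ ⊆ Ico 0 u₀ ×ˢ Icc a b) (F : ℝ × ℝ → ℝ) :
    ∫ p in domain, F p * φ p
      = ∫ p, F p * φ p ∂((volume.restrict (Ioo 0 u₀)).prod (volume.restrict (Icc a b))) := by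
  rw [Measure.restrict_congr_set (Ioo_ae_eq_Ico (μ := volume)), Measure.prod_restrict,
    ← Measure.volume_eq_prod]
  refine setIntegral_eq_of_subset_of_forall_sdiff_eq_zero measurableSet_domain
    (fun p hp => ⟨hp.1.1, ha.trans_le hp.2.1⟩) fun p hp => ?_
  rw [Function.notMem_support.1 fun hs => hp.2 (hφ hs), mul_zero]

lemma integrableOn_domain {φ : ℝ × ℝ → ℝ} {u₀ a b : ℝ}
    (hφ : Function.support φ ⊆ Ico 0 u₀ ×ˢ Icc a b) {F : ℝ × ℝ → ℝ}
    (hF : Integrable (fun p => F p * φ p)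
      ((volume.restrict (Ioo 0 u₀)).prod (volume.restrict (Icc a b)))) :
    IntegrableOn (fun p => F p * φ p) domain := by
  rw [Measure.restrict_congr_set (Ioo_ae_eq_Ico (μ := volume)), Measure.prod_restrict,
    ← Measure.volume_eq_prod] at hF
  refine IntegrableOn.of_forall_sdiff_eq_zero hF measurableSet_domain fun p hp => ?_
  rw [Function.notMem_support.1 fun hs => hp.2 (hφ hs), mul_zero]

lemma exists_support_subset_rect {φ : ℝ × ℝ → ℝ} (hφ : HasCompactSupport φ)
    (hd : tsupport φ ⊆ domain) : ∃ u₀ a b : ℝ, 0 < u₀ ∧ 0 < a ∧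
      Function.support φ ⊆ Ico 0 u₀ ×ˢ Icc a b := by
  obtain ⟨a, ha, haK⟩ := hφ.isCompact.exists_forall_le' (f := Prod.snd) continuousOn_snd
    (a := 0) fun p hp => (hd hp).2
  obtain ⟨B, hB⟩ := hφ.isCompact.exists_bound_of_continuousOn continuousOn_id
  refine ⟨|B| + 1, a, B, by positivity, ha, fun p hp => ?_⟩
  have hp' := subset_tsupport φ hp
  have h1 := hB p hp'
  have h2 : p.1 ≤ B := (le_abs_self _).trans ((norm_fst_le p).trans h1)
  have h3 : p.2 ≤ B := (le_abs_self _).trans ((norm_snd_le p).trans h1)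
  exact ⟨⟨(hd hp').1, (h2.trans (le_abs_self B)).trans_lt (lt_add_one _)⟩, haK p hp', h3⟩

section Fubini

variable {u₀ a b : ℝ} {φ : ℝ × ℝ → ℝ} (hφ : Continuous φ) {B : ℝ} (hB : ∀ p, |φ p| ≤ B)
include hφ hB

lemma integrable_fst_mul {X : ℝ → ℝ} (hX : Integrable X (volume.restrict (Ioo 0 u₀))) :
    Integrable (fun p : ℝ × ℝ => X p.1 * φ p)
      ((volume.restrict (Ioo 0 u₀)).prod (volume.restrict (Icc a b))) :=
  (hX.comp_fst _).mul_bdd hφ.aestronglyMeasurable (Eventually.of_forall hB)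

lemma integral_fst_mul {X : ℝ → ℝ} (hX : Integrable X (volume.restrict (Ioo 0 u₀))) :
    ∫ p : ℝ × ℝ, X p.1 * φ p ∂((volume.restrict (Ioo 0 u₀)).prod (volume.restrict (Icc a b)))
      = ∫ u in Ioo 0 u₀, X u * ∫ r in Icc a b, φ (u, r) := by
  rw [integral_prod _ (integrable_fst_mul hφ hB hX)]
  simp only [integral_const_mul]

lemma memLp_integral_right :
    MemLp (fun u => ∫ r in Icc a b, φ (u, r)) 2 (volume.restrict (Ioo 0 u₀)) := by
  refine MemLp.of_bound (hφ.aestronglyMeasurable (μ := (volume.restrict (Ioo 0 u₀)).prod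
    (volume.restrict (Icc a b)))).integral_prod_right' (B * volume.real (Icc a b))
    (Eventually.of_forall fun u => ?_)
  exact norm_setIntegral_le_of_norm_le_const (by simp) fun r _ => hB (u, r)

end Fubini

namespace IsBoundedLimit

variable {c C : ℝ} {h₀ : ℝ → ℝ} {ε : ℕ → ℝ} {hε : ℕ → ℝ → ℝ → ℝ} {h : ℝ → ℝ → ℝ}
  (hl : IsBoundedLimit c C h₀ ε hε h)
include hl

section Rect

variable {u₀ a b : ℝ} (ha : 0 < a) {φ : ℝ × ℝ → ℝ} (hφ : Continuous φ) {B : ℝ}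
  (hB : ∀ p, |φ p| ≤ B)
include ha hφ hB

lemma integrable_xiTrunc_mul : Integrable (fun p : ℝ × ℝ => xiTrunc c (h p.1) p.2 1 * φ p)
    ((volume.restrict (Ioo 0 u₀)).prod (volume.restrict (Icc a b))) := by
  obtain ⟨D, hD0, hD⟩ := hl.bound_xiReg_sub u₀ a b ha
  have hm := aemeasurable_prod_of_indicator (f := fun u r => xiTrunc c (h u) r 1)
    hl.measurable_xiTrunc u₀ (measurableSet_Icc (a := a) (b := b)) fun r hr => ha.trans_le hr.1
  refine Integrable.mul_bdd (c := B) (Integrable.of_bound hm.aestronglyMeasurable D ?_)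
    hφ.aestronglyMeasurable (Eventually.of_forall hB)
  rw [Measure.prod_restrict]
  filter_upwards [ae_restrict_mem (measurableSet_Ioo.prod measurableSet_Icc)] with p hp
  exact le_of_tendsto (hl.tendsto_xiReg_sub hp.1.1.le (ha.trans_le hp.2.1)).abs
    (hD.mono fun n hn => hn p.1 p.2 hp.1.1.le hp.1.2.le hp.2.1 hp.2.2)

omit hB in
lemma integrable_xiReg_sub_mul (n : ℕ) : Integrable (fun p : ℝ × ℝ =>
      (xiReg c (ε n) (hε n p.1) p.2 - xiReg c (ε n) (hε n p.1) 1) * φ p)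
    ((volume.restrict (Ioo 0 u₀)).prod (volume.restrict (Icc a b))) := by
  rw [Measure.prod_restrict, ← Measure.volume_eq_prod]
  have h1 : ContinuousOn (fun p : ℝ × ℝ =>
      (xiReg c (ε n) (hε n p.1) p.2 - xiReg c (ε n) (hε n p.1) 1) * φ p) domain :=
    ((hl.cont_domain_xiReg n).sub (hl.cont_domain_xiReg_one n)).mul hφ.continuousOn
  exact IntegrableOn.mono_set ((h1.mono (rect_subset_domain (u₀ := u₀) (b := b) ha)).integrableOn_compact
    (isCompact_Icc.prod isCompact_Icc)) (prod_mono Ioo_subset_Icc_self subset_rfl)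

lemma tendsto_integral_prod_xiReg_sub_mul : Tendsto (fun n => ∫ p : ℝ × ℝ,
      (xiReg c (ε n) (hε n p.1) p.2 - xiReg c (ε n) (hε n p.1) 1) * φ p
        ∂((volume.restrict (Ioo 0 u₀)).prod (volume.restrict (Icc a b)))) atTop
    (𝓝 (∫ p : ℝ × ℝ, xiTrunc c (h p.1) p.2 1 * φ p
        ∂((volume.restrict (Ioo 0 u₀)).prod (volume.restrict (Icc a b))))) := by
  obtain ⟨D, hD0, hD⟩ := hl.bound_xiReg_sub u₀ a b ha
  have hmem : ∀ᵐ p : ℝ × ℝ ∂((volume.restrict (Ioo 0 u₀)).prod (volume.restrict (Icc a b))),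
      p ∈ Ioo 0 u₀ ×ˢ Icc a b := by
    rw [Measure.prod_restrict]
    exact ae_restrict_mem (measurableSet_Ioo.prod measurableSet_Icc)
  refine tendsto_integral_filter_of_dominated_convergence (fun _ => D * B)
    (Eventually.of_forall fun n => (hl.integrable_xiReg_sub_mul ha hφ n).1) ?_
    (integrable_const _) ?_
  · filter_upwards [hD] with n hn
    filter_upwards [hmem] with p hp
    rw [norm_mul]
    exact mul_le_mul (hn p.1 p.2 hp.1.1.le hp.1.2.le hp.2.1 hp.2.2) (hB p) (abs_nonneg _) hD0
  · filter_upwards [hmem] with p hp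
    exact (hl.tendsto_xiReg_sub hp.1.1.le (ha.trans_le hp.2.1)).mul_const _

lemma tendsto_integral_prod_xiReg_mul (hu₀ : 0 < u₀) :
    Integrable (fun p : ℝ × ℝ => xi c (h p.1) p.2 * φ p)
      ((volume.restrict (Ioo 0 u₀)).prod (volume.restrict (Icc a b))) ∧
    Tendsto (fun n => ∫ p : ℝ × ℝ, xiReg c (ε n) (hε n p.1) p.2 * φ p
        ∂((volume.restrict (Ioo 0 u₀)).prod (volume.restrict (Icc a b)))) atTop
      (𝓝 (∫ p : ℝ × ℝ, xi c (h p.1) p.2 * φ p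
        ∂((volume.restrict (Ioo 0 u₀)).prod (volume.restrict (Icc a b))))) := by
  -- Convergence is tested along every ultrafilter finer than `atTop`. The weak limit η may a priori
  -- depend on the ultrafilter, but the limit of the integrals is expressed through ξ and does not.
  have key : ∀ 𝒰 : Ultrafilter ℕ, (𝒰 : Filter ℕ) ≤ atTop →
      Integrable (fun p : ℝ × ℝ => xi c (h p.1) p.2 * φ p)
        ((volume.restrict (Ioo 0 u₀)).prod (volume.restrict (Icc a b))) ∧
      Tendsto (fun n => ∫ p : ℝ × ℝ, xiReg c (ε n) (hε n p.1) p.2 * φ p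
          ∂((volume.restrict (Ioo 0 u₀)).prod (volume.restrict (Icc a b)))) 𝒰
        (𝓝 (∫ p : ℝ × ℝ, xi c (h p.1) p.2 * φ p
          ∂((volume.restrict (Ioo 0 u₀)).prod (volume.restrict (Icc a b))))) := by
    intro 𝒰 h𝒰
    obtain ⟨η, Φ, hη, -, hlim, hae⟩ := hl.exists_weak_limit_xi hu₀ h𝒰
    have hη1 := hη.integrable one_le_two
    have i1 := integrable_fst_mul (a := a) (b := b) hφ hB hη1
    have i2 := hl.integrable_xiTrunc_mul (u₀ := u₀) (b := b) ha hφ hB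
    have hmem : ∀ᵐ p : ℝ × ℝ ∂((volume.restrict (Ioo 0 u₀)).prod (volume.restrict (Icc a b))),
        p ∈ Ioo 0 u₀ ×ˢ Icc a b := by
      rw [Measure.prod_restrict]
      exact ae_restrict_mem (measurableSet_Ioo.prod measurableSet_Icc)
    have hxi : (fun p : ℝ × ℝ => η p.1 * φ p + xiTrunc c (h p.1) p.2 1 * φ p)
        =ᵐ[(volume.restrict (Ioo 0 u₀)).prod (volume.restrict (Icc a b))]
        fun p => xi c (h p.1) p.2 * φ p := by
      filter_upwards [hmem, Measure.quasiMeasurePreserving_fst.ae hae] with p hp hu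
      rw [hu.2.1 p.2 (ha.trans_le hp.2.1), add_mul]
    refine ⟨(i1.add i2).congr hxi, ?_⟩
    rw [← integral_congr_ae hxi, integral_add i1 i2, integral_fst_mul hφ hB hη1]
    -- By Fubini the part depending on u alone is tested with u ↦ ∫ φ(u, r) dr, which is in L²; the
    -- difference from the value at r = 1 converges by domination.
    refine ((hlim _ (memLp_integral_right hφ hB)).add
      ((hl.tendsto_integral_prod_xiReg_sub_mul ha hφ hB).mono_left h𝒰)).congr fun n => ?_
    have hX := (hl.memLp_xiReg (u₀ := u₀) n one_pos).integrable one_le_two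
    rw [← integral_fst_mul hφ hB hX, ← integral_add (integrable_fst_mul hφ hB hX)
      (hl.integrable_xiReg_sub_mul ha hφ n)]
    refine integral_congr_ae (Eventually.of_forall fun p => ?_)
    simp only
    ring
  exact ⟨(key _ Nat.hyperfilter_le_atTop).1,
    (tendsto_iff_ultrafilter _ _ _).2 fun 𝒰 h𝒰 => (key 𝒰 h𝒰).2⟩

end Rect

theorem tendsto_integral_domain {φ : ℝ × ℝ → ℝ} (hφ : Continuous φ) (hs : HasCompactSupport φ)
    (hd : tsupport φ ⊆ domain) :
    IntegrableOn (fun p : ℝ × ℝ => xi c (h p.1) p.2 * φ p) domain ∧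
      Tendsto (fun n => ∫ p in domain, xiReg c (ε n) (hε n p.1) p.2 * φ p) atTop
        (𝓝 (∫ p in domain, xi c (h p.1) p.2 * φ p)) := by
  obtain ⟨u₀, a, b, hu₀, ha, hsub⟩ := exists_support_subset_rect hs hd
  obtain ⟨B, hB⟩ := hs.exists_bound_of_continuous hφ
  obtain ⟨h1, h2⟩ := hl.tendsto_integral_prod_xiReg_mul ha hφ hB hu₀ (b := b)
  refine ⟨integrableOn_domain hsub h1, ?_⟩
  rw [setIntegral_domain_eq ha hsub fun p => xi c (h p.1) p.2]
  exact h2.congr fun n =>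
    (setIntegral_domain_eq ha hsub fun p => xiReg c (ε n) (hε n p.1) p.2).symm

end IsBoundedLimit

end

end EKG

theorem proposition7p2 (c : ℝ) (h₀ : ℝ → ℝ) (hdata : EKG.InitialData c h₀)
    (ε : ℕ → ℝ) (hε : ℕ → ℝ → ℝ → ℝ) (h : ℝ → ℝ → ℝ)
    (hlim : EKG.IsLimitingSolution c h₀ ε hε h) :
    -- `ξ` is the weak limit of the regularized functions
    (∀ φ : ℝ × ℝ → ℝ, Continuous φ → HasCompactSupport φ → tsupport φ ⊆ EKG.domain →
      IntegrableOn (fun p : ℝ × ℝ => EKG.xi c (h p.1) p.2 * φ p) EKG.domain ∧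
      Tendsto (fun n => ∫ p in EKG.domain, EKG.xiReg c (ε n) (hε n p.1) p.2 * φ p) atTop
        (𝓝 (∫ p in EKG.domain, EKG.xi c (h p.1) p.2 * φ p))) ∧
    -- at almost all `u`: the limit defining `ξ` exists, continuity in `r`, limit at the center
    (∀ᵐ u ∂(volume.restrict (Ici (0 : ℝ))),
      (∀ r, 0 < r → Tendsto (EKG.xiTrunc c (h u) r) (𝓝[>] 0) (𝓝 (EKG.xi c (h u) r))) ∧
      ContinuousOn (fun r => EKG.xi c (h u) r / √(EKG.expNuLam 0 (h u) r)) (Ioi 0) ∧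
      Tendsto (fun r => EKG.xi c (h u) r / √(EKG.expNuLam 0 (h u) r)) (𝓝[>] 0) (𝓝 0)) ∧
    -- integrability in `u`
    (∀ u₀ : ℝ, 0 < u₀ →
      (∀ r, 0 < r → MemLp (fun u => EKG.xi c (h u) r / √(EKG.expNuLam 0 (h u) r)) 2
        (volume.restrict (Ioo 0 u₀))) ∧
      (∀ᵐ u ∂(volume.restrict (Ioo 0 u₀)), BddAbove (range fun r : Ioi (0 : ℝ) =>
        |EKG.xi c (h u) r / (max 1 (r : ℝ) * √(EKG.expNuLam 0 (h u) r))|)) ∧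
      MemLp (fun u => ⨆ r : Ioi (0 : ℝ),
        |EKG.xi c (h u) r / (max 1 (r : ℝ) * √(EKG.expNuLam 0 (h u) r))|) 2
        (volume.restrict (Ioo 0 u₀)) ∧
      Tendsto (fun r => ∫ u in (0 : ℝ)..u₀, EKG.xi c (h u) r ^ 2 / EKG.expNuLam 0 (h u) r)
        (𝓝[>] 0) (𝓝 0)) := by
  obtain ⟨N, C, hl⟩ := hlim.exists_isBoundedLimit hdata
  refine ⟨fun φ hφ hs hd => ?_, hl.ae_tendsto_and_continuousOn, fun u₀ hu₀ =>
    ⟨fun r hr => hl.memLp_xi_div hu₀ hr, (hl.memLp_iSup hu₀).1, (hl.memLp_iSup hu₀).2,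
      hl.tendsto_integral_xi_sq_div hu₀⟩⟩
  obtain ⟨h1, h2⟩ := hl.tendsto_integral_domain hφ hs hd
  -- The estimates concern the sequence shifted by N; a shift does not affect the limit.
  exact ⟨h1, (tendsto_add_atTop_iff_nat (f := fun n =>
    ∫ p in EKG.domain, EKG.xiReg c (ε n) (hε n p.1) p.2 * φ p) N).1 h2⟩
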